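/- Let $\mathbb B=(\{0,1\},\vee,\wedge)$ be the Boolean semiring. For a finite Abelian group $\mathcal G$ (written additively) and $\alpha,\beta\colon\mathcal G\to\{0,1\}$, let $\alpha\star\beta$ be their product in the group semiring $\mathbb B[\mathcal G]$, i.e. $(\alpha\star\beta)(x)=\bigvee_{g\in\mathcal G}\alpha(g)\wedge\beta(x-g)$. A basis of $\mathcal G$ is a family $b_1,\dots,b_s\in\mathcal G$ such that every $g\in\mathcal G$ is uniquely of the form $g=i_1b_1+\dots+i_sb_s$ with $0\le i_j<r_j$, where $r_j$ is the order of $b_j$. The size of an integer $z$ is $1+\lceil\log_2(|z|+1)\rceil$, and the size of a rational $p/q$ in lowest terms is the sum of the sizes of $p$ and $q$. Theorem. There are an absolute constant $C$ and a single Word-RAM program over rational words (unit-cost addition, subtraction, multiplication, division, rounding down to an integer, comparison, and reading or writing of array cells addressed by computed indices) with the following property. Let $\mathcal G$ be a finite Abelian group of order $n\ge 2$ with a basis $b_1,\dots,b_s$ of nonzero elements, and let $\alpha,\beta\in\mathbb B[\mathcal G]$. Given $s$, the orders $r_1,\dots,r_s$ and the tables of the values of $\alpha$ and $\beta$, in which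 the value at $i_1b_1+\dots+i_sb_s$ is stored at position $\sum_j i_j\prod_{k<j}r_k$, the program halts with the table of $\alpha\star\beta$, after at most $C\,n\log n$ elementary steps, and all rational numbers that occur in the computation have size at most $C\log n$. -/

import Mathlib

/-! ### Encoding sizes -/

/-- `size z = 1 + ⌈log₂ (|z| + 1)⌉`. -/
def intSize (z : ℤ) : ℕ := 1 + Nat.clog 2 (z.natAbs + 1)

/-- `size (p / q) = size p + size q` for coprime `p`, `q`. -/
def ratSize (r : ℚ) : ℕ := intSize r.num + intSize (r.den : ℤ)

/-! ### Word-RAM with rational words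

A machine has registers and finitely many arrays (both named by natural numbers; a program mentions
only finitely many of them), whose cells hold rational numbers. -/

namespace WordRAM

structure State where
  reg : ℕ → ℚ
  mem : ℕ → ℕ → ℚ

def State.setReg (σ : State) (x : ℕ) (v : ℚ) : State :=
  { σ with reg := Function.update σ.reg x v }

def State.setMem (σ : State) (a i : ℕ) (v : ℚ) : State :=
  { σ with mem := Function.update σ.mem a (Function.update (σ.mem a) i v) }

/-- Expressions; `get a i` reads the cell with (computed) index `i` of the array `a`. -/
inductive Expr where
  | const (q : ℚ)
  | reg (x : ℕ)
  | get (a : ℕ) (i : Expr)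
  | add (e f : Expr)
  | sub (e f : Expr)
  | mul (e f : Expr)
  | div (e f : Expr)
  | floor (e : Expr)

/-- The number of elementary operations that the evaluation of an expression takes: every constant,
register access, array access and arithmetic operation costs one unit. -/
def Expr.cost : Expr → ℕ
  | .const _ => 1
  | .reg _ => 1
  | .get _ i => i.cost + 1
  | .add e f => e.cost + f.cost + 1
  | .sub e f => e.cost + f.cost + 1
  | .mul e f => e.cost + f.cost + 1
  | .div e f => e.cost + f.cost + 1
  | .floor e => e.cost + 1

/-- The value of an expression; meaningful when `Expr.Valid` holds. -/
def Expr.eval (σ : State) : Expr → ℚ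
  | .const q => q
  | .reg x => σ.reg x
  | .get a i => σ.mem a ⌊i.eval σ⌋₊
  | .add e f => e.eval σ + f.eval σ
  | .sub e f => e.eval σ - f.eval σ
  | .mul e f => e.eval σ * f.eval σ
  | .div e f => e.eval σ / f.eval σ
  | .floor e => (⌊e.eval σ⌋ : ℚ)

/-- The evaluation is legal with words of size `W`: no operand and no intermediate result is larger
than `W`, array indices are natural numbers, and there is no division by zero. -/
def Expr.Valid (W : ℕ) (σ : State) : Expr → Prop
  | .const q => ratSize q ≤ W
  | .reg x => ratSize (σ.reg x) ≤ W
  | .get a i => i.Valid W σ ∧ (∃ k : ℕ, i.eval σ = k) ∧ ratSize ((Expr.get a i).eval σ) ≤ W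
  | .add e f => e.Valid W σ ∧ f.Valid W σ ∧ ratSize ((Expr.add e f).eval σ) ≤ W
  | .sub e f => e.Valid W σ ∧ f.Valid W σ ∧ ratSize ((Expr.sub e f).eval σ) ≤ W
  | .mul e f => e.Valid W σ ∧ f.Valid W σ ∧ ratSize ((Expr.mul e f).eval σ) ≤ W
  | .div e f => e.Valid W σ ∧ f.Valid W σ ∧ f.eval σ ≠ 0 ∧ ratSize ((Expr.div e f).eval σ) ≤ W
  | .floor e => e.Valid W σ ∧ ratSize ((Expr.floor e).eval σ) ≤ W

/-- Programs: `assign x e` is `x ← e`, `store a i e` is `a[i] ← e`, `cond e f c d` is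
`if e < f then c else d`, and `loop e f c` is `while e < f do c`. -/
inductive Program where
  | skip
  | assign (x : ℕ) (e : Expr)
  | store (a : ℕ) (i e : Expr)
  | seq (c d : Program)
  | cond (e f : Expr) (c d : Program)
  | loop (e f : Expr) (c : Program)

/-- `Exec W c σ t τ`: with words of size `W`, the program `c` started in the state `σ` halts in the
state `τ` after `t` steps. An illegal operation has no successor. -/
inductive Exec (W : ℕ) : Program → State → ℕ → State → Prop where
  | skip (σ : State) : Exec W .skip σ 1 σ
  | assign (σ : State) (x : ℕ) (e : Expr) (he : e.Valid W σ) :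
      Exec W (.assign x e) σ (e.cost + 1) (σ.setReg x (e.eval σ))
  | store (σ : State) (a k : ℕ) (i e : Expr) (hi : i.Valid W σ) (hk : i.eval σ = k)
      (he : e.Valid W σ) :
      Exec W (.store a i e) σ (i.cost + e.cost + 1) (σ.setMem a k (e.eval σ))
  | seq (σ τ υ : State) (t u : ℕ) (c d : Program) (hc : Exec W c σ t τ) (hd : Exec W d τ u υ) :
      Exec W (.seq c d) σ (t + u) υ
  | cond_true (σ τ : State) (t : ℕ) (e f : Expr) (c d : Program) (he : e.Valid W σ)
      (hf : f.Valid W σ) (h : e.eval σ < f.eval σ) (hc : Exec W c σ t τ) :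
      Exec W (.cond e f c d) σ (e.cost + f.cost + 1 + t) τ
  | cond_false (σ τ : State) (t : ℕ) (e f : Expr) (c d : Program) (he : e.Valid W σ)
      (hf : f.Valid W σ) (h : ¬ e.eval σ < f.eval σ) (hd : Exec W d σ t τ) :
      Exec W (.cond e f c d) σ (e.cost + f.cost + 1 + t) τ
  | loop_true (σ τ υ : State) (t u : ℕ) (e f : Expr) (c : Program) (he : e.Valid W σ)
      (hf : f.Valid W σ) (h : e.eval σ < f.eval σ) (hc : Exec W c σ t τ)
      (hl : Exec W (.loop e f c) τ u υ) :
      Exec W (.loop e f c) σ (e.cost + f.cost + 1 + t + u) υ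
  | loop_false (σ : State) (e f : Expr) (c : Program) (he : e.Valid W σ)
      (hf : f.Valid W σ) (h : ¬ e.eval σ < f.eval σ) :
      Exec W (.loop e f c) σ (e.cost + f.cost + 1) σ

end WordRAM

/-! ### Boolean convolution over a finite Abelian group given by a basis -/

/-- Convolution in the group semiring `𝔹[G]` over `𝔹 = ({0,1}, ∨, ∧)`:
`(α ⋆ β) x = ⋁ g, α g ∧ β (x - g)`. -/
noncomputable def boolConv {G : Type*} [AddCommGroup G] [Fintype G] (α β : G → Bool) (x : G) : Bool :=
  Finset.univ.sup fun g => α g ⊓ β (x - g)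

/-- Every `g` is a unique combination `∑ j, i j • b j` with `0 ≤ i j < ord (b j)`. -/
def IsGroupBasis {G : Type*} [AddCommGroup G] {s : ℕ} (b : Fin s → G) : Prop :=
  ∀ g : G, ∃! i : (j : Fin s) → Fin (addOrderOf (b j)), ∑ j, (i j : ℕ) • b j = g

/-- The group element at position `p` of a table: `∑ j, i j • b j`, where the `i j` are the mixed
radix digits of `p = ∑ j, i j * ∏ k < j, ord (b k)`. -/
noncomputable def tableElem {G : Type*} [AddCommGroup G] {s : ℕ} (b : Fin s → G)
    (p : Fin (∏ j, addOrderOf (b j))) : G :=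
  ∑ j, (finPiFinEquiv.symm p j : ℕ) • b j

/-- The `0`/`1`-table of the values of `α : 𝔹[G]`, padded by zeros. -/
noncomputable def boolTable {G : Type*} [AddCommGroup G] {s : ℕ} (b : Fin s → G) (α : G → Bool) (p : ℕ) : ℚ :=
  if h : p < ∏ j, addOrderOf (b j) then (if α (tableElem b ⟨p, h⟩) then 1 else 0) else 0

/-- The input: register `0` holds the length `s` of the basis, array `0` holds the orders of the
basis elements, arrays `1` and `2` hold the tables of `α` and `β`; all other cells hold `0`. -/
noncomputable def convInput {G : Type*} [AddCommGroup G] {s : ℕ} (b : Fin s → G) (α β : G → Bool) :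
    WordRAM.State where
  reg x := if x = 0 then (s : ℚ) else 0
  mem a p :=
    if a = 0 then (if h : p < s then (addOrderOf (b ⟨p, h⟩) : ℚ) else 0)
    else if a = 1 then boolTable b α p
    else if a = 2 then boolTable b β p
    else 0

/-! Regard `α` and `β` as complex vectors with entries 0 and 1. In the group ring over `ℂ` the
coefficient of their product at `x` counts the pairs of support elements with sum `x`, and the
Boolean convolution is 1 exactly where this count is positive. Fourier transforms of the group,
which by the basis is a product of cyclic groups of orders `r 0, r 1, ...`, produce the counts:
transform both tables, multiply pointwise, conjugate, transform again. Orthogonality of characters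
(`sum_chi`, `dft_conj_mul`) gives `n` times the counts. Since counts are integers, an approximation
of `n` times the count with error below 1/2 suffices (`round_eq`, `error_lt_half`).

The transform is done digit by digit. Along a digit of radix `r`, Bluestein's identity (`bluestein`)
turns all `n / r` transforms of length `r` into cyclic convolutions of a length `L = 2 ^ k` with `2
r ≤ L ≤ 4 r`, and radix-2 steps (`fstep_bconv`, `bwd_mul_fwd`) evaluate these convolutions. This
costs `O(n log r)`, and the tables of roots of unity cost `O(r log n)`. As the radices are at least
2, their logarithms sum to `O(log n)` and they themselves sum to at most `n` (`sum_clog_le`,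
`sum_le_stride`), so the total is `O(n log n)`.

The roots of unity must be computed. Machin's series gives `π / 4`; then `exp z` is approximated by
`1 + z / 2 ^ K` squared `K` times (`Runs.rootProg`), which leaves an error of order `(3/4) ^ K`. All
stored complex numbers are rounded to multiples of `1 / 16 ^ K`. The relation `Cl δ A` measures the
error in units of a magnitude bound `A`; a transform multiplies `A` by at most `n ^ 55`. With `K =
600 ⌈log₂ n⌉` the accuracy outweighs the total factor `96 n ^ 165`, while every stored number has
height at most `2 ^ (8 K)`, that is, size `O(log n)`.

Legality of machine operations is handled once: an expression of bounded cost over numbers of height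
at most `H` has height at most a fixed power of `H` (`Expr.ht_eval_le`). Programs are then verified
by invariants with time bounds (`Runs`). -/

namespace WordRAM

/-! ### Heights of rational numbers -/

/-- The height of a rational number. -/
def ht (q : ℚ) : ℕ := max q.num.natAbs q.den

theorem one_le_ht (q : ℚ) : 1 ≤ ht q := le_max_of_le_right q.den_pos

theorem ht_div_le {a b : ℤ} (hb : b ≠ 0) {B : ℕ} (ha : a.natAbs ≤ B) (hb' : b.natAbs ≤ B) :
    ht ((a : ℚ) / b) ≤ B := by
  have h0 : 1 ≤ B := le_trans (Nat.one_le_iff_ne_zero.2 (Int.natAbs_ne_zero.2 hb)) hb'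
  rw [← Rat.divInt_eq_div]
  refine max_le ?_ ?_
  · rcases eq_or_ne a 0 with rfl | h
    · simp
    · exact (Nat.le_of_dvd (Int.natAbs_pos.2 h) (Int.natAbs_dvd_natAbs.2 (Rat.num_dvd a hb))).trans ha
  · have := Int.natAbs_dvd_natAbs.2 (Rat.den_dvd a b)
    exact (Nat.le_of_dvd (Int.natAbs_pos.2 hb) (by simpa using this)).trans hb'

theorem ht_natCast (k : ℕ) : ht (k : ℚ) = max k 1 := by simp [ht]

theorem natAbs_num_le_ht (q : ℚ) : q.num.natAbs ≤ ht q := le_max_left _ _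

theorem den_le_ht (q : ℚ) : q.den ≤ ht q := le_max_right _ _

theorem ht_add_le (q r : ℚ) : ht (q + r) ≤ 2 * (ht q * ht r) := by
  have e : q + r = ((q.num * r.den + r.num * q.den : ℤ) : ℚ) / ((q.den * r.den : ℕ) : ℤ) := by
    have h1 : (q.den : ℚ) ≠ 0 := by exact_mod_cast q.den_nz
    have h2 : (r.den : ℚ) ≠ 0 := by exact_mod_cast r.den_nz
    conv_lhs => rw [← Rat.num_div_den q, ← Rat.num_div_den r]
    push_cast
    field_simp
  rw [e]
  have h1 := Nat.mul_le_mul (natAbs_num_le_ht q) (den_le_ht r)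
  have h2 := Nat.mul_le_mul (natAbs_num_le_ht r) (den_le_ht q)
  have h3 := Nat.mul_le_mul (den_le_ht q) (den_le_ht r)
  refine ht_div_le (by simp) ?_ ?_
  · refine (Int.natAbs_add_le _ _).trans ?_
    rw [Int.natAbs_mul, Int.natAbs_mul, Int.natAbs_natCast, Int.natAbs_natCast]
    nlinarith
  · rw [Int.natAbs_natCast]; omega

theorem ht_neg (q : ℚ) : ht (-q) = ht q := by simp [ht]

theorem ht_sub_le (q r : ℚ) : ht (q - r) ≤ 2 * (ht q * ht r) := by
  rw [sub_eq_add_neg, ← ht_neg r]; exact ht_add_le _ _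

theorem ht_mul_le (q r : ℚ) : ht (q * r) ≤ ht q * ht r := by
  have e : q * r = ((q.num * r.num : ℤ) : ℚ) / ((q.den * r.den : ℕ) : ℤ) := by
    have h1 : (q.den : ℚ) ≠ 0 := by exact_mod_cast q.den_nz
    have h2 : (r.den : ℚ) ≠ 0 := by exact_mod_cast r.den_nz
    conv_lhs => rw [← Rat.num_div_den q, ← Rat.num_div_den r]
    push_cast
    field_simp
  rw [e]
  refine ht_div_le (by simp) ?_ ?_
  · rw [Int.natAbs_mul]; exact Nat.mul_le_mul (natAbs_num_le_ht q) (natAbs_num_le_ht r)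
  · rw [Int.natAbs_natCast]; exact Nat.mul_le_mul (den_le_ht q) (den_le_ht r)

theorem ht_inv_le (q : ℚ) : ht q⁻¹ ≤ ht q := by
  rcases eq_or_ne q 0 with rfl | h
  · simp
  have e : q⁻¹ = ((q.den : ℤ) : ℚ) / q.num := by
    conv_lhs => rw [← Rat.num_div_den q]
    simp
  rw [e]
  exact ht_div_le (Rat.num_ne_zero.2 h) (by simpa using den_le_ht q) (natAbs_num_le_ht q)

theorem ht_div_le_mul (q r : ℚ) : ht (q / r) ≤ ht q * ht r := by
  rw [div_eq_mul_inv]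
  exact (ht_mul_le _ _).trans (Nat.mul_le_mul_left _ (ht_inv_le r))

theorem ht_floor_le (q : ℚ) : ht (⌊q⌋ : ℚ) ≤ ht q := by
  have hd : (0 : ℤ) < q.den := by exact_mod_cast q.den_pos
  have h : ⌊q⌋.natAbs ≤ q.num.natAbs := by
    rw [Rat.floor_def']
    have := Int.natAbs_ediv_le_natAbs q.num q.den
    exact this
  refine max_le ?_ ?_
  · simpa using h.trans (natAbs_num_le_ht q)
  · simpa using one_le_ht q

/-- Sizes are logarithmic in heights. Heights are easier to track through arithmetic because they
are submultiplicative up to a factor 2. -/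
theorem ratSize_le (q : ℚ) : ratSize q ≤ 2 * (1 + Nat.clog 2 (ht q + 1)) := by
  have h1 := Nat.clog_mono_right 2 (Nat.add_le_add_right (natAbs_num_le_ht q) 1)
  have h2 := Nat.clog_mono_right 2 (Nat.add_le_add_right (den_le_ht q) 1)
  simp only [ratSize, intSize, Int.natAbs_natCast]
  omega

/-! ### Legality of the evaluation of expressions -/

/-- All constants in the expression have height at most `H`. -/
def Expr.ConstLe (H : ℕ) : Expr → Prop
  | .const q => ht q ≤ H
  | .reg _ => True
  | .get _ i => i.ConstLe H
  | .add e f => e.ConstLe H ∧ f.ConstLe H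
  | .sub e f => e.ConstLe H ∧ f.ConstLe H
  | .mul e f => e.ConstLe H ∧ f.ConstLe H
  | .div e f => e.ConstLe H ∧ f.ConstLe H
  | .floor e => e.ConstLe H

/-- Array indices are natural numbers and there is no division by zero. -/
def Expr.Ok (σ : State) : Expr → Prop
  | .const _ => True
  | .reg _ => True
  | .get _ i => i.Ok σ ∧ ∃ k : ℕ, i.eval σ = k
  | .add e f => e.Ok σ ∧ f.Ok σ
  | .sub e f => e.Ok σ ∧ f.Ok σ
  | .mul e f => e.Ok σ ∧ f.Ok σ
  | .div e f => e.Ok σ ∧ f.Ok σ ∧ f.eval σ ≠ 0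
  | .floor e => e.Ok σ

theorem Expr.one_le_cost (e : Expr) : 1 ≤ e.cost := by cases e <;> simp [Expr.cost]

/-- An operation at worst multiplies the heights of its operands and doubles the result. The unit of
cost of the operation contributes a factor `H ≥ 2`, which pays for the doubling. -/
theorem Expr.ht_eval_le {H : ℕ} (hH : 2 ≤ H) {σ : State} (hr : ∀ x, ht (σ.reg x) ≤ H)
    (hm : ∀ a i, ht (σ.mem a i) ≤ H) (e : Expr) (hc : e.ConstLe H) :
    ht (e.eval σ) ≤ H ^ e.cost := by
  have key : ∀ {a b u v : ℕ}, u ≤ H ^ a → v ≤ H ^ b → 2 * (u * v) ≤ H ^ (a + b + 1) := by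
    intro a b u v h1 h2
    rw [pow_succ, pow_add]
    calc 2 * (u * v) ≤ H * (H ^ a * H ^ b) := Nat.mul_le_mul hH (Nat.mul_le_mul h1 h2)
      _ = _ := mul_comm _ _
  induction e with
  | const q => simpa [Expr.eval, Expr.cost, Expr.ConstLe] using hc
  | reg x => simpa [Expr.eval, Expr.cost] using hr x
  | get a i ih =>
    exact (hm _ _).trans (Nat.le_self_pow (by simp [Expr.cost]) _)
  | add e f he hf => exact (ht_add_le _ _).trans (key (he hc.1) (hf hc.2))
  | sub e f he hf => exact (ht_sub_le _ _).trans (key (he hc.1) (hf hc.2))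
  | mul e f he hf =>
    exact (ht_mul_le _ _).trans ((Nat.le_mul_of_pos_left _ two_pos).trans (key (he hc.1) (hf hc.2)))
  | div e f he hf =>
    exact (ht_div_le_mul _ _).trans
      ((Nat.le_mul_of_pos_left _ two_pos).trans (key (he hc.1) (hf hc.2)))
  | floor e he =>
    exact (ht_floor_le _).trans ((he hc).trans (Nat.pow_le_pow_right (by omega) (by simp [Expr.cost])))

/-- A bound for the cost of the expressions of the programs below. -/
def costBound : ℕ := 20000

/-- Words of size `W` can hold everything that expressions of cost at most `costBound` produce from
numbers of height at most `H`. -/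
structure Fits (W H : ℕ) : Prop where
  two_le : 64 ≤ H
  size_le : ∀ q : ℚ, ht q ≤ H ^ costBound → ratSize q ≤ W

/-- A subexpression costs no more than the whole expression, so the same height bound covers every
intermediate result. What remains of legality is `Expr.Ok`, which does not involve sizes. -/
theorem Expr.valid_of_ok {W H : ℕ} (hF : Fits W H) {σ : State} (hr : ∀ x, ht (σ.reg x) ≤ H)
    (hm : ∀ a i, ht (σ.mem a i) ≤ H) (e : Expr) (hc : e.ConstLe H) (hcost : e.cost ≤ costBound)
    (hok : e.Ok σ) : e.Valid W σ := by
  have h2 := hF.two_le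
  have main : ∀ e : Expr, e.ConstLe H → e.cost ≤ costBound → ratSize (e.eval σ) ≤ W := fun e hc h =>
    hF.size_le _ ((e.ht_eval_le (by omega) hr hm hc).trans (Nat.pow_le_pow_right (by omega) h))
  have hself := main e hc hcost
  induction e with
  | const q => exact hself
  | reg x => exact hself
  | get a i ih =>
    have hi : i.cost ≤ costBound := by simp only [Expr.cost] at hcost; omega
    exact ⟨ih hc hi hok.1 (main i hc hi), hok.2, hself⟩
  | add e f he hf =>
    have h1 : e.cost ≤ costBound := by simp only [Expr.cost] at hcost; omega
    have h2 : f.cost ≤ costBound := by simp only [Expr.cost] at hcost; omega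
    exact ⟨he hc.1 h1 hok.1 (main e hc.1 h1), hf hc.2 h2 hok.2 (main f hc.2 h2), hself⟩
  | sub e f he hf =>
    have h1 : e.cost ≤ costBound := by simp only [Expr.cost] at hcost; omega
    have h2 : f.cost ≤ costBound := by simp only [Expr.cost] at hcost; omega
    exact ⟨he hc.1 h1 hok.1 (main e hc.1 h1), hf hc.2 h2 hok.2 (main f hc.2 h2), hself⟩
  | mul e f he hf =>
    have h1 : e.cost ≤ costBound := by simp only [Expr.cost] at hcost; omega
    have h2 : f.cost ≤ costBound := by simp only [Expr.cost] at hcost; omega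
    exact ⟨he hc.1 h1 hok.1 (main e hc.1 h1), hf hc.2 h2 hok.2 (main f hc.2 h2), hself⟩
  | div e f he hf =>
    have h1 : e.cost ≤ costBound := by simp only [Expr.cost] at hcost; omega
    have h2 : f.cost ≤ costBound := by simp only [Expr.cost] at hcost; omega
    exact ⟨he hc.1 h1 hok.1 (main e hc.1 h1), hf hc.2 h2 hok.2.1 (main f hc.2 h2), hok.2.2, hself⟩
  | floor e he =>
    have h1 : e.cost ≤ costBound := by simp only [Expr.cost] at hcost; omega
    exact ⟨he hc h1 hok (main e hc h1), hself⟩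

/-- The expression does not read the array `a`. -/
def Expr.avoids (a : ℕ) : Expr → Bool
  | .const _ => true
  | .reg _ => true
  | .get b i => b != a && i.avoids a
  | .add e f => e.avoids a && f.avoids a
  | .sub e f => e.avoids a && f.avoids a
  | .mul e f => e.avoids a && f.avoids a
  | .div e f => e.avoids a && f.avoids a
  | .floor e => e.avoids a

/-- This lets a loop write to `a` while it evaluates an expression that refers to the contents
before the loop. -/
theorem Expr.eval_congr {a : ℕ} {σ τ : State} (hr : σ.reg = τ.reg)
    (hm : ∀ b, b ≠ a → σ.mem b = τ.mem b) (e : Expr) (he : e.avoids a = true) :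
    e.eval σ = e.eval τ := by
  induction e with
  | const q => rfl
  | reg x => simp [Expr.eval, hr]
  | get b i ih =>
    simp only [Expr.avoids, Bool.and_eq_true, bne_iff_ne, ne_eq] at he
    simp [Expr.eval, hm b he.1, ih he.2]
  | add e f h1 h2 =>
    simp only [Expr.avoids, Bool.and_eq_true] at he; simp [Expr.eval, h1 he.1, h2 he.2]
  | sub e f h1 h2 =>
    simp only [Expr.avoids, Bool.and_eq_true] at he; simp [Expr.eval, h1 he.1, h2 he.2]
  | mul e f h1 h2 =>
    simp only [Expr.avoids, Bool.and_eq_true] at he; simp [Expr.eval, h1 he.1, h2 he.2]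
  | div e f h1 h2 =>
    simp only [Expr.avoids, Bool.and_eq_true] at he; simp [Expr.eval, h1 he.1, h2 he.2]
  | floor e h1 => simp only [Expr.avoids] at he; simp [Expr.eval, h1 he]

theorem Expr.ok_congr {a : ℕ} {σ τ : State} (hr : σ.reg = τ.reg)
    (hm : ∀ b, b ≠ a → σ.mem b = τ.mem b) (e : Expr) (he : e.avoids a = true) (hok : e.Ok σ) :
    e.Ok τ := by
  induction e with
  | const q => trivial
  | reg x => trivial
  | get b i ih =>
    simp only [Expr.avoids, Bool.and_eq_true, bne_iff_ne, ne_eq] at he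
    exact ⟨ih he.2 hok.1, by rw [← Expr.eval_congr hr hm i he.2]; exact hok.2⟩
  | add e f h1 h2 =>
    simp only [Expr.avoids, Bool.and_eq_true] at he; exact ⟨h1 he.1 hok.1, h2 he.2 hok.2⟩
  | sub e f h1 h2 =>
    simp only [Expr.avoids, Bool.and_eq_true] at he; exact ⟨h1 he.1 hok.1, h2 he.2 hok.2⟩
  | mul e f h1 h2 =>
    simp only [Expr.avoids, Bool.and_eq_true] at he; exact ⟨h1 he.1 hok.1, h2 he.2 hok.2⟩
  | div e f h1 h2 =>
    simp only [Expr.avoids, Bool.and_eq_true] at he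
    exact ⟨h1 he.1 hok.1, h2 he.2 hok.2.1, by rw [← Expr.eval_congr hr hm f he.2]; exact hok.2.2⟩
  | floor e h1 => simp only [Expr.avoids] at he; exact h1 he hok

/-! ### States whose registers hold natural numbers -/

/-- A state whose registers hold natural numbers. -/
@[ext] structure NState where
  reg : ℕ → ℕ
  mem : ℕ → ℕ → ℚ

def NState.st (h : NState) : State := ⟨fun x => h.reg x, h.mem⟩

def NState.set (h : NState) (x k : ℕ) : NState := { h with reg := Function.update h.reg x k }

@[simp] theorem NState.set_mem (h : NState) (x k : ℕ) : (h.set x k).mem = h.mem := rfl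

@[simp] theorem NState.set_reg_self (h : NState) (x k : ℕ) : (h.set x k).reg x = k := by
  simp [NState.set]

@[simp] theorem NState.set_reg_ne (h : NState) {x y : ℕ} (hy : y ≠ x) (k : ℕ) :
    (h.set x k).reg y = h.reg y := by
  simp [NState.set, hy]

theorem NState.setReg_st (h : NState) (x k : ℕ) : h.st.setReg x k = (h.set x k).st := by
  simp only [NState.st, State.setReg, NState.set, State.mk.injEq, and_true]
  funext y
  by_cases hy : y = x
  · subst hy; simp
  · simp [hy]

/-- All numbers in the state have height at most `H`. -/
structure NState.Bd (H : ℕ) (h : NState) : Prop where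
  reg_le : ∀ x, h.reg x ≤ H
  mem_le : ∀ a i, ht (h.mem a i) ≤ H

theorem NState.Bd.set {H : ℕ} {h : NState} (hb : h.Bd H) (x : ℕ) {k : ℕ} (hk : k ≤ H) :
    (h.set x k).Bd H := by
  refine ⟨fun y => ?_, hb.mem_le⟩
  by_cases hy : y = x
  · subst hy; simpa using hk
  · simpa [hy] using hb.reg_le y

theorem NState.Bd.valid {W H : ℕ} (hF : Fits W H) {h : NState} (hb : h.Bd H) {e : Expr}
    (hc : e.ConstLe H) (hcost : e.cost ≤ costBound) (hok : e.Ok h.st) : e.Valid W h.st := by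
  refine e.valid_of_ok hF (fun x => ?_) hb.mem_le hc hcost hok
  have := hF.two_le
  simp only [NState.st, ht_natCast]
  exact max_le (hb.reg_le x) (by omega)

/-- From `h` the program halts within `t` steps, in a bounded state with natural registers that
satisfies `Q`. -/
def Runs (W H : ℕ) (P : Program) (h : NState) (t : ℕ) (Q : NState → Prop) : Prop :=
  ∃ t' ≤ t, ∃ h' : NState, Exec W P h.st t' h'.st ∧ h'.Bd H ∧ Q h'

variable {W H : ℕ}

/-! ### Rules of a program logic with time bounds -/

theorem Runs.mono {P : Program} {h : NState} {t u : ℕ} {Q R : NState → Prop}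
    (hr : Runs W H P h t Q) (htu : t ≤ u) (hQ : ∀ h', h'.Bd H → Q h' → R h') :
    Runs W H P h u R := by
  obtain ⟨t', h1, h', h2, h3, h4⟩ := hr
  exact ⟨t', h1.trans htu, h', h2, h3, hQ _ h3 h4⟩

theorem Runs.seq {P P' : Program} {h : NState} {t u : ℕ} {Q R : NState → Prop}
    (h1 : Runs W H P h t Q) (h2 : ∀ h', h'.Bd H → Q h' → Runs W H P' h' u R) :
    Runs W H (.seq P P') h (t + u) R := by
  obtain ⟨t', ht, h', he, hb, hq⟩ := h1
  obtain ⟨u', hu, h'', he', hb', hr⟩ := h2 h' hb hq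
  exact ⟨t' + u', by omega, h'', .seq _ _ _ _ _ _ _ he he', hb', hr⟩

theorem Runs.assign {h : NState} (hF : Fits W H) (hb : h.Bd H) {x : ℕ} {e : Expr} {k : ℕ}
    (hc : e.ConstLe H) (hcost : e.cost ≤ costBound) (hok : e.Ok h.st) (hk : e.eval h.st = k)
    (hkH : k ≤ H) : Runs W H (.assign x e) h (costBound + 1) (fun h' => h' = h.set x k) := by
  refine ⟨e.cost + 1, by omega, h.set x k, ?_, hb.set x hkH, rfl⟩
  have := Exec.assign (W := W) h.st x e (hb.valid hF hc hcost hok)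
  rwa [hk, NState.setReg_st] at this

/-- The invariant is indexed by the number of completed iterations and decides the test, so the loop
runs exactly `cnt` times. The induction is on the number of iterations left. -/
theorem Runs.loop {e f : Expr} {c : Program} (cnt : ℕ) (I : ℕ → NState → Prop) (tb : ℕ → ℕ)
    (hv : ∀ k ≤ cnt, ∀ h : NState, h.Bd H → I k h →
      e.Valid W h.st ∧ f.Valid W h.st ∧ (e.eval h.st < f.eval h.st ↔ k < cnt))
    (hbody : ∀ k < cnt, ∀ h : NState, h.Bd H → I k h → Runs W H c h (tb k) (I (k + 1)))
    {h : NState} (hb : h.Bd H) (h0 : I 0 h) :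
    Runs W H (.loop e f c) h
      (∑ k ∈ Finset.range cnt, (tb k + (e.cost + f.cost + 1)) + (e.cost + f.cost + 1)) (I cnt) := by
  have main : ∀ d k, k + d = cnt → ∀ h : NState, h.Bd H → I k h →
      Runs W H (.loop e f c) h
        (∑ i ∈ Finset.range d, (tb (k + i) + (e.cost + f.cost + 1)) + (e.cost + f.cost + 1))
        (I cnt) := by
    intro d
    induction d with
    | zero =>
      intro k hk h hb hI
      obtain rfl : k = cnt := by omega
      obtain ⟨v1, v2, v3⟩ := hv k le_rfl h hb hI
      exact ⟨_, by simp, h, .loop_false _ _ _ _ v1 v2 (by simp [v3]), hb, hI⟩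
    | succ d ih =>
      intro k hk h hb hI
      obtain ⟨v1, v2, v3⟩ := hv k (by omega) h hb hI
      obtain ⟨t, h1, h', h2, h3, h4⟩ := hbody k (by omega) h hb hI
      obtain ⟨u, g1, h'', g2, g3, g4⟩ := ih (k + 1) (by omega) h' h3 h4
      refine ⟨_, ?_, h'', .loop_true _ _ _ _ _ _ _ _ v1 v2 (v3.2 (by omega)) h2 g2, g3, g4⟩
      rw [Finset.sum_range_succ']
      have : ∀ i, k + 1 + i = k + (i + 1) := fun i => by ring
      simp only [this] at g1
      simp only [add_zero]
      omega
  simpa using main cnt 0 (by omega) h hb h0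

/-! ### Natural and complex expressions -/

/-- Expressions for natural numbers, with the division and the remainder of natural numbers. -/
inductive NE where
  | nat (k : ℕ)
  | reg (x : ℕ)
  | add (e f : NE)
  | mul (e f : NE)
  | div (e f : NE)
  | mod (e f : NE)

def NE.eval (ρ : ℕ → ℕ) : NE → ℕ
  | .nat k => k
  | .reg x => ρ x
  | .add e f => e.eval ρ + f.eval ρ
  | .mul e f => e.eval ρ * f.eval ρ
  | .div e f => e.eval ρ / f.eval ρ
  | .mod e f => e.eval ρ % f.eval ρ

def NE.Ok (ρ : ℕ → ℕ) : NE → Prop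
  | .nat _ => True
  | .reg _ => True
  | .add e f => e.Ok ρ ∧ f.Ok ρ
  | .mul e f => e.Ok ρ ∧ f.Ok ρ
  | .div e f => e.Ok ρ ∧ f.Ok ρ ∧ f.eval ρ ≠ 0
  | .mod e f => e.Ok ρ ∧ f.Ok ρ ∧ f.eval ρ ≠ 0

/-- All constants are at most `64`. -/
def NE.small : NE → Bool
  | .nat k => k ≤ 64
  | .reg _ => true
  | .add e f => e.small && f.small
  | .mul e f => e.small && f.small
  | .div e f => e.small && f.small
  | .mod e f => e.small && f.small

/-- Integer quotients are floors of rational quotients, and the remainder is the dividend minus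
divisor times quotient. There is no subtraction in `NE`, so all values are natural numbers. -/
def NE.comp : NE → Expr
  | .nat k => .const k
  | .reg x => .reg x
  | .add e f => .add e.comp f.comp
  | .mul e f => .mul e.comp f.comp
  | .div e f => .floor (.div e.comp f.comp)
  | .mod e f => .sub e.comp (.mul f.comp (.floor (.div e.comp f.comp)))

theorem NE.comp_eval (h : NState) (e : NE) : e.comp.eval h.st = e.eval h.reg := by
  induction e with
  | nat k => rfl
  | reg x => rfl
  | add e f he hf => simp [NE.comp, Expr.eval, NE.eval, he, hf]
  | mul e f he hf => simp [NE.comp, Expr.eval, NE.eval, he, hf]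
  | div e f he hf =>
    simp only [NE.comp, Expr.eval, NE.eval, he, hf, Rat.floor_natCast_div_natCast]
    norm_cast
  | mod e f he hf =>
    simp only [NE.comp, Expr.eval, NE.eval, he, hf, Rat.floor_natCast_div_natCast]
    have := Nat.div_add_mod (e.eval h.reg) (f.eval h.reg)
    rw [sub_eq_iff_eq_add]
    have h2 : ((e.eval h.reg : ℕ) : ℚ) = (f.eval h.reg * (e.eval h.reg / f.eval h.reg) +
      e.eval h.reg % f.eval h.reg : ℕ) := by rw [this]
    have h3 : (((e.eval h.reg : ℤ) / (f.eval h.reg : ℤ) : ℤ) : ℚ) =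
      ((e.eval h.reg / f.eval h.reg : ℕ) : ℚ) := by norm_cast
    rw [h3, h2]; push_cast; ring

theorem NE.comp_ok (h : NState) (e : NE) (hok : e.Ok h.reg) : e.comp.Ok h.st := by
  induction e with
  | nat k => trivial
  | reg x => trivial
  | add e f he hf => exact ⟨he hok.1, hf hok.2⟩
  | mul e f he hf => exact ⟨he hok.1, hf hok.2⟩
  | div e f he hf =>
    exact ⟨he hok.1, hf hok.2.1, by rw [NE.comp_eval]; exact_mod_cast hok.2.2⟩
  | mod e f he hf =>
    exact ⟨he hok.1, hf hok.2.1, he hok.1, hf hok.2.1,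
      by rw [NE.comp_eval]; exact_mod_cast hok.2.2⟩

theorem NE.comp_constLe (hH : 64 ≤ H) (e : NE) (hs : e.small = true) : e.comp.ConstLe H := by
  induction e with
  | nat k =>
    simp only [NE.small, decide_eq_true_eq] at hs
    simp only [NE.comp, Expr.ConstLe, ht_natCast]
    exact max_le (le_trans hs hH) (by omega)
  | reg x => trivial
  | add e f he hf => simp only [NE.small, Bool.and_eq_true] at hs; exact ⟨he hs.1, hf hs.2⟩
  | mul e f he hf => simp only [NE.small, Bool.and_eq_true] at hs; exact ⟨he hs.1, hf hs.2⟩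
  | div e f he hf => simp only [NE.small, Bool.and_eq_true] at hs; exact ⟨he hs.1, hf hs.2⟩
  | mod e f he hf =>
    simp only [NE.small, Bool.and_eq_true] at hs
    exact ⟨he hs.1, hf hs.2, he hs.1, hf hs.2⟩

/-- `x ← e`. -/
def Program.nset (x : ℕ) (e : NE) : Program := .assign x e.comp

theorem Runs.assignNat {h : NState} (hF : Fits W H) (hb : h.Bd H) {x : ℕ} {e : NE}
    (hs : e.small = true) (hcost : e.comp.cost ≤ costBound) (hok : e.Ok h.reg)
    (hkH : e.eval h.reg ≤ H) :
    Runs W H (.nset x e) h (costBound + 1) (fun h' => h' = h.set x (e.eval h.reg)) :=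
  Runs.assign hF hb (e.comp_constLe hF.two_le hs) hcost (e.comp_ok h hok) (e.comp_eval h) hkH

/-- `for x < N do c`, where `c` changes neither `x` nor `N`. -/
def Program.forLt (x : ℕ) (N : NE) (c : Program) : Program :=
  .seq (.nset x (NE.nat 0))
    (.loop (.reg x) N.comp (.seq c (.nset x (NE.add (.reg x) (.nat 1)))))

/-- The body has to establish the next invariant for the state with the counter already advanced;
the increment then needs no further argument from the user of the rule. -/
theorem Runs.forLt (hF : Fits W H) {x : ℕ} {N : NE} {c : Program} (cnt : ℕ)
    (I : ℕ → NState → Prop) (tb : ℕ → ℕ) (hcntH : cnt ≤ H) (hs : N.small = true)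
    (hcost : N.comp.cost ≤ costBound)
    (hN : ∀ k ≤ cnt, ∀ h : NState, h.reg x = k → I k h → N.Ok h.reg ∧ N.eval h.reg = cnt)
    (hbody : ∀ k < cnt, ∀ h : NState, h.Bd H → h.reg x = k → I k h →
      Runs W H c h (tb k) (fun h' => h'.reg x = k ∧ I (k + 1) (h'.set x (k + 1))))
    {h : NState} (hb : h.Bd H) (h0 : I 0 (h.set x 0)) :
    Runs W H (.forLt x N c) h (∑ k ∈ Finset.range cnt, (tb k + 3 * costBound) + 3 * costBound)
      (fun h' => h'.reg x = cnt ∧ I cnt h') := by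
  have hcB : 100 ≤ costBound := by decide
  have h64 := hF.two_le
  have hl := fun h => Runs.loop (W := W) (H := H) (h := h) (e := .reg x) (f := N.comp)
    (c := .seq c (.nset x (NE.add (.reg x) (.nat 1)))) cnt
    (fun k h => h.reg x = k ∧ I k h) (fun k => tb k + (costBound + 1))
    (fun k hk h hb hI => by
      obtain ⟨h1, h2⟩ := hN k hk h hI.1 hI.2
      refine ⟨hb.valid hF trivial (by simp only [Expr.cost]; omega) trivial,
        hb.valid hF (N.comp_constLe h64 hs) hcost (N.comp_ok h h1), ?_⟩
      rw [NE.comp_eval, h2]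
      simp [Expr.eval, NState.st, hI.1])
    (fun k hk h hb hI => by
      refine Runs.seq (hbody k hk h hb hI.1 hI.2) (fun h' hb' hq => ?_)
      refine (Runs.assignNat hF hb' (e := NE.add (.reg x) (.nat 1)) rfl ?_ ?_ ?_).mono
        le_rfl ?_
      · simp only [NE.comp, Expr.cost]; omega
      · simp [NE.Ok]
      · simp only [NE.eval, hq.1]; omega
      · rintro h'' - rfl
        simp only [NE.eval, hq.1]
        exact ⟨by simp, hq.2⟩)
  refine (Runs.seq (u := ∑ k ∈ Finset.range cnt, (tb k + 3 * costBound) + 2 * costBound - 1)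
    (Runs.assignNat hF hb (e := NE.nat 0) rfl
    (by simp only [NE.comp, Expr.cost]; omega) trivial (by simp [NE.eval])) (fun h' hb' hq => ?_)).mono
    ?_ (fun _ _ h => h)
  · refine (hl h' hb' ?_).mono ?_ (fun _ _ h => h)
    · subst hq; exact ⟨by simp [NE.eval], h0⟩
    · have hN1 := N.comp.one_le_cost
      have : ∑ k ∈ Finset.range cnt, (tb k + (costBound + 1) + ((Expr.reg x).cost + N.comp.cost + 1))
          ≤ ∑ k ∈ Finset.range cnt, (tb k + 3 * costBound) :=
        Finset.sum_le_sum fun k _ => by simp only [Expr.cost]; omega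
      simp only [Expr.cost] at this ⊢
      omega
  · omega

end WordRAM

namespace WordRAM

variable {W H : ℕ}

/-! ### Array loops -/

/-- The register that serves as the index of the array loops. -/
abbrev ix : ℕ := 15

/-- The register that holds the denominator of the fixed point numbers. -/
abbrev rD : ℕ := 5

/-- `h` with the first `cnt` cells of the array `a` replaced by the values of `v`. -/
def NState.write (h : NState) (a cnt : ℕ) (v : ℕ → ℚ) : NState :=
  ⟨Function.update h.reg ix cnt,
    Function.update h.mem a (fun j => if j < cnt then v j else h.mem a j)⟩

/-- `for ix < reg y do a[ix] ← e`. -/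
def Program.fill (a y : ℕ) (e : Expr) : Program :=
  .forLt ix (.reg y) (.store a (.reg ix) e)

/-- As `e` does not read `a`, cells written earlier do not influence later ones. Each value may
therefore be computed in the state before the loop, with only the index register changed. -/
theorem Runs.fill (hF : Fits W H) {a y : ℕ} {e : Expr} {cnt : ℕ} (v : ℕ → ℚ) {h : NState}
    (hb : h.Bd H) (hy : y ≠ ix) (hcnt : h.reg y = cnt) (hc : e.ConstLe H)
    (hcost : e.cost ≤ costBound) (hav : e.avoids a = true)
    (hok : ∀ i < cnt, e.Ok (h.set ix i).st) (hv : ∀ i < cnt, e.eval (h.set ix i).st = v i)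
    (hvH : ∀ i < cnt, ht (v i) ≤ H) :
    Runs W H (.fill a y e) h ((cnt + 1) * (5 * costBound)) (fun h' => h' = h.write a cnt v) := by
  have hcB : 100 ≤ costBound := by decide
  have hcH : cnt ≤ H := hcnt ▸ hb.reg_le y
  refine (Runs.forLt hF (x := ix) (N := .reg y) cnt
    (fun k h' => (∀ z, z ≠ ix → h'.reg z = h.reg z) ∧ h'.mem = (h.write a k v).mem)
    (fun _ => costBound + 2) hcH rfl (by simp only [NE.comp, Expr.cost]; omega)
    (fun k _ h' _ hI => ⟨trivial, by simp only [NE.eval]; rw [hI.1 y hy, hcnt]⟩)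
    (fun k hk h' hb' hx hI => ?_) hb ⟨fun z hz => by simp [hz], ?_⟩).mono ?_ ?_
  · have hreg : (h.set ix k).st.reg = h'.st.reg := by
      funext z
      simp only [NState.st]
      by_cases hz : z = ix
      · subst hz; simp [hx]
      · simp [hz, hI.1 z hz]
    have hmem : ∀ b, b ≠ a → (h.set ix k).st.mem b = h'.st.mem b := by
      intro b hba
      simp [NState.st, hI.2, NState.write, hba]
    have hev : e.eval h'.st = v k := by rw [← Expr.eval_congr hreg hmem e hav, hv k hk]
    have hok' : e.Ok h'.st := Expr.ok_congr hreg hmem e hav (hok k hk)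
    refine ⟨(Expr.reg ix).cost + e.cost + 1, ?_,
      ⟨h'.reg, Function.update h'.mem a (Function.update (h'.mem a) k (v k))⟩, ?_, ?_, ?_⟩
    · simp only [Expr.cost]; omega
    · have := Exec.store (W := W) h'.st a k (.reg ix) e
        (hb'.valid hF trivial (by simp only [Expr.cost]; omega) trivial)
        (by simp [Expr.eval, NState.st, hx]) (hb'.valid hF hc hcost hok')
      rw [hev] at this
      exact this
    · refine ⟨hb'.reg_le, fun b i => ?_⟩
      by_cases hba : b = a
      · subst hba
        by_cases hi : i = k
        · subst hi; simpa using hvH _ hk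
        · simpa [hi] using hb'.mem_le _ _
      · simpa [hba] using hb'.mem_le _ _
    · refine ⟨hx, fun z hz => ?_, ?_⟩
      · simpa [hz] using hI.1 z hz
      · simp only [NState.set_mem, hI.2, NState.write, Function.update_self, Function.update_idem]
        congr 1
        funext j
        by_cases hj : j = k
        · subst hj; simp
        · have : j < k + 1 ↔ j < k := by omega
          simp [hj, this]
  · simp [NState.write]
  · simp only [Finset.sum_const, Finset.card_range, smul_eq_mul]
    nlinarith
  · rintro h' - ⟨h1, h2, h3⟩
    ext z
    · by_cases hz : z = ix
      · subst hz; simp [h1, NState.write]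
      · simp [h2 z hz, NState.write, hz]
    · rw [h3]

/-! ### Complex expressions -/

/-- The complex array `a`, whose real and imaginary parts are the arrays `4 + 2a` and `5 + 2a`. -/
noncomputable def NState.carr (h : NState) (a i : ℕ) : ℂ := ⟨h.mem (4 + 2 * a) i, h.mem (5 + 2 * a) i⟩

/-- Expressions for complex numbers; `rget` reads an array of rational numbers, `get` a complex
array, and `divN` divides by a natural number. -/
inductive CE where
  | nat (e : NE)
  | im
  | rget (a : ℕ) (i : NE)
  | get (a : ℕ) (i : NE)
  | add (e f : CE)
  | sub (e f : CE)
  | mul (e f : CE)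
  | conj (e : CE)
  | divN (e : CE) (k : NE)

noncomputable def CE.eval (h : NState) : CE → ℂ
  | .nat e => e.eval h.reg
  | .im => Complex.I
  | .rget a i => ((h.mem a (i.eval h.reg) : ℚ) : ℝ)
  | .get a i => h.carr a (i.eval h.reg)
  | .add e f => e.eval h + f.eval h
  | .sub e f => e.eval h - f.eval h
  | .mul e f => e.eval h * f.eval h
  | .conj e => (starRingEnd ℂ) (e.eval h)
  | .divN e k => e.eval h / k.eval h.reg

def CE.Ok (ρ : ℕ → ℕ) : CE → Prop
  | .nat e => e.Ok ρ
  | .im => True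
  | .rget _ i => i.Ok ρ
  | .get _ i => i.Ok ρ
  | .add e f => e.Ok ρ ∧ f.Ok ρ
  | .sub e f => e.Ok ρ ∧ f.Ok ρ
  | .mul e f => e.Ok ρ ∧ f.Ok ρ
  | .conj e => e.Ok ρ
  | .divN e k => e.Ok ρ ∧ k.Ok ρ ∧ k.eval ρ ≠ 0

/-- The expressions for the real and the imaginary part. -/
def CE.comp : CE → Expr × Expr
  | .nat e => (e.comp, .const 0)
  | .im => (.const 0, .const 1)
  | .rget a i => (.get a i.comp, .const 0)
  | .get a i => (.get (4 + 2 * a) i.comp, .get (5 + 2 * a) i.comp)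
  | .add e f => (.add e.comp.1 f.comp.1, .add e.comp.2 f.comp.2)
  | .sub e f => (.sub e.comp.1 f.comp.1, .sub e.comp.2 f.comp.2)
  | .mul e f => (.sub (.mul e.comp.1 f.comp.1) (.mul e.comp.2 f.comp.2),
      .add (.mul e.comp.1 f.comp.2) (.mul e.comp.2 f.comp.1))
  | .conj e => (e.comp.1, .sub (.const 0) e.comp.2)
  | .divN e k => (.div e.comp.1 k.comp, .div e.comp.2 k.comp)

theorem CE.comp_eval (h : NState) (e : CE) :
    ((e.comp.1.eval h.st : ℚ) : ℝ) = (e.eval h).re ∧ ((e.comp.2.eval h.st : ℚ) : ℝ) = (e.eval h).im := by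
  induction e with
  | nat e => simp [CE.comp, CE.eval, Expr.eval, NE.comp_eval]
  | im => simp [CE.comp, CE.eval, Expr.eval]
  | rget a i =>
    simp [CE.comp, CE.eval, Expr.eval, NE.comp_eval]
    simp [NState.st]
  | get a i =>
    simp only [CE.comp, CE.eval, Expr.eval, NE.comp_eval]
    simp [NState.st, NState.carr]
  | add e f he hf => simp [CE.comp, CE.eval, Expr.eval, he, hf]
  | sub e f he hf => simp [CE.comp, CE.eval, Expr.eval, he, hf]
  | mul e f he hf => simp [CE.comp, CE.eval, Expr.eval, he, hf]
  | conj e he => simp [CE.comp, CE.eval, Expr.eval, he]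
  | divN e k he =>
    simp [CE.comp, CE.eval, Expr.eval, he, NE.comp_eval]

theorem CE.comp_ok (h : NState) (e : CE) (hok : e.Ok h.reg) :
    e.comp.1.Ok h.st ∧ e.comp.2.Ok h.st := by
  induction e with
  | nat e => exact ⟨e.comp_ok h hok, trivial⟩
  | im => exact ⟨trivial, trivial⟩
  | rget a i => exact ⟨⟨i.comp_ok h hok, _, i.comp_eval h⟩, trivial⟩
  | get a i => exact ⟨⟨i.comp_ok h hok, _, i.comp_eval h⟩, ⟨i.comp_ok h hok, _, i.comp_eval h⟩⟩
  | add e f he hf => exact ⟨⟨(he hok.1).1, (hf hok.2).1⟩, ⟨(he hok.1).2, (hf hok.2).2⟩⟩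
  | sub e f he hf => exact ⟨⟨(he hok.1).1, (hf hok.2).1⟩, ⟨(he hok.1).2, (hf hok.2).2⟩⟩
  | mul e f he hf =>
    exact ⟨⟨⟨(he hok.1).1, (hf hok.2).1⟩, ⟨(he hok.1).2, (hf hok.2).2⟩⟩,
      ⟨⟨(he hok.1).1, (hf hok.2).2⟩, ⟨(he hok.1).2, (hf hok.2).1⟩⟩⟩
  | conj e he => exact ⟨(he hok).1, trivial, (he hok).2⟩
  | divN e k he =>
    have h1 : k.comp.eval h.st ≠ 0 := by rw [k.comp_eval]; exact_mod_cast hok.2.2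
    exact ⟨⟨(he hok.1).1, k.comp_ok h hok.2.1, h1⟩, ⟨(he hok.1).2, k.comp_ok h hok.2.1, h1⟩⟩

/-- All constants are at most `64`. -/
def CE.small : CE → Bool
  | .nat e => e.small
  | .im => true
  | .rget _ i => i.small
  | .get _ i => i.small
  | .add e f => e.small && f.small
  | .sub e f => e.small && f.small
  | .mul e f => e.small && f.small
  | .conj e => e.small
  | .divN e k => e.small && k.small

theorem CE.comp_constLe (hH : 64 ≤ H) (e : CE) (hs : e.small = true) :
    e.comp.1.ConstLe H ∧ e.comp.2.ConstLe H := by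
  have h0 : (Expr.const 0).ConstLe H := by
    have := ht_natCast 0
    simp only [Nat.cast_zero] at this
    simp only [Expr.ConstLe, this]; omega
  have h1 : (Expr.const 1).ConstLe H := by
    have := ht_natCast 1
    simp only [Nat.cast_one] at this
    simp only [Expr.ConstLe, this]; omega
  induction e with
  | nat e => exact ⟨e.comp_constLe hH hs, h0⟩
  | im => exact ⟨h0, h1⟩
  | rget a i => exact ⟨i.comp_constLe hH hs, h0⟩
  | get a i => exact ⟨i.comp_constLe hH hs, i.comp_constLe hH hs⟩
  | add e f he hf =>
    simp only [CE.small, Bool.and_eq_true] at hs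
    exact ⟨⟨(he hs.1).1, (hf hs.2).1⟩, ⟨(he hs.1).2, (hf hs.2).2⟩⟩
  | sub e f he hf =>
    simp only [CE.small, Bool.and_eq_true] at hs
    exact ⟨⟨(he hs.1).1, (hf hs.2).1⟩, ⟨(he hs.1).2, (hf hs.2).2⟩⟩
  | mul e f he hf =>
    simp only [CE.small, Bool.and_eq_true] at hs
    exact ⟨⟨⟨(he hs.1).1, (hf hs.2).1⟩, ⟨(he hs.1).2, (hf hs.2).2⟩⟩,
      ⟨⟨(he hs.1).1, (hf hs.2).2⟩, ⟨(he hs.1).2, (hf hs.2).1⟩⟩⟩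
  | conj e he => exact ⟨(he hs).1, h0, (he hs).2⟩
  | divN e k he =>
    simp only [CE.small, Bool.and_eq_true] at hs
    exact ⟨⟨(he hs.1).1, k.comp_constLe hH hs.2⟩, ⟨(he hs.1).2, k.comp_constLe hH hs.2⟩⟩

/-! ### Fixed point rounding -/

/-- Rounding down to a multiple of `1 / D`. -/
def rnd (D : ℕ) (q : ℚ) : ℚ := (⌊q * D⌋ : ℚ) / D

/-- Exact arithmetic would let denominators grow with the number of operations; a common denominator
`D` keeps the heights of stored numbers bounded throughout. -/
def Expr.rnd (e : Expr) : Expr := .div (.floor (.mul e (.reg rD))) (.reg rD)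

theorem Expr.rnd_eval (e : Expr) (h : NState) :
    e.rnd.eval h.st = WordRAM.rnd (h.reg rD) (e.eval h.st) := by
  simp [Expr.rnd, Expr.eval, WordRAM.rnd, NState.st]

theorem abs_rnd_sub_le {D : ℕ} (hD : 0 < D) (q : ℚ) : |((rnd D q : ℚ) : ℝ) - q| ≤ 1 / D := by
  have hD' : (0 : ℚ) < D := by exact_mod_cast hD
  have h1 := Int.floor_le (q * D)
  have h2 := Int.lt_floor_add_one (q * D)
  have e : rnd D q - q = (⌊q * D⌋ - q * D) / D := by
    rw [rnd, sub_div, mul_div_cancel_right₀ _ hD'.ne']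
  have : |rnd D q - q| ≤ 1 / D := by
    rw [e, abs_div, abs_of_pos hD']
    gcongr
    rw [abs_le]
    constructor <;> linarith
  have h : ((|rnd D q - q| : ℚ) : ℝ) ≤ ((1 / D : ℚ) : ℝ) := by exact_mod_cast this
  simpa using h

/-- The rounded number is `⌊q D⌋ / D`, and the numerator is at most `|q| D + 1 ≤ (|q| + 1) D` in
absolute value. -/
theorem ht_rnd_le {D : ℕ} (hD : 0 < D) {q : ℚ} (hH : (|(q : ℝ)| + 1) * D ≤ H) :
    ht (rnd D q) ≤ H := by
  have hD' : (1 : ℝ) ≤ D := by exact_mod_cast hD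
  have e : rnd D q = ((⌊q * D⌋ : ℤ) : ℚ) / ((D : ℤ) : ℚ) := by simp [rnd]
  rw [e]
  have hq := abs_nonneg (q : ℝ)
  refine ht_div_le (by exact_mod_cast hD.ne') ?_ ?_
  · have h1 : (⌊q * D⌋ : ℝ) ≤ q * D := by exact_mod_cast Int.floor_le (q * D)
    have h2 : (q * D : ℝ) < ⌊q * D⌋ + 1 := by exact_mod_cast Int.lt_floor_add_one (q * D)
    have h3 : |(⌊q * D⌋ : ℝ)| ≤ H := by
      refine le_trans ?_ hH
      have h4 := mul_le_mul_of_nonneg_right (le_abs_self (q : ℝ)) (by linarith : (0:ℝ) ≤ D)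
      have h5 := mul_le_mul_of_nonneg_right (neg_abs_le (q : ℝ)) (by linarith : (0:ℝ) ≤ D)
      rw [abs_le]
      constructor <;> nlinarith
    have h4 : ((⌊q * D⌋.natAbs : ℤ) : ℝ) ≤ H := by rw [Int.natCast_natAbs]; exact_mod_cast h3
    exact_mod_cast h4
  · rw [Int.natAbs_natCast]
    have : (D : ℝ) ≤ H := le_trans (by nlinarith) hH
    exact_mod_cast this

/-! ### Frames -/

/-- Apart from the registers in `R` and the complex arrays in `A`, the states agree; the input
and output arrays agree as well. -/
structure NState.Frame (R A : List ℕ) (h h' : NState) : Prop where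
  reg : ∀ y, y ∉ R → h'.reg y = h.reg y
  inp : ∀ b < 4, h'.mem b = h.mem b
  arr : ∀ a, a ∉ A → h'.mem (4 + 2 * a) = h.mem (4 + 2 * a) ∧ h'.mem (5 + 2 * a) = h.mem (5 + 2 * a)

theorem NState.Frame.refl (R A : List ℕ) (h : NState) : h.Frame R A h :=
  ⟨fun _ _ => rfl, fun _ _ => rfl, fun _ _ => ⟨rfl, rfl⟩⟩

theorem NState.Frame.trans {R A R' A' : List ℕ} {h h' h'' : NState} (h1 : h.Frame R A h')
    (h2 : h'.Frame R' A' h'') : h.Frame (R ++ R') (A ++ A') h'' := by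
  refine ⟨fun y hy => ?_, fun b hb => (h2.inp b hb).trans (h1.inp b hb), fun a ha => ?_⟩
  · rw [List.mem_append, not_or] at hy
    exact (h2.reg y hy.2).trans (h1.reg y hy.1)
  · rw [List.mem_append, not_or] at ha
    exact ⟨(h2.arr a ha.2).1.trans (h1.arr a ha.1).1, (h2.arr a ha.2).2.trans (h1.arr a ha.1).2⟩

theorem NState.Frame.mono {R A R' A' : List ℕ} {h h' : NState} (h1 : h.Frame R A h')
    (hR : R ⊆ R') (hA : A ⊆ A') : h.Frame R' A' h' :=
  ⟨fun y hy => h1.reg y fun hy' => hy (hR hy'), h1.inp, fun a ha => h1.arr a fun ha' => ha (hA ha')⟩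

theorem NState.Frame.carr {R A : List ℕ} {h h' : NState} (h1 : h.Frame R A h') {a : ℕ}
    (ha : a ∉ A) : h'.carr a = h.carr a := by
  funext i
  simp [NState.carr, (h1.arr a ha).1, (h1.arr a ha).2]

theorem NState.frame_set (h : NState) (x k : ℕ) : h.Frame [x] [] (h.set x k) :=
  ⟨fun y hy => by simp at hy; simp [hy], fun _ _ => rfl, fun _ _ => ⟨rfl, rfl⟩⟩

theorem NState.Frame.trans' {R A R' A' : List ℕ} {h h' h'' : NState} (h1 : h.Frame R A h')
    (h2 : h'.Frame R' A' h'') (hR : R' ⊆ R) (hA : A' ⊆ A) : h.Frame R A h'' :=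
  (h1.trans h2).mono (List.append_subset.2 ⟨List.Subset.refl _, hR⟩)
    (List.append_subset.2 ⟨List.Subset.refl _, hA⟩)

theorem NState.Frame.set {R A : List ℕ} {h h' : NState} (h1 : h.Frame R A h') {x : ℕ} (hx : x ∈ R)
    (k : ℕ) : h.Frame R A (h'.set x k) :=
  h1.trans' (h'.frame_set x k) (by simpa using hx) (by simp)

/-! ### Loops over complex arrays -/

/-- `for ix < reg y do a[ix] ← rounded e` for a complex array `a`. -/
def Program.cmap (a y : ℕ) (e : CE) : Program :=
  .seq (.fill (4 + 2 * a) y e.comp.1.rnd) (.fill (5 + 2 * a) y e.comp.2.rnd)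

/-- The syntactic conditions on the expression of `Program.cmap`. -/
structure CE.Fit (a : ℕ) (e : CE) : Prop where
  small : e.small = true
  cost1 : e.comp.1.rnd.cost ≤ costBound
  cost2 : e.comp.2.rnd.cost ≤ costBound
  av1 : e.comp.1.avoids (4 + 2 * a) = true
  av2 : e.comp.2.avoids (5 + 2 * a) = true
  -- The real parts have already been overwritten when the imaginary parts are computed.
  av3 : e.comp.2.avoids (4 + 2 * a) = true

/-- The error `2 / D` consists of `1 / D` for each of the two rounded coordinates. -/
theorem Runs.cmap (hF : Fits W H) {a y : ℕ} {e : CE} {cnt D : ℕ} {h : NState} (hfit : e.Fit a)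
    (hb : h.Bd H) (hy : y ≠ ix) (hcnt : h.reg y = cnt) (hD : h.reg rD = D) (hD0 : 0 < D)
    (hok : ∀ i < cnt, e.Ok (h.set ix i).reg)
    (hbound : ∀ i < cnt, (‖e.eval (h.set ix i)‖ + 1) * D ≤ H) :
    Runs W H (.cmap a y e) h ((cnt + 1) * (10 * costBound)) (fun h' => h.Frame [ix] [a] h' ∧
      ∀ i < cnt, ‖h'.carr a i - e.eval (h.set ix i)‖ ≤ 2 / D) := by
  have h64 := hF.two_le
  have hDix : ∀ i, (h.set ix i).reg rD = D := fun i => by simp [hD]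
  have bd1 : ∀ i < cnt, ht (rnd D (e.comp.1.eval (h.set ix i).st)) ≤ H := fun i hi =>
    ht_rnd_le hD0 (le_trans (by
      rw [(e.comp_eval _).1]; gcongr; exact Complex.abs_re_le_norm _) (hbound i hi))
  have bd2 : ∀ i < cnt, ht (rnd D (e.comp.2.eval (h.set ix i).st)) ≤ H := fun i hi =>
    ht_rnd_le hD0 (le_trans (by
      rw [(e.comp_eval _).2]; gcongr; exact Complex.abs_im_le_norm _) (hbound i hi))
  have hc := e.comp_constLe h64 hfit.small
  have hrnd : ∀ (f : Expr) (g : NState), g.reg rD = D → f.Ok g.st → f.rnd.Ok g.st := by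
    intro f g hg hf
    refine ⟨⟨hf, trivial⟩, trivial, ?_⟩
    simp only [Expr.eval, NState.st, hg]
    exact_mod_cast hD0.ne'
  have hrc : ∀ f : Expr, f.ConstLe H → f.rnd.ConstLe H := fun f hf => ⟨⟨hf, trivial⟩, trivial⟩
  have hrav : ∀ (b : ℕ) (f : Expr), f.avoids b = true → f.rnd.avoids b = true := by
    intro b f hf
    simp [Expr.rnd, Expr.avoids, hf]
  set v1 : ℕ → ℚ := fun i => rnd D (e.comp.1.eval (h.set ix i).st) with hv1
  set v2 : ℕ → ℚ := fun i => rnd D (e.comp.2.eval (h.set ix i).st) with hv2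
  refine (Runs.seq (Runs.fill hF v1 hb hy hcnt (hrc _ hc.1) hfit.cost1 (hrav _ _ hfit.av1)
    (fun i hi => hrnd _ _ (hDix i) (e.comp_ok _ (hok i hi)).1)
    (fun i hi => by rw [Expr.rnd_eval, hDix]) bd1) (fun h' hb' hq => ?_)).mono
      (le_of_eq (by ring : (cnt + 1) * (5 * costBound) + (cnt + 1) * (5 * costBound) = _))
      (fun _ _ h => h)
  have hreg : ∀ i, (h.set ix i).st.reg = (h'.set ix i).st.reg := by
    intro i
    funext z
    simp only [NState.st, hq]
    by_cases hz : z = ix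
    · subst hz; simp
    · simp [hz, NState.write]
  have hmem : ∀ i b, b ≠ 4 + 2 * a → (h.set ix i).st.mem b = (h'.set ix i).st.mem b := by
    intro i b hba
    simp [NState.st, hq, NState.write, hba]
  have hD' : ∀ i, (h'.set ix i).reg rD = D := fun i => by simp [hq, NState.write, hD]
  refine (Runs.fill hF v2 hb' hy (by simp [hq, NState.write, hy, hcnt]) (hrc _ hc.2) hfit.cost2
    (hrav _ _ hfit.av2) (fun i hi => hrnd _ _ (hD' i)
      (Expr.ok_congr (hreg i) (hmem i) _ hfit.av3 (e.comp_ok _ (hok i hi)).2))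
    (fun i hi => by rw [Expr.rnd_eval, hD', ← Expr.eval_congr (hreg i) (hmem i) _ hfit.av3]) bd2).mono
    le_rfl ?_
  rintro h'' - rfl
  subst hq
  refine ⟨⟨fun z hz => ?_, fun b hb4 => ?_, fun b hba => ?_⟩, fun i hi => ?_⟩
  · simp only [List.mem_singleton] at hz
    simp [NState.write, hz]
  · have h1 : b ≠ 4 + 2 * a := by omega
    have h2 : b ≠ 5 + 2 * a := by omega
    simp [NState.write, h1, h2]
  · simp only [List.mem_singleton] at hba
    have h1 : 4 + 2 * b ≠ 4 + 2 * a := by omega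
    have h2 : 4 + 2 * b ≠ 5 + 2 * a := by omega
    have h3 : 5 + 2 * b ≠ 4 + 2 * a := by omega
    have h4 : 5 + 2 * b ≠ 5 + 2 * a := by omega
    simp only [NState.write, ne_eq, h1, h2, h3, h4, not_false_eq_true, Function.update_of_ne, and_self]
  · have hre : (((h.write (4 + 2 * a) cnt v1).write (5 + 2 * a) cnt v2).carr a i - e.eval (h.set ix i)).re
        = (v1 i : ℝ) - (e.comp.1.eval (h.set ix i).st : ℚ) := by
      simp [NState.carr, NState.write, hi, (e.comp_eval _).1]
    have him : (((h.write (4 + 2 * a) cnt v1).write (5 + 2 * a) cnt v2).carr a i - e.eval (h.set ix i)).im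
        = (v2 i : ℝ) - (e.comp.2.eval (h.set ix i).st : ℚ) := by
      simp [NState.carr, NState.write, hi, (e.comp_eval _).2]
    refine (Complex.norm_le_abs_re_add_abs_im _).trans ?_
    rw [hre, him]
    have g1 := abs_rnd_sub_le hD0 (e.comp.1.eval (h.set ix i).st)
    have g2 := abs_rnd_sub_le hD0 (e.comp.2.eval (h.set ix i).st)
    have : (2 : ℝ) / D = 1 / D + 1 / D := by ring
    rw [this]
    exact add_le_add g1 g2

/-! ### Propagation of errors -/

/-- `w` approximates `z` with error at most `A * δ`, where `A` bounds the absolute value of `z`. -/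
def Cl (δ A : ℝ) (w z : ℂ) : Prop := ‖z‖ ≤ A ∧ ‖w - z‖ ≤ A * δ

section Cl

variable {δ A B : ℝ} {w z w' z' : ℂ}

theorem Cl.nonneg (h : Cl δ A w z) : 0 ≤ A := (norm_nonneg _).trans h.1

theorem Cl.mono (hδ : 0 ≤ δ) (h : Cl δ A w z) (hAB : A ≤ B) : Cl δ B w z :=
  ⟨h.1.trans hAB, h.2.trans (mul_le_mul_of_nonneg_right hAB hδ)⟩

theorem Cl.zero : Cl δ 0 0 0 := by simp [Cl]

theorem Cl.add (h : Cl δ A w z) (h' : Cl δ B w' z') : Cl δ (A + B) (w + w') (z + z') := by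
  refine ⟨(norm_add_le _ _).trans (add_le_add h.1 h'.1), ?_⟩
  rw [show w + w' - (z + z') = (w - z) + (w' - z') by ring, add_mul]
  exact (norm_add_le _ _).trans (add_le_add h.2 h'.2)

theorem Cl.neg (h : Cl δ A w z) : Cl δ A (-w) (-z) := by
  refine ⟨by rw [norm_neg]; exact h.1, ?_⟩
  rw [show -w - -z = -(w - z) by ring, norm_neg]
  exact h.2

theorem Cl.norm_le (h : Cl δ A w z) (hδ1 : δ ≤ 1) : ‖w‖ ≤ 2 * A := by
  have := norm_add_le (w - z) z
  rw [sub_add_cancel] at this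
  nlinarith [h.1, h.2, h.nonneg]

/-- Write `w w' - z z' = (w - z) w' + z (w' - z')`. Since `δ ≤ 1`, the approximation `w'` is at most
`2 B` in absolute value, so the two terms contribute `2 A B δ` and `A B δ`. -/
theorem Cl.mul (hδ : 0 ≤ δ) (hδ1 : δ ≤ 1) (h : Cl δ A w z) (h' : Cl δ B w' z') :
    Cl δ (3 * A * B) (w * w') (z * z') := by
  have hA := h.nonneg
  have hB := h'.nonneg
  have hAB : 0 ≤ A * B := mul_nonneg hA hB
  refine ⟨?_, ?_⟩
  · rw [norm_mul]
    nlinarith [mul_le_mul h.1 h'.1 (norm_nonneg _) hA]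
  · rw [show w * w' - z * z' = (w - z) * w' + z * (w' - z') by ring]
    refine (norm_add_le _ _).trans ?_
    rw [norm_mul, norm_mul]
    have h1 := mul_le_mul h.2 (h'.norm_le hδ1) (norm_nonneg _) (mul_nonneg hA hδ)
    have h2 := mul_le_mul h.1 h'.2 (norm_nonneg _) hA
    nlinarith

theorem Cl.conj (h : Cl δ A w z) : Cl δ A ((starRingEnd ℂ) w) ((starRingEnd ℂ) z) := by
  refine ⟨by rw [RCLike.norm_conj]; exact h.1, ?_⟩
  rw [← map_sub, RCLike.norm_conj]; exact h.2

theorem Cl.divN (h : Cl δ A w z) {k : ℕ} (hk : 1 ≤ k) : Cl δ A (w / k) (z / k) := by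
  have hk' : (1 : ℝ) ≤ k := by exact_mod_cast hk
  refine ⟨?_, ?_⟩
  · rw [norm_div, Complex.norm_natCast]
    exact (div_le_self (norm_nonneg _) hk').trans h.1
  · rw [← sub_div, norm_div, Complex.norm_natCast]
    exact (div_le_self (norm_nonneg _) hk').trans h.2

/-- A rounding error is absolute; the condition `1 ≤ A` allows it to be charged to the bound, at the
price of doubling it. -/
theorem Cl.round (h : Cl δ A w z) (hδ : 0 ≤ δ) (hA : 1 ≤ A) (hw : ‖w' - w‖ ≤ δ) :
    Cl δ (2 * A) w' z := by
  refine ⟨h.1.trans (by linarith), ?_⟩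
  rw [show w' - z = (w' - w) + (w - z) by ring]
  refine (norm_add_le _ _).trans ?_
  nlinarith [h.2]

/-- The signs `1 - 2 b` with `b ∈ {0, 1}`. -/
theorem Cl.sign_mul (h : Cl δ A w z) {b : ℕ} (hb : b < 2) :
    Cl δ A ((1 - 2 * (b : ℂ)) * w) ((1 - 2 * (b : ℂ)) * z) := by
  interval_cases b
  · simpa using h
  · have e : (1 - 2 * ((1 : ℕ) : ℂ)) = -1 := by norm_num
    rw [e, neg_one_mul, neg_one_mul]
    exact h.neg

end Cl

/-- The denominator `D` guarantees the accuracy `δ` for numbers of absolute value at most `2M`. -/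
structure Prec (H D : ℕ) (δ M : ℝ) : Prop where
  D_pos : 0 < D
  two_div_le : 2 / (D : ℝ) ≤ δ
  le_one : δ ≤ 1
  bound : (2 * M + 1) * D ≤ H

theorem Prec.nonneg {D : ℕ} {δ M : ℝ} (hP : Prec H D δ M) : 0 ≤ δ :=
  le_trans (by positivity) hP.two_div_le

theorem Runs.cmapCl (hF : Fits W H) {D : ℕ} {δ M : ℝ} (hP : Prec H D δ M) {a y : ℕ} {e : CE}
    {cnt : ℕ} {h : NState} (hfit : e.Fit a) (hb : h.Bd H) (hy : y ≠ ix) (hcnt : h.reg y = cnt)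
    (hD : h.reg rD = D) {A : ℝ} {z : ℕ → ℂ} (hA : 1 ≤ A) (hAM : A ≤ M)
    (hok : ∀ i < cnt, e.Ok (h.set ix i).reg)
    (hcl : ∀ i < cnt, Cl δ A (e.eval (h.set ix i)) (z i)) :
    Runs W H (.cmap a y e) h ((cnt + 1) * (10 * costBound)) (fun h' => h.Frame [ix] [a] h' ∧
      ∀ i < cnt, Cl δ (2 * A) (h'.carr a i) (z i)) := by
  have hD1 : (0 : ℝ) < D := by exact_mod_cast hP.D_pos
  refine (Runs.cmap hF hfit hb hy hcnt hD hP.D_pos hok (fun i hi => le_trans ?_ hP.bound)).mono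
    le_rfl (fun h' _ hq => ⟨hq.1, fun i hi =>
      (hcl i hi).round hP.nonneg hA ((hq.2 i hi).trans hP.two_div_le)⟩)
  have := (hcl i hi).norm_le hP.le_one
  gcongr
  linarith

end WordRAM

namespace WordRAM

open Finset

/-! ### Roots of unity -/

/-- `root M a = exp (2 π i a / M)`. -/
noncomputable def root (M a : ℕ) : ℂ := Complex.exp (2 * Real.pi * Complex.I * (a / M))

theorem root_add (M a b : ℕ) : root M (a + b) = root M a * root M b := by
  rw [root, root, root, ← Complex.exp_add]
  push_cast
  ring_nf

@[simp] theorem root_zero (M : ℕ) : root M 0 = 1 := by simp [root]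

theorem root_self {M : ℕ} (hM : M ≠ 0) : root M M = 1 := by
  have : (M : ℂ) ≠ 0 := by exact_mod_cast hM
  rw [root, div_self this, mul_one, Complex.exp_two_pi_mul_I]

theorem root_mul (M a k : ℕ) : root M (k * a) = root M a ^ k := by
  induction k with
  | zero => simp
  | succ k ih => rw [Nat.add_mul, one_mul, root_add, ih, pow_succ]

theorem root_mod (M a : ℕ) : root M (a % M) = root M a := by
  rcases eq_or_ne M 0 with rfl | hM
  · simp
  conv_rhs => rw [← Nat.mod_add_div a M, root_add, mul_comm M, root_mul, root_self hM, one_pow,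
    mul_one]

theorem norm_root (M a : ℕ) : ‖root M a‖ = 1 := by
  rw [root, show (2 * Real.pi * Complex.I * (a / M) : ℂ) = ((2 * Real.pi * (a / M) : ℝ) : ℂ) * Complex.I by
    push_cast; ring, Complex.norm_exp_ofReal_mul_I]

theorem conj_root_mul (M a : ℕ) : (starRingEnd ℂ) (root M a) * root M a = 1 := by
  rw [mul_comm, Complex.mul_conj, Complex.normSq_eq_norm_sq, norm_root]; simp

theorem root_mul_mul {c : ℕ} (hc : c ≠ 0) (M a : ℕ) : root (c * M) (c * a) = root M a := by
  have : (c : ℂ) ≠ 0 := by exact_mod_cast hc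
  rw [root, root]
  push_cast
  rw [mul_div_mul_left _ _ this]

theorem root_half {m : ℕ} (hm : m ≠ 0) : root (2 * m) m = -1 := by
  have : (m : ℂ) ≠ 0 := by exact_mod_cast hm
  rw [root, ← Complex.exp_pi_mul_I]
  congr 1
  push_cast
  field_simp

/-! ### Cyclic convolution by halving -/

/-- Cyclic convolution on every block of length `m`. -/
noncomputable def bconv (m : ℕ) (x y : ℕ → ℂ) (p : ℕ) : ℂ :=
  ∑ a ∈ range m, x (p / m * m + a) * y (p / m * m + (p % m + m - a) % m)

/-- One step of the fast Fourier transform, on blocks of length `2m`. -/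
noncomputable def fstep (m : ℕ) (x : ℕ → ℂ) (p : ℕ) : ℂ :=
  (x (p / (2 * m) * (2 * m) + p % m) +
    (1 - 2 * ((p / m % 2 : ℕ) : ℂ)) * x (p / (2 * m) * (2 * m) + p % m + m)) *
    root (2 * m) (p / m % 2 * (p % m))

/-- One step of the inverse fast Fourier transform, on blocks of length `2m`. -/
noncomputable def istep (m : ℕ) (x : ℕ → ℂ) (p : ℕ) : ℂ :=
  x (p / (2 * m) * (2 * m) + p % m) +
    (1 - 2 * ((p / m % 2 : ℕ) : ℂ)) *
      (x (p / (2 * m) * (2 * m) + p % m + m) * (starRingEnd ℂ) (root (2 * m) (p % m)))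

theorem block_div {m o : ℕ} (B : ℕ) (ho : o < m) : (B * m + o) / m = B := by
  rw [add_comm, Nat.add_mul_div_right _ _ (by omega), Nat.div_eq_of_lt ho, zero_add]

theorem block_mod {m o : ℕ} (B : ℕ) (ho : o < m) : (B * m + o) % m = o :=
  Nat.mul_add_mod_of_lt ho

theorem bconv_block {m o : ℕ} (B : ℕ) (ho : o < m) (x y : ℕ → ℂ) :
    bconv m x y (B * m + o) =
      ∑ a ∈ range m, x (B * m + a) * y (B * m + (o + m - a) % m) := by
  rw [bconv, block_div B ho, block_mod B ho]

theorem exists_block {m : ℕ} (hm : 0 < m) (p : ℕ) :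
    ∃ B o, o < m ∧ (p = B * (2 * m) + o ∨ p = B * (2 * m) + (o + m)) := by
  refine ⟨p / (2 * m), p % m, Nat.mod_lt _ hm, ?_⟩
  have h1 := Nat.div_add_mod p (2 * m)
  have h2 := Nat.mod_lt p (show 0 < 2 * m by omega)
  have h3 : p % (2 * m) % m = p % m := Nat.mod_mod_of_dvd _ (Dvd.intro_left 2 rfl)
  rw [mul_comm] at h1
  rcases lt_or_ge (p % (2 * m)) m with h | h
  · left
    rw [Nat.mod_eq_of_lt h] at h3
    omega
  · right
    rw [Nat.mod_eq_sub_mod h, Nat.mod_eq_of_lt (by omega)] at h3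
    omega

theorem even_index {m o : ℕ} (B : ℕ) (ho : o < m) :
    (B * (2 * m) + o) / (2 * m) = B ∧ (B * (2 * m) + o) % m = o ∧
      (B * (2 * m) + o) / m % 2 = 0 := by
  refine ⟨block_div B (by omega), ?_, ?_⟩
  · rw [show B * (2 * m) + o = (B * 2) * m + o by ring, block_mod _ ho]
  · rw [show B * (2 * m) + o = (B * 2) * m + o by ring, block_div _ ho]; omega

theorem odd_index {m o : ℕ} (B : ℕ) (ho : o < m) :
    (B * (2 * m) + (o + m)) / (2 * m) = B ∧ (B * (2 * m) + (o + m)) % m = o ∧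
      (B * (2 * m) + (o + m)) / m % 2 = 1 := by
  refine ⟨block_div B (by omega), ?_, ?_⟩
  · rw [show B * (2 * m) + (o + m) = (B * 2 + 1) * m + o by ring, block_mod _ ho]
  · rw [show B * (2 * m) + (o + m) = (B * 2 + 1) * m + o by ring, block_div _ ho]; omega

theorem fstep_even {m o : ℕ} (B : ℕ) (ho : o < m) (x : ℕ → ℂ) :
    fstep m x (B * (2 * m) + o) = x (B * (2 * m) + o) + x (B * (2 * m) + (o + m)) := by
  obtain ⟨h1, h2, h3⟩ := even_index B ho
  simp [fstep, h1, h2, h3, add_assoc]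

theorem fstep_odd {m o : ℕ} (B : ℕ) (ho : o < m) (x : ℕ → ℂ) :
    fstep m x (B * (2 * m) + (o + m)) =
      (x (B * (2 * m) + o) - x (B * (2 * m) + (o + m))) * root (2 * m) o := by
  obtain ⟨h1, h2, h3⟩ := odd_index B ho
  simp only [fstep, h1, h2, h3, add_assoc]
  push_cast
  ring_nf

theorem istep_even {m o : ℕ} (B : ℕ) (ho : o < m) (x : ℕ → ℂ) :
    istep m x (B * (2 * m) + o) =
      x (B * (2 * m) + o) + x (B * (2 * m) + (o + m)) * (starRingEnd ℂ) (root (2 * m) o) := by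
  obtain ⟨h1, h2, h3⟩ := even_index B ho
  simp [istep, h1, h2, h3, add_assoc]

theorem istep_odd {m o : ℕ} (B : ℕ) (ho : o < m) (x : ℕ → ℂ) :
    istep m x (B * (2 * m) + (o + m)) =
      x (B * (2 * m) + o) - x (B * (2 * m) + (o + m)) * (starRingEnd ℂ) (root (2 * m) o) := by
  obtain ⟨h1, h2, h3⟩ := odd_index B ho
  simp only [istep, h1, h2, h3, add_assoc]
  push_cast
  ring_nf

/-- The inverse step omits the factor 1/2. The resulting power of 2 is divided out only once, in
`outE`. -/
theorem istep_fstep {m : ℕ} (hm : 0 < m) (x : ℕ → ℂ) : istep m (fstep m x) = fun p => 2 * x p := by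
  funext p
  obtain ⟨B, o, ho, rfl | rfl⟩ := exists_block hm p
  · rw [istep_even B ho, fstep_even B ho, fstep_odd B ho]
    linear_combination (x (B * (2 * m) + o) - x (B * (2 * m) + (o + m))) * conj_root_mul (2 * m) o
  · rw [istep_odd B ho, fstep_even B ho, fstep_odd B ho]
    linear_combination -(x (B * (2 * m) + o) - x (B * (2 * m) + (o + m))) * conj_root_mul (2 * m) o

theorem istep_smul (m : ℕ) (c : ℂ) (x : ℕ → ℂ) :
    istep m (fun p => c * x p) = fun p => c * istep m x p := by
  funext p
  simp only [istep]
  ring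

/-- A block of length `2 m` is a polynomial modulo `X ^ (2 m) - 1`. The first half of `fstep` is its
residue modulo `X ^ m - 1`, where the product is again a cyclic convolution. The second half is the
residue modulo `X ^ m + 1`; substituting `ζ X` for `X` with `ζ = root (2 * m) 1`, so that `ζ ^ m =
-1`, makes that product cyclic as well. -/
theorem fstep_bconv {m : ℕ} (hm : 0 < m) (x y : ℕ → ℂ) :
    fstep m (bconv (2 * m) x y) = bconv m (fstep m x) (fstep m y) := by
  funext p
  obtain ⟨B, o, ho, rfl | rfl⟩ := exists_block hm p
  · rw [fstep_even B ho, bconv_block B (by omega), bconv_block B (by omega),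
      show B * (2 * m) + o = (2 * B) * m + o by ring, bconv_block (2 * B) ho, two_mul m,
      sum_range_add, sum_range_add, ← sum_add_distrib, ← sum_add_distrib, ← sum_add_distrib]
    refine sum_congr rfl fun a ha => ?_
    rw [mem_range] at ha
    have hc := Nat.mod_lt (o + m - a) hm
    rw [show 2 * B * m = B * (2 * m) by ring, ← two_mul m, fstep_even B ha, fstep_even B hc]
    -- The cases say whether the index `o - a` wraps around the block of length `m`.
    rcases le_or_gt a o with h | h
    · rw [show o + m - a = o - a + m by omega, Nat.add_mod_right, Nat.mod_eq_of_lt (show o - a < m by omega),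
        show o + 2 * m - a = o - a + 2 * m by omega, Nat.add_mod_right,
        Nat.mod_eq_of_lt (show o - a < 2 * m by omega),
        show o + m + 2 * m - a = o - a + m + 2 * m by omega, Nat.add_mod_right,
        Nat.mod_eq_of_lt (show o - a + m < 2 * m by omega),
        show o + 2 * m - (m + a) = o - a + m by omega,
        Nat.mod_eq_of_lt (show o - a + m < 2 * m by omega),
        show o + m + 2 * m - (m + a) = o - a + 2 * m by omega, Nat.add_mod_right,
        Nat.mod_eq_of_lt (show o - a < 2 * m by omega), add_comm m a]
      ring
    · rw [Nat.mod_eq_of_lt (show o + m - a < m by omega),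
        Nat.mod_eq_of_lt (show o + 2 * m - a < 2 * m by omega),
        show o + m + 2 * m - a = o + m - a + 2 * m by omega, Nat.add_mod_right,
        Nat.mod_eq_of_lt (show o + m - a < 2 * m by omega),
        show o + 2 * m - (m + a) = o + m - a by omega,
        Nat.mod_eq_of_lt (show o + m - a < 2 * m by omega),
        show o + m + 2 * m - (m + a) = o + 2 * m - a by omega,
        Nat.mod_eq_of_lt (show o + 2 * m - a < 2 * m by omega), add_comm m a,
        show o + 2 * m - a = o + m - a + m by omega]
      ring
  · rw [fstep_odd B ho, bconv_block B (by omega), bconv_block B (by omega),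
      show B * (2 * m) + (o + m) = (2 * B + 1) * m + o by ring, bconv_block (2 * B + 1) ho, two_mul m,
      sum_range_add, sum_range_add, ← sum_add_distrib, ← sum_add_distrib, ← sum_sub_distrib,
      sum_mul]
    refine sum_congr rfl fun a ha => ?_
    rw [mem_range] at ha
    have hc := Nat.mod_lt (o + m - a) hm
    rw [show (2 * B + 1) * m + a = B * (2 * m) + (a + m) by ring,
      show (2 * B + 1) * m + (o + m - a) % m = B * (2 * m) + ((o + m - a) % m + m) by ring,
      ← two_mul m, fstep_odd B ha, fstep_odd B hc]
    rcases le_or_gt a o with h | h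
    · have hr : root (2 * m) o = root (2 * m) a * root (2 * m) (o - a) := by
        rw [← root_add]; congr 1; omega
      rw [show o + m - a = o - a + m by omega, Nat.add_mod_right, Nat.mod_eq_of_lt (show o - a < m by omega),
        show o + 2 * m - a = o - a + 2 * m by omega, Nat.add_mod_right,
        Nat.mod_eq_of_lt (show o - a < 2 * m by omega),
        show o + m + 2 * m - a = o - a + m + 2 * m by omega, Nat.add_mod_right,
        Nat.mod_eq_of_lt (show o - a + m < 2 * m by omega),
        show o + 2 * m - (m + a) = o - a + m by omega,
        Nat.mod_eq_of_lt (show o - a + m < 2 * m by omega),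
        show o + m + 2 * m - (m + a) = o - a + 2 * m by omega, Nat.add_mod_right,
        Nat.mod_eq_of_lt (show o - a < 2 * m by omega), add_comm m a, hr]
      ring
    -- On wrapping around, the exponents add up to `o + m`, and `root (2 * m) m = -1` supplies the
    -- sign of the negacyclic product.
    · have hr : root (2 * m) o = - (root (2 * m) a * root (2 * m) (o + m - a)) := by
        rw [← root_add, show a + (o + m - a) = o + m by omega, root_add, root_half hm.ne']; ring
      rw [Nat.mod_eq_of_lt (show o + m - a < m by omega),
        Nat.mod_eq_of_lt (show o + 2 * m - a < 2 * m by omega),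
        show o + m + 2 * m - a = o + m - a + 2 * m by omega, Nat.add_mod_right,
        Nat.mod_eq_of_lt (show o + m - a < 2 * m by omega),
        show o + 2 * m - (m + a) = o + m - a by omega,
        Nat.mod_eq_of_lt (show o + m - a < 2 * m by omega),
        show o + m + 2 * m - (m + a) = o + 2 * m - a by omega,
        Nat.mod_eq_of_lt (show o + 2 * m - a < 2 * m by omega), add_comm m a,
        show o + 2 * m - a = o + m - a + m by omega, hr]
      ring

/-- The first `l` steps of the fast Fourier transform on blocks of length `2 ^ k`. -/
noncomputable def fwd (k : ℕ) (x : ℕ → ℂ) : ℕ → ℕ → ℂ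
  | 0 => x
  | l + 1 => fstep (2 ^ (k - (l + 1))) (fwd k x l)

/-- The first `l` steps of the inverse fast Fourier transform. -/
noncomputable def bwd (x : ℕ → ℂ) : ℕ → ℕ → ℂ
  | 0 => x
  | l + 1 => istep (2 ^ l) (bwd x l)

theorem fwd_bconv {k l : ℕ} (hl : l ≤ k) (x y : ℕ → ℂ) :
    fwd k (bconv (2 ^ k) x y) l = bconv (2 ^ (k - l)) (fwd k x l) (fwd k y l) := by
  induction l with
  | zero => rfl
  | succ l ih =>
    rw [fwd, ih (by omega), fwd, fwd, ← fstep_bconv (by positivity)]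
    congr 2
    rw [← pow_succ']
    congr 1
    omega

theorem bwd_fwd {k l : ℕ} (hl : l ≤ k) (x : ℕ → ℂ) :
    bwd (fwd k x k) l = fun p => 2 ^ l * fwd k x (k - l) p := by
  induction l with
  | zero => simp [bwd]
  | succ l ih =>
    have e : fwd k x (k - l) = fstep (2 ^ l) (fwd k x (k - (l + 1))) := by
      conv_lhs => rw [show k - l = k - (l + 1) + 1 by omega, fwd]
      congr 2
      omega
    rw [bwd, ih (by omega), istep_smul, e, istep_fstep (by positivity)]
    funext p
    ring

/-- After `k` halvings the blocks have length 1 and cyclic convolution is the pointwise product. The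
transform comes out in a permuted order, but since the inverse steps undo the forward steps in
reverse, no reordering is needed. -/
theorem bwd_mul_fwd (k : ℕ) (x y : ℕ → ℂ) :
    bwd (fun p => fwd k x k p * fwd k y k p) k = fun p => 2 ^ k * bconv (2 ^ k) x y p := by
  have h : (fun p => fwd k x k p * fwd k y k p) = fwd k (bconv (2 ^ k) x y) k := by
    rw [fwd_bconv le_rfl]
    funext p
    simp [bconv, Nat.mod_one]
  rw [h, bwd_fwd le_rfl, Nat.sub_self]
  rfl

/-! ### Bluestein's reduction of a Fourier transform to a cyclic convolution -/

/-- With `ζ = root (2 * r) 1` the identity `2 k j = k² + j² - (k - j)²` turns the kernel `ζ ^ (2 k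
j)` into a function of `k - j`. The difference is shifted to `i = k + r - j` to be positive, and `i²
+ r²` differs from `(k - j)²` by a multiple of `2 r`. As `0 < i < 2 r ≤ L`, the cyclic convolution
does not wrap around on the positions that are read. -/
theorem bluestein {r L : ℕ} (hL : 2 * r ≤ L) (f : ℕ) (X U V : ℕ → ℂ)
    (hU : ∀ j < r, U (f * L + j) = X j * root (2 * r) (j * j))
    (hU0 : ∀ j < L, r ≤ j → U (f * L + j) = 0)
    (hV : ∀ i < L, V (f * L + i) = (starRingEnd ℂ) (root (2 * r) (i * i + r * r))) {k : ℕ} (hk : k < r) :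
    root (2 * r) (k * k) * bconv L U V (f * L + (k + r)) = ∑ j ∈ range r, X j * root r (k * j) := by
  rw [bconv_block f (by omega), mul_sum]
  obtain ⟨c, rfl⟩ := Nat.exists_eq_add_of_le (show r ≤ L by omega)
  rw [sum_range_add, sum_eq_zero (s := range c), add_zero]
  · refine sum_congr rfl fun j hj => ?_
    rw [mem_range] at hj
    rw [show k + r + (r + c) - j = (k + r - j) + (r + c) by omega, Nat.add_mod_right,
      Nat.mod_eq_of_lt (by omega), hU j hj, hV _ (by omega)]
    set i := k + r - j with hi
    have hr : root (2 * r) (k * k) * root (2 * r) (j * j) =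
        root r (k * j) * root (2 * r) (i * i + r * r) := by
      rw [← root_mul_mul two_ne_zero r (k * j), ← root_add, ← root_add]
      have e : k + r = i + j := by omega
      -- Multiples of `2 r` are added on both sides so that the congruence of exponents is an
      -- equation without subtraction.
      have : k * k + j * j + (2 * r) * (k + r) = 2 * (k * j) + (i * i + r * r) + (2 * r) * j := by
        zify at e ⊢
        have : (i : ℤ) = k + r - j := by linarith
        rw [this]; ring
      rw [← root_mod, ← Nat.add_mul_mod_self_left _ (2 * r) (k + r), this,
        Nat.add_mul_mod_self_left, root_mod]
    have hc := conj_root_mul (2 * r) (i * i + r * r)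
    linear_combination (X j * (starRingEnd ℂ) (root (2 * r) (i * i + r * r))) * hr +
      X j * root r (k * j) * hc
  · intro a ha
    rw [mem_range] at ha
    rw [hU0 (r + a) (by omega) (by omega)]; simp

end WordRAM

namespace WordRAM

open Finset

/-! ### The Fourier transform in mixed radix -/

/-- The product of the first `t` radices. -/
def stride (r : ℕ → ℕ) (t : ℕ) : ℕ := ∏ k ∈ range t, r k

theorem stride_succ (r : ℕ → ℕ) (t : ℕ) : stride r (t + 1) = stride r t * r t := prod_range_succ _ _

theorem stride_pos {r : ℕ → ℕ} {t : ℕ} (hr : ∀ u < t, 0 < r u) : 0 < stride r t :=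
  prod_pos fun u hu => hr u (mem_range.1 hu)

/-- The digits of `p` in mixed radix. -/
def digit (r : ℕ → ℕ) (u p : ℕ) : ℕ := p / stride r u % r u

theorem sum_range_mul {M : Type*} [AddCommMonoid M] (S r : ℕ) (f : ℕ → M) :
    ∑ q ∈ range (S * r), f q = ∑ j ∈ range r, ∑ q ∈ range S, f (q + S * j) := by
  induction r with
  | zero => simp
  | succ r ih =>
    rw [Nat.mul_succ, sum_range_add, ih, sum_range_succ]
    congr 1
    exact sum_congr rfl fun q _ => by rw [add_comm]

theorem stride_dvd {r : ℕ → ℕ} {u t : ℕ} (h : u ≤ t) : stride r u ∣ stride r t :=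
  prod_dvd_prod_of_subset _ _ _ (by simpa using h)

theorem digit_add_mul {r : ℕ → ℕ} {u t : ℕ} (hut : u < t) (hr : 0 < stride r u) (q c : ℕ) :
    digit r u (q + stride r t * c) = digit r u q := by
  obtain ⟨d, hd⟩ := stride_dvd (r := r) (show u + 1 ≤ t from hut)
  rw [digit, hd, stride_succ, show q + stride r u * r u * d * c = q + stride r u * (r u * (d * c)) by ring,
    Nat.add_mul_div_left _ _ hr, Nat.add_mul_mod_self_left, digit]

theorem digit_mod {r : ℕ → ℕ} {u t : ℕ} (hut : u < t) (hr : 0 < stride r u) (p : ℕ) :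
    digit r u (p % stride r t) = digit r u p := by
  conv_rhs => rw [← Nat.mod_add_div p (stride r t), digit_add_mul hut hr]

theorem digit_top {r : ℕ → ℕ} {t q j : ℕ} (hq : q < stride r t) (hj : j < r t) :
    digit r t (q + stride r t * j) = j := by
  rw [digit, Nat.add_mul_div_left _ _ (by omega), Nat.div_eq_of_lt hq, zero_add, Nat.mod_eq_of_lt hj]

/-- The Fourier transform along one digit with radix `r` and stride `S`. -/
noncomputable def dstep (S r : ℕ) (x : ℕ → ℂ) (p : ℕ) : ℂ :=
  ∑ j ∈ range r, x (p % S + S * (j + r * (p / (S * r)))) * root r (p / S % r * j)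

/-- The Fourier transform along the first `t` digits. -/
noncomputable def dft (r : ℕ → ℕ) (x : ℕ → ℂ) : ℕ → ℕ → ℂ
  | 0 => x
  | t + 1 => dstep (stride r t) (r t) (dft r x t)

/-- The characters of the product of the cyclic groups of the orders `r u`, `u < t`. -/
noncomputable def chi (r : ℕ → ℕ) (t p q : ℕ) : ℂ :=
  ∏ u ∈ range t, root (r u) (digit r u p * digit r u q)

/-- After `t` steps the first `t` digits have been summed against characters, while the higher
digits, encoded in `p / stride r t`, still select the part of the input. -/
theorem dft_eq {r : ℕ → ℕ} {t : ℕ} (hr : ∀ u < t, 0 < r u) (x : ℕ → ℂ) (p : ℕ) :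
    dft r x t p = ∑ q ∈ range (stride r t), x (q + stride r t * (p / stride r t)) * chi r t p q := by
  induction t generalizing p with
  | zero => simp [dft, stride, chi]
  | succ t ih =>
    have hS : ∀ u ≤ t, 0 < stride r u := fun u hu => stride_pos fun v hv => hr v (by omega)
    rw [dft, dstep, stride_succ, sum_range_mul]
    refine sum_congr rfl fun j hj => ?_
    rw [mem_range] at hj
    rw [ih (fun u hu => hr u (by omega)), sum_mul]
    refine sum_congr rfl fun q hq => ?_
    rw [mem_range] at hq
    rw [Nat.add_mul_div_left _ _ (hS t le_rfl), Nat.div_eq_of_lt (Nat.mod_lt _ (hS t le_rfl)), zero_add,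
      chi, chi, prod_range_succ, digit_top hq hj, mul_assoc]
    congr 2
    · ring
    · refine prod_congr rfl fun u hu => ?_
      rw [mem_range] at hu
      rw [digit_add_mul hu (hS u hu.le), digit_mod hu (hS u hu.le), digit_add_mul hu (hS u hu.le)]

/-- Numbers below `stride r t` correspond to arbitrary tuples of digits, so this is the distributive
law. -/
theorem sum_prod_digit {r : ℕ → ℕ} {t : ℕ} (hr : ∀ u < t, 0 < r u) (g : ℕ → ℕ → ℂ) :
    ∑ q ∈ range (stride r t), ∏ u ∈ range t, g u (digit r u q) =
      ∏ u ∈ range t, ∑ k ∈ range (r u), g u k := by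
  induction t with
  | zero => simp [stride]
  | succ t ih =>
    have hS : ∀ u ≤ t, 0 < stride r u := fun u hu => stride_pos fun v hv => hr v (by omega)
    rw [stride_succ, sum_range_mul, prod_range_succ, ← ih fun u hu => hr u (by omega), mul_sum]
    refine sum_congr rfl fun j hj => ?_
    rw [sum_mul]
    refine sum_congr rfl fun q hq => ?_
    rw [mem_range] at hj hq
    rw [prod_range_succ, digit_top hq hj]
    congr 1
    refine prod_congr rfl fun u hu => ?_
    rw [mem_range] at hu
    rw [digit_add_mul hu (hS u hu.le)]

theorem sum_pow_eq {r : ℕ} {w : ℂ} (hw : w ^ r = 1) :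
    ∑ k ∈ range r, w ^ k = if w = 1 then (r : ℂ) else 0 := by
  split_ifs with h
  · simp [h]
  · rw [geom_sum_eq h, hw]; simp

theorem root_eq_root_iff {r : ℕ} (hr : 0 < r) (a b : ℕ) : root r a = root r b ↔ a % r = b % r := by
  constructor
  · intro h
    have hr' : (r : ℂ) ≠ 0 := by exact_mod_cast hr.ne'
    rw [root, root, Complex.exp_eq_exp_iff_exists_int] at h
    obtain ⟨n, hn⟩ := h
    have h2 := Complex.two_pi_I_ne_zero
    have h3 : (a : ℂ) / r = b / r + n := by
      apply mul_left_cancel₀ h2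
      rw [hn]; ring
    have h4 : (a : ℂ) = b + n * r := by
      field_simp at h3
      rw [h3]; ring
    have h5 : (a : ℤ) = b + n * r := by exact_mod_cast h4
    have h6 : (a : ℤ) % r = b % r := by rw [h5, Int.add_mul_emod_self_right]
    exact_mod_cast h6
  · intro h
    rw [← root_mod, h, root_mod]

-- Orthogonality of characters: the sum factors over the digits into geometric sums of `w u`, which
-- satisfies `w u ^ r u = 1`. The factor is `r u` if `w u = 1`, that is, if the digits add up
-- correctly, and 0 otherwise.
open Classical in
theorem sum_chi {r : ℕ → ℕ} {s : ℕ} (hr : ∀ u < s, 0 < r u) (q q' p : ℕ) :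
    ∑ k ∈ range (stride r s), (starRingEnd ℂ) (chi r s k q) * (starRingEnd ℂ) (chi r s k q') *
      chi r s p k = if ∀ u < s, (digit r u q + digit r u q') % r u = digit r u p
        then (stride r s : ℂ) else 0 := by
  set w : ℕ → ℂ := fun u => (starRingEnd ℂ) (root (r u) (digit r u q + digit r u q')) *
    root (r u) (digit r u p) with hw
  have h1 : ∀ k, (starRingEnd ℂ) (chi r s k q) * (starRingEnd ℂ) (chi r s k q') * chi r s p k =
      ∏ u ∈ range s, w u ^ digit r u k := by
    intro k
    rw [chi, chi, chi, map_prod, map_prod, ← prod_mul_distrib, ← prod_mul_distrib]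
    refine prod_congr rfl fun u _ => ?_
    simp only [hw]
    rw [root_add, root_mul, root_mul, mul_comm (digit r u p), root_mul]
    simp only [map_mul, map_pow]
    ring
  have hw1 : ∀ u < s, w u ^ r u = 1 := by
    intro u hu
    rw [hw]
    simp only
    rw [mul_pow, ← map_pow, ← root_mul, ← root_mul, mul_comm (r u), root_mul, mul_comm (r u),
      root_mul, root_self (hr u hu).ne']
    simp
  have hiff : ∀ u < s, w u = 1 ↔ (digit r u q + digit r u q') % r u = digit r u p := by
    intro u hu
    have h2 : digit r u p = digit r u p % r u :=
      (Nat.mod_eq_of_lt (Nat.mod_lt _ (hr u hu))).symm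
    conv_rhs => rw [h2]
    rw [← root_eq_root_iff (hr u hu), hw]
    have hc := conj_root_mul (r u) (digit r u q + digit r u q')
    simp only
    constructor
    · intro h
      exact mul_left_cancel₀ (left_ne_zero_of_mul_eq_one hc) (hc.trans h.symm)
    · intro h
      rw [← h, hc]
  simp only [h1]
  rw [sum_prod_digit hr (fun u k => w u ^ k), prod_congr rfl fun u hu => sum_pow_eq (hw1 u (mem_range.1 hu))]
  split_ifs with h
  · rw [stride, Nat.cast_prod]
    exact prod_congr rfl fun u hu => by
      rw [if_pos ((hiff u (mem_range.1 hu)).2 (h u (mem_range.1 hu)))]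
  · push Not at h
    obtain ⟨u, hu, h⟩ := h
    exact prod_eq_zero (mem_range.2 hu) (by rw [if_neg (mt (hiff u hu).1 h)])

open Classical in
/-- The number of pairs of positions with values `1` whose sum is at the position `p`. -/
noncomputable def convCount (r : ℕ → ℕ) (s : ℕ) (x y : ℕ → Prop) (p : ℕ) : ℕ :=
  #{qq ∈ range (stride r s) ×ˢ range (stride r s) | x qq.1 ∧ y qq.2 ∧
    ∀ u < s, (digit r u qq.1 + digit r u qq.2) % r u = digit r u p}

-- Conjugating the product of the spectra makes a second forward transform act as the inverse one,
-- so the machine needs only one kind of transform. The conjugation of the result is invisible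
-- because the counts are real.
open Classical in
theorem dft_conj_mul {r : ℕ → ℕ} {s : ℕ} (hr : ∀ u < s, 0 < r u) (x y : ℕ → Prop) {p : ℕ}
    (hp : p < stride r s) :
    dft r (fun k => (starRingEnd ℂ) (dft r (fun q => if x q then 1 else 0) s k *
      dft r (fun q => if y q then 1 else 0) s k)) s p = stride r s * convCount r s x y p := by
  have h0 : ∀ (z : ℕ → ℂ) {k : ℕ}, k < stride r s → dft r z s k =
      ∑ q ∈ range (stride r s), z q * chi r s k q := by
    intro z k hk
    rw [dft_eq hr, Nat.div_eq_of_lt hk]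
    simp
  rw [h0 _ hp]
  calc _ = ∑ k ∈ range (stride r s), ∑ q ∈ range (stride r s), ∑ q' ∈ range (stride r s),
        (if x q then 1 else 0) * (if y q' then 1 else 0) * ((starRingEnd ℂ) (chi r s k q) *
          (starRingEnd ℂ) (chi r s k q') * chi r s p k) := by
        refine sum_congr rfl fun k hk => ?_
        rw [h0 _ (mem_range.1 hk), h0 _ (mem_range.1 hk), sum_mul_sum, map_sum, sum_mul]
        refine sum_congr rfl fun q _ => ?_
        rw [map_sum, sum_mul]
        refine sum_congr rfl fun q' _ => ?_
        simp only [map_mul, apply_ite (starRingEnd ℂ), map_one, map_zero]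
        ring
    _ = ∑ q ∈ range (stride r s), ∑ q' ∈ range (stride r s),
        (if x q then 1 else 0) * (if y q' then 1 else 0) *
          (if ∀ u < s, (digit r u q + digit r u q') % r u = digit r u p
            then (stride r s : ℂ) else 0) := by
        rw [sum_comm]
        refine sum_congr rfl fun q _ => ?_
        rw [sum_comm]
        refine sum_congr rfl fun q' _ => ?_
        rw [← mul_sum, sum_chi hr]
    _ = _ := by
        rw [convCount, card_filter, sum_product, Nat.cast_sum, mul_sum]
        refine sum_congr rfl fun q _ => ?_
        rw [Nat.cast_sum, mul_sum]
        refine sum_congr rfl fun q' _ => ?_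
        by_cases hx : x q <;> by_cases hy : y q' <;> simp [hx, hy]

theorem convCount_pos_iff {r : ℕ → ℕ} {s : ℕ} (x y : ℕ → Prop) (p : ℕ) :
    0 < convCount r s x y p ↔ ∃ q < stride r s, ∃ q' < stride r s, x q ∧ y q' ∧
      ∀ u < s, (digit r u q + digit r u q') % r u = digit r u p := by
  classical
  rw [convCount, card_pos]
  constructor
  · rintro ⟨⟨q, q'⟩, h⟩
    simp only [mem_filter, mem_product, mem_range] at h
    exact ⟨q, h.1.1, q', h.1.2, h.2⟩
  · rintro ⟨q, hq, q', hq', h⟩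
    exact ⟨(q, q'), by simp only [mem_filter, mem_product, mem_range]; exact ⟨⟨hq, hq'⟩, h⟩⟩

end WordRAM

namespace WordRAM

open Finset

variable {W H : ℕ}

/-! ### Machin's series for `π / 4` -/

/-- The terms of the series for `arctan (1/2) + arctan (1/3)`. -/
noncomputable def piTerm (k : ℕ) : ℂ :=
  (1 - 2 * ((k % 2 : ℕ) : ℂ)) * (1 / (2 * 4 ^ k) + 1 / (3 * 9 ^ k)) / (2 * k + 1)

/-- The series is `arctan (1/2) + arctan (1/3) = π / 4`. Its terms are at most `(1/4) ^ k`, so the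
remainder is at most `4/3 * (1/4) ^ K`. -/
theorem norm_piSum_sub_le (K : ℕ) :
    ‖∑ k ∈ range K, piTerm k - Real.pi / 4‖ ≤ 2 * (1 / 4) ^ K := by
  set f : ℕ → ℝ := fun k => (-1) ^ k * (2⁻¹ : ℝ) ^ (2 * k + 1) / ((2 * k + 1 : ℕ) : ℝ) +
    (-1) ^ k * (3⁻¹ : ℝ) ^ (2 * k + 1) / ((2 * k + 1 : ℕ) : ℝ) with hf
  have hs : HasSum f (Real.pi / 4) := by
    rw [← Real.arctan_inv_2_add_arctan_inv_3]
    exact (Real.hasSum_arctan (by norm_num)).add (Real.hasSum_arctan (by norm_num))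
  have hb : ∀ k, ‖f k‖ ≤ 1 * (1 / 4) ^ k := by
    intro k
    have h1 : (1 : ℝ) ≤ ((2 * k + 1 : ℕ) : ℝ) := by exact_mod_cast Nat.le_add_left 1 (2 * k)
    have h2 : ∀ c : ℝ, 0 < c → ‖(-1) ^ k * c ^ (2 * k + 1) / ((2 * k + 1 : ℕ) : ℝ)‖ ≤ c ^ (2 * k + 1) := by
      intro c hc
      rw [norm_div, norm_mul, norm_pow, norm_neg, norm_one, one_pow, one_mul, norm_pow,
        Real.norm_of_nonneg hc.le, Real.norm_of_nonneg (by linarith : (0:ℝ) ≤ ((2 * k + 1 : ℕ) : ℝ))]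
      exact div_le_self (by positivity) h1
    refine (norm_add_le _ _).trans ((add_le_add (h2 _ (by norm_num)) (h2 _ (by norm_num))).trans ?_)
    have h3 : (2⁻¹ : ℝ) ^ (2 * k + 1) = 1 / 2 * (1 / 4) ^ k := by
      rw [pow_succ, pow_mul]; norm_num; ring
    have h4 : (3⁻¹ : ℝ) ^ (2 * k + 1) = 1 / 3 * (1 / 9) ^ k := by
      rw [pow_succ, pow_mul]; norm_num; ring
    have h5 : (1 / 9 : ℝ) ^ k ≤ (1 / 4) ^ k := by gcongr; norm_num
    have h6 : (0 : ℝ) < (1 / 4) ^ k := by positivity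
    rw [h3, h4]
    linarith
  have hc : ∀ k, piTerm k = ((f k : ℝ) : ℂ) := by
    intro k
    have hsgn : (1 - 2 * ((k % 2 : ℕ) : ℂ)) = (-1) ^ k := by
      rcases Nat.mod_two_eq_zero_or_one k with h | h
      · rw [h, (Nat.even_iff.2 h).neg_one_pow]; simp
      · rw [h, (Nat.odd_iff.2 h).neg_one_pow]; norm_num
    rw [piTerm, hf, hsgn]
    push_cast
    rw [pow_succ (2⁻¹ : ℂ), pow_mul, pow_succ (3⁻¹ : ℂ), pow_mul]
    norm_num
    simp only [one_div, inv_pow]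
    ring
  have := norm_sub_le_of_geometric_bound_of_hasSum (by norm_num) hb hs K
  simp only [hc]
  rw [← Complex.ofReal_sum, show (Real.pi / 4 : ℂ) = ((Real.pi / 4 : ℝ) : ℂ) by push_cast; ring,
    ← Complex.ofReal_sub, Complex.norm_real]
  refine this.trans ?_
  have h6 : (0 : ℝ) < (1 / 4) ^ K := by positivity
  rw [div_le_iff₀ (by norm_num)]
  linarith

/-! ### Roots of unity by repeated squaring -/

/-- Squaring turns the error `b` into at most `b² + 2 b ≤ 5/2 b`; the two roundings, one when
squaring into the scratch array and one when copying back, add at most `b / 2`. -/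
theorem norm_sq_sub_sq_le {b ρ : ℝ} {u w w' w'' : ℂ} (hu : ‖u‖ = 1) (hw : ‖w - u‖ ≤ b) (hb : b ≤ 1 / 2)
    (hρ : 4 * ρ ≤ b) (h1 : ‖w' - w * w‖ ≤ ρ) (h2 : ‖w'' - w'‖ ≤ ρ) : ‖w'' - u * u‖ ≤ 3 * b := by
  rw [show w'' - u * u = (w'' - w') + (w' - w * w) + ((w - u) * (w - u) + 2 * u * (w - u)) by ring]
  refine (norm_add_le _ _).trans ?_
  have h3 : ‖(w - u) * (w - u) + 2 * u * (w - u)‖ ≤ b * b + 2 * b := by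
    refine (norm_add_le _ _).trans ?_
    rw [norm_mul, norm_mul, norm_mul, hu]
    have := norm_nonneg (w - u)
    norm_num
    nlinarith
  have h4 := norm_add_le (w'' - w') (w' - w * w)
  have := (norm_nonneg _).trans hw
  nlinarith

/-- The accuracy of the tables of roots of unity. -/
noncomputable def acc (K : ℕ) : ℝ := 120 * (3 / 4) ^ K

theorem acc_pos (K : ℕ) : 0 < acc K := by rw [acc]; positivity

theorem acc_le {K : ℕ} (hK : 600 ≤ K) : acc K ≤ 1 / 2 := by
  have h1 : (3 / 4 : ℝ) ^ K ≤ (3 / 4) ^ 24 := pow_le_pow_of_le_one (by norm_num) (by norm_num) (by omega)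
  rw [acc]
  refine (mul_le_mul_of_nonneg_left h1 (by norm_num)).trans ?_
  norm_num

/-- The state holds the constants of the computation: the order `n` of the group, the number `K` of
squarings, the powers `2 ^ K` and `16 ^ K`, and an approximation of `π / 4`. -/
structure Consts (n K : ℕ) (h : NState) : Prop where
  n_eq : h.reg 1 = n
  K_eq : h.reg 3 = K
  N_eq : h.reg 4 = 2 ^ K
  D_eq : h.reg rD = 2 ^ (4 * K)
  one_eq : h.reg 17 = 1
  pi_close : ‖h.carr 6 0 - Real.pi / 4‖ ≤ 6 / 2 ^ K

theorem Consts.frame {n K : ℕ} {h h' : NState} (hc : Consts n K h) {R A : List ℕ}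
    (hf : h.Frame R A h')
    (hR : 1 ∉ R ∧ 3 ∉ R ∧ 4 ∉ R ∧ 5 ∉ R ∧ 17 ∉ R) (hA : 6 ∉ A) : Consts n K h' := by
  obtain ⟨h1, h3, h4, h5, h17⟩ := hR
  exact ⟨by rw [hf.reg _ h1, hc.n_eq], by rw [hf.reg _ h3, hc.K_eq], by rw [hf.reg _ h4, hc.N_eq],
    by rw [hf.reg _ h5, hc.D_eq], by rw [hf.reg _ h17, hc.one_eq],
    by rw [hf.carr hA]; exact hc.pi_close⟩

/-- `1 + 2 π i x / (M 2 ^ K)` for the index `x`. -/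
def rootInit (y : ℕ) : CE :=
  .add (.nat (.nat 1)) (.divN (.mul .im (.mul (.nat (.mul (.nat 8) (.reg ix))) (.get 6 (.nat 0))))
    (.mul (.reg y) (.reg 4)))

def sqAt (T : ℕ) : CE := .mul (.get T (.reg ix)) (.get T (.reg ix))

def copyAt (T : ℕ) : CE := .get T (.reg ix)

/-- Fills the array `T` with the roots of unity of the order stored in the register `y`. -/
def rootProg (T y : ℕ) : Program :=
  .seq (.cmap T y (rootInit y))
    (.forLt 20 (.reg 3) (.seq (.cmap 3 y (sqAt T)) (.cmap T y (copyAt 3))))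

theorem two_pow_div_le {K : ℕ} (hK : 600 ≤ K) : (2 : ℝ) / 2 ^ (4 * K) ≤ 1 / 2 ^ K / 2 ^ K := by
  have h2 : (2 : ℝ) ≤ 2 ^ K := by
    calc (2 : ℝ) = 2 ^ 1 := by norm_num
      _ ≤ 2 ^ K := pow_le_pow_right₀ (by norm_num) (by omega)
  have h1 : (0 : ℝ) < 2 ^ K := by positivity
  have h4 : (2 : ℝ) ^ (4 * K) = 2 ^ K * 2 ^ K * 2 ^ K * 2 ^ K := by rw [mul_comm, pow_mul]; ring
  rw [div_div, div_le_div_iff₀ (by positivity) (by positivity), h4]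
  have h3 : (0 : ℝ) < 2 ^ K * 2 ^ K := by positivity
  have h5 : (2 : ℝ) ≤ 2 ^ K * 2 ^ K := by nlinarith
  nlinarith [mul_le_mul_of_nonneg_left h5 h3.le]

/-- In units of `1 / 4 ^ K` the error is at most 1 from rounding, 48 from the approximation of `π /
4`, which enters with a factor below `8 / 2 ^ K`, and 49 from the quadratic remainder of `exp`, as
`2 π < 7`. The constant 120 leaves a margin of 22. -/
theorem norm_exp_init_le {K M i : ℕ} (hK : 600 ≤ K) (hi : i < M) {p w : ℂ}
    (hp : ‖p - Real.pi / 4‖ ≤ 6 / 2 ^ K)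
    (hw : ‖w - (1 + Complex.I * (((8 * i : ℕ) : ℂ) * p) / ((M * 2 ^ K : ℕ) : ℂ))‖ ≤ 2 / 2 ^ (4 * K)) :
    ‖w - Complex.exp (2 * Real.pi * Complex.I * (i / M) / 2 ^ K)‖ ≤ 120 / 2 ^ K / 2 ^ K := by
  have hM : (0 : ℝ) < M := by exact_mod_cast (by omega : 0 < M)
  have hMc : (M : ℂ) ≠ 0 := by exact_mod_cast hM.ne'
  have h2 : (8 : ℝ) ≤ 2 ^ K := by
    calc (8 : ℝ) = 2 ^ 3 := by norm_num
      _ ≤ 2 ^ K := pow_le_pow_right₀ (by norm_num) (by omega)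
  set N : ℝ := 2 ^ K with hN
  have hNc : (2 : ℂ) ^ K = (N : ℂ) := by rw [hN]; push_cast; rfl
  have hN0 : 0 < N := by linarith
  have hq1 : (i : ℝ) / M ≤ 1 := by rw [div_le_one hM]; exact_mod_cast hi.le
  have hq0 : 0 ≤ (i : ℝ) / M := by positivity
  set x : ℂ := 2 * Real.pi * Complex.I * (i / M) / 2 ^ K with hx
  have hxn : ‖x‖ ≤ 7 / N := by
    have : ‖x‖ = 2 * Real.pi * (i / M) / N := by
      rw [hx, hNc]
      simp [abs_of_pos Real.pi_pos, abs_of_pos hN0]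
    rw [this]
    gcongr
    have := Real.pi_lt_d2
    have := Real.pi_pos
    nlinarith
  have hx1 : ‖x‖ ≤ 1 := hxn.trans (by rw [div_le_one hN0]; linarith)
  have h3 := Complex.norm_exp_sub_one_sub_id_le hx1
  have h4 : ‖x‖ ^ 2 ≤ 49 / N / N := by
    calc ‖x‖ ^ 2 ≤ (7 / N) ^ 2 := by gcongr
      _ = 49 / N / N := by ring
  set E : ℂ := Complex.I * (((8 * i : ℕ) : ℂ) * p) / ((M * 2 ^ K : ℕ) : ℂ) with hE
  have h5 : ‖E - x‖ ≤ 48 / N / N := by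
    have e : E - x = Complex.I * (8 * (((i / M : ℝ)) : ℂ) / (N : ℂ)) * (p - Real.pi / 4) := by
      rw [hE, hx]
      push_cast
      rw [hNc]
      have : (N : ℂ) ≠ 0 := by exact_mod_cast hN0.ne'
      field_simp
      ring
    rw [e, norm_mul, norm_mul, Complex.norm_I, one_mul, norm_div, norm_mul, Complex.norm_real,
      Complex.norm_real, Real.norm_of_nonneg hq0, Real.norm_of_nonneg hN0.le]
    norm_num
    calc 8 * ((i : ℝ) / M) / N * ‖p - Real.pi / 4‖ ≤ 8 * 1 / N * (6 / N) := by gcongr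
      _ = 48 / N / N := by ring
  have h6 := two_pow_div_le hK
  rw [show w - Complex.exp x = (w - (1 + E)) + ((E - x) - (Complex.exp x - 1 - x)) by ring]
  refine (norm_add_le _ _).trans ?_
  have h7 := norm_sub_le (E - x) (Complex.exp x - 1 - x)
  have h8 : (120 : ℝ) / N / N = 1 / N / N + 48 / N / N + 49 / N / N + 22 / N / N := by ring
  have h9 : 0 ≤ 22 / N / N := by positivity
  rw [← hN] at h6
  linarith

/-- After `k` squarings the entry `i` approximates the number of modulus 1 with argument `2 π (i /
M) 2 ^ k / 2 ^ K`. Each squaring at most triples the error, so `120 / 4 ^ K` grows to `120 * 3 ^ K /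
4 ^ K = acc K`. -/
theorem Runs.rootProg (hF : Fits W H) {n K M : ℕ} (hK : 600 ≤ K)
    (hP : Prec H (2 ^ (4 * K)) (acc K) (2 ^ (3 * K))) {h : NState} (hb : h.Bd H) (hc : Consts n K h)
    {T y : ℕ} (hy : y ≠ ix ∧ y ≠ 20) (hM : h.reg y = M)
    (fit1 : (rootInit y).Fit T) (fit2 : (sqAt T).Fit 3) (fit3 : (copyAt 3).Fit T) :
    Runs W H (rootProg T y) h ((M + 1) * (K + 1) * (23 * costBound)) (fun h' =>
      h.Frame [ix, 20] [T, 3] h' ∧ ∀ i < M, Cl (acc K) 1 (h'.carr T i) (root M i)) := by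
  have hcB : 100 ≤ costBound := by decide
  set D : ℕ := 2 ^ (4 * K) with hD
  have hDr : (D : ℝ) = 2 ^ (4 * K) := by rw [hD]; push_cast; rfl
  have hD0 : 0 < D := hP.D_pos
  have hN8 : (600 : ℝ) ≤ 2 ^ K := by
    calc (600 : ℝ) ≤ 2 ^ 10 := by norm_num
      _ ≤ 2 ^ K := pow_le_pow_right₀ (by norm_num) (by omega)
  have hbd : ∀ z : ℂ, ‖z‖ ≤ 1000 → (‖z‖ + 1) * D ≤ H := by
    intro z hz
    refine le_trans ?_ hP.bound
    have h1 : (2000 : ℝ) ≤ 2 ^ (3 * K) := by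
      calc (2000 : ℝ) ≤ 2 ^ 11 := by norm_num
        _ ≤ 2 ^ (3 * K) := pow_le_pow_right₀ (by norm_num) (by omega)
    gcongr
    linarith
  set u : ℕ → ℕ → ℂ := fun k i => Complex.exp (2 * Real.pi * Complex.I * (i / M) / 2 ^ K * 2 ^ k) with hu
  have hun : ∀ k i, ‖u k i‖ = 1 := by
    intro k i
    rw [hu]
    simp only
    rw [show (2 * Real.pi * Complex.I * (i / M) / 2 ^ K * 2 ^ k : ℂ) =
      ((2 * Real.pi * (i / M) / 2 ^ K * 2 ^ k : ℝ) : ℂ) * Complex.I by push_cast; ring,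
      Complex.norm_exp_ofReal_mul_I]
  have husq : ∀ k i, u (k + 1) i = u k i * u k i := by
    intro k i
    rw [hu]
    simp only
    rw [← Complex.exp_add]
    congr 1
    ring
  set b : ℕ → ℝ := fun k => 3 ^ k * (120 / 2 ^ K / 2 ^ K) with hbdef
  have hb0 : 120 / 2 ^ K / 2 ^ K ≤ (1 : ℝ) / 2 := by
    rw [div_div, div_le_div_iff₀ (by positivity) (by norm_num)]; nlinarith
  have hbK : b K = acc K := by
    rw [hbdef, acc]
    simp only
    rw [div_pow, show (4 : ℝ) = 2 * 2 by norm_num, mul_pow]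
    ring
  have hbmono : ∀ k l, k ≤ l → b k ≤ b l := by
    intro k l hkl
    simp only [hbdef]
    gcongr
    norm_num
  have h2D : (2 : ℝ) / D ≤ 1 / 2 ^ K / 2 ^ K := by rw [hDr]; exact two_pow_div_le hK
  have hρ : ∀ k, 4 * (2 / (D : ℝ)) ≤ b k := by
    intro k
    refine le_trans ?_ (hbmono 0 k (Nat.zero_le _))
    have : (0 : ℝ) ≤ 1 / 2 ^ K / 2 ^ K := by positivity
    have e : b 0 = 120 * (1 / 2 ^ K / 2 ^ K) := by simp only [hbdef]; ring
    rw [e]; linarith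
  have hbh : ∀ k ≤ K, b k ≤ 1 / 2 := fun k hk => (hbmono k K hk).trans (hbK ▸ acc_le hK)
  -- the initial values
  have hw0 : ∀ i < M, (rootInit y).eval (h.set ix i) =
      1 + Complex.I * (((8 * i : ℕ) : ℂ) * h.carr 6 0) / ((M * 2 ^ K : ℕ) : ℂ) := by
    intro i _
    simp [rootInit, CE.eval, NE.eval, hy.1, hM, hc.N_eq, NState.carr]
  have hinit : ∀ i < M, ∀ w : ℂ, ‖w - (rootInit y).eval (h.set ix i)‖ ≤ 2 / D →
      ‖w - u 0 i‖ ≤ b 0 := by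
    intro i hi w hw
    rw [hw0 i hi, hDr] at hw
    have := norm_exp_init_le hK hi hc.pi_close hw
    simpa [hu, hbdef] using this
  have hstep : ∀ k < K, ∀ g : NState, g.Bd H → g.reg 20 = k →
      (h.Frame [ix, 20] [T, 3] g ∧ ∀ i < M, ‖g.carr T i - u k i‖ ≤ b k) →
      Runs W H (.seq (.cmap 3 y (sqAt T)) (.cmap T y (copyAt 3))) g
        ((M + 1) * (10 * costBound) + (M + 1) * (10 * costBound))
        (fun h' => h'.reg 20 = k ∧ (h.Frame [ix, 20] [T, 3] (h'.set 20 (k + 1)) ∧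
          ∀ i < M, ‖(h'.set 20 (k + 1)).carr T i - u (k + 1) i‖ ≤ b (k + 1))) := by
    intro k hk g hgb hgk ⟨hgf, hgc⟩
    have gy : g.reg y = M := by rw [hgf.reg y (by simp [hy.1, hy.2]), hM]
    have gD : g.reg rD = D := by rw [hgf.reg rD (by decide), hc.D_eq]
    have hsmall : ∀ i < M, ‖g.carr T i‖ ≤ 2 := by
      intro i hi
      have h1 := norm_add_le (g.carr T i - u k i) (u k i)
      rw [sub_add_cancel, hun] at h1
      linarith [hgc i hi, hbh k hk.le]
    refine Runs.seq (Runs.cmap hF fit2 hgb hy.1 gy gD hD0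
      (fun i _ => by simp [sqAt, CE.Ok, NE.Ok]) (fun i hi => hbd _ ?_)) (fun g' hgb' ⟨hgf', hgc'⟩ => ?_)
    · have : ‖(sqAt T).eval (g.set ix i)‖ ≤ 2 * 2 := by
        simp only [sqAt, CE.eval, NE.eval, NState.set_reg_self, norm_mul]
        exact mul_le_mul (hsmall i hi) (hsmall i hi) (norm_nonneg _) (by norm_num)
      linarith
    · have gy' : g'.reg y = M := by rw [hgf'.reg y (by simp [hy.1]), gy]
      have gD' : g'.reg rD = D := by rw [hgf'.reg rD (by decide), gD]
      have hsq : ∀ i < M, ‖g'.carr 3 i - g.carr T i * g.carr T i‖ ≤ 2 / D := by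
        intro i hi
        have := hgc' i hi
        simpa only [sqAt, CE.eval, NE.eval, NState.set_reg_self, NState.carr, NState.set_mem] using this
      refine (Runs.cmap hF fit3 hgb' hy.1 gy' gD' hD0
        (fun i _ => by simp [copyAt, CE.Ok, NE.Ok]) (fun i hi => hbd _ ?_)).mono le_rfl ?_
      · have h1 := norm_add_le (g'.carr 3 i - g.carr T i * g.carr T i) (g.carr T i * g.carr T i)
        rw [sub_add_cancel, norm_mul] at h1
        have h2 := mul_le_mul (hsmall i hi) (hsmall i hi) (norm_nonneg _) (by norm_num)
        have h3 := hρ k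
        have h4 := hbh k hk.le
        have h5 := hsq i hi
        simp only [copyAt, CE.eval, NE.eval, NState.set_reg_self]
        simp only [NState.carr, NState.set_mem] at h1 h2 h5 ⊢
        linarith
      · rintro h' - ⟨hf', hc'⟩
        refine ⟨?_, ?_, fun i hi => ?_⟩
        · rw [hf'.reg 20 (by decide), hgf'.reg 20 (by decide), hgk]
        · exact ((hgf.trans' hgf' (by simp) (by simp)).trans' hf' (by simp) (by simp)).set (by simp) _
        · have h1 := hc' i hi
          simp only [copyAt, CE.eval, NE.eval, NState.set_reg_self] at h1
          rw [husq, show b (k + 1) = 3 * b k by simp only [hbdef]; ring]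
          exact norm_sq_sub_sq_le (hun k i) (hgc i hi) (hbh k hk.le) (hρ k) (hsq i hi) h1
  refine (Runs.seq (Runs.cmap hF fit1 hb hy.1 hM hc.D_eq hD0
    (fun i hi => ?_) (fun i hi => hbd _ ?_)) (fun g hgb ⟨hgf, hgc⟩ =>
      Runs.forLt hF (x := 20) (N := .reg 3) K
        (fun k g => h.Frame [ix, 20] [T, 3] g ∧ ∀ i < M, ‖g.carr T i - u k i‖ ≤ b k)
        (fun _ => (M + 1) * (10 * costBound) + (M + 1) * (10 * costBound)) ?_ rfl
        (by decide) (fun k _ g' _ hI => ⟨trivial, ?_⟩) hstep hgb ⟨?_, fun i hi => ?_⟩)).mono ?_ ?_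
  · refine ⟨trivial, ⟨trivial, ⟨trivial, trivial⟩, trivial⟩, ⟨trivial, trivial⟩, ?_⟩
    simp only [NE.eval, NState.set_reg_ne _ hy.1, hM, ne_eq, NState.set_reg_ne _ (show 4 ≠ ix by decide),
      hc.N_eq]
    have : 0 < M * 2 ^ K := Nat.mul_pos (by omega) (by positivity)
    omega
  · have h1 := hinit i hi ((rootInit y).eval (h.set ix i))
      (by rw [sub_self, norm_zero]; positivity)
    have h2 := norm_add_le ((rootInit y).eval (h.set ix i) - u 0 i) (u 0 i)
    rw [sub_add_cancel, hun] at h2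
    linarith [hbh 0 (Nat.zero_le _)]
  · rw [← hc.K_eq]; exact hb.reg_le _
  · simp only [NE.eval]; rw [hI.1.reg 3 (by decide), hc.K_eq]
  · exact ((hgf.mono (R' := [ix, 20]) (A' := [T, 3]) (by simp) (by simp))).set (by simp) _
  · exact hinit i hi _ (hgc i hi)
  · rw [sum_const, card_range, smul_eq_mul]
    have : (M + 1) * (K + 1) * (23 * costBound) = (M + 1) * (10 * costBound) +
      (K * ((M + 1) * (10 * costBound) + (M + 1) * (10 * costBound) + 3 * costBound) + 3 * costBound) +
      (3 * K * M * costBound + 13 * M * costBound + 10 * costBound) := by ring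
    omega
  · rintro h' - ⟨-, hf, hcl⟩
    refine ⟨hf, fun i hi => ⟨(norm_root _ _).le, ?_⟩⟩
    have h1 := hcl i hi
    rw [hbK] at h1
    have h2 : u K i = root M i := by
      simp only [hu, root]
      congr 1
      field_simp
    rw [h2] at h1
    simpa using h1

end WordRAM

namespace WordRAM

open Finset

variable {W H : ℕ}

/-! ### The constants of the computation -/

/-- Multiplies the orders stored in the array `0`. -/
def orderProg : Program :=
  .seq (.nset 1 (NE.nat 1))
    (.forLt 6 (.reg 0) (.seq (.assign 8 (.get 0 (.reg 6)))
      (.nset 1 (NE.mul (.reg 1) (.reg 8)))))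

theorem Runs.readOrder (hF : Fits W H) {h : NState} (hb : h.Bd H) {t k : ℕ} (ht : h.reg 6 = t)
    (hk : h.mem 0 t = k) :
    Runs W H (.assign 8 (.get 0 (.reg 6))) h (costBound + 1) (fun h' => h' = h.set 8 k) := by
  refine Runs.assign hF hb trivial (by decide) ⟨trivial, t, by simp [Expr.eval, NState.st, ht]⟩ ?_ ?_
  · simp [Expr.eval, NState.st, ht, hk]
  · have := hb.mem_le 0 t
    rw [hk, ht_natCast] at this
    exact (le_max_left _ _).trans this

theorem stride_le_stride {r : ℕ → ℕ} {t s : ℕ} (hts : t ≤ s) (hr : ∀ u < s, 0 < r u) :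
    stride r t ≤ stride r s :=
  Nat.le_of_dvd (stride_pos hr) (stride_dvd hts)

theorem Runs.order (hF : Fits W H) {h : NState} (hb : h.Bd H) {r : ℕ → ℕ} {s : ℕ}
    (hr : ∀ t < s, 0 < r t) (hs : h.reg 0 = s) (hm : ∀ t < s, h.mem 0 t = r t)
    (hn : stride r s ≤ H) :
    Runs W H orderProg h ((s + 1) * (6 * costBound)) (fun h' =>
      h.Frame [1, 6, 8] [] h' ∧ h'.reg 1 = stride r s) := by
  have hcB : 100 ≤ costBound := by decide
  have h64 := hF.two_le
  refine (Runs.seq (Runs.assignNat hF hb (e := .nat 1) rfl (by decide) trivial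
    (by simp only [NE.eval]; omega)) (fun g hgb hg =>
      Runs.forLt hF (x := 6) (N := .reg 0) s
        (fun k g => h.Frame [1, 6, 8] [] g ∧ g.reg 1 = stride r k) (fun _ => 2 * (costBound + 1))
        (hs ▸ hb.reg_le 0) rfl (by decide) (fun k _ g' _ hI => ⟨trivial, ?_⟩)
        (fun k hk g' hgb' hgk hI => ?_) hgb ⟨?_, ?_⟩)).mono ?_ (fun h' _ hq => hq.2)
  · simp only [NE.eval]; rw [hI.1.reg 0 (by decide), hs]
  · refine (Runs.seq (Runs.readOrder hF hgb' hgk (k := r k) (by rw [hI.1.inp 0 (by omega), hm k hk]))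
      (fun g1 hgb1 hg1 => (Runs.assignNat hF hgb1 (e := NE.mul (.reg 1) (.reg 8)) rfl (by decide)
        ⟨trivial, trivial⟩ ?_).mono le_rfl ?_)).mono (by omega) (fun _ _ h => h)
    · subst hg1
      simp only [NE.eval, NState.set_reg_self]
      rw [NState.set_reg_ne _ (by decide), hI.2, ← stride_succ]
      exact (stride_le_stride hk hr).trans hn
    · rintro g2 - rfl
      subst hg1
      simp only [NE.eval, NState.set_reg_self]
      rw [NState.set_reg_ne _ (show 1 ≠ 8 by decide), hI.2, ← stride_succ]
      refine ⟨?_, ((hI.1.set (by decide) _).set (by decide) _).set (by decide) _, ?_⟩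
      · simp [hgk]
      · simp
  · subst hg
    exact ((NState.Frame.refl _ _ h).set (by decide) _).set (by decide) _
  · subst hg; simp [NE.eval, stride]
  · rw [sum_const, card_range, smul_eq_mul]
    nlinarith

/-- Computes the least power `2 ^ k ≥ e` in the register `q`, and `k` in the register `k`. -/
def logProg (q k : ℕ) (e : NE) : Program :=
  .seq (.nset q (NE.nat 1)) (.seq (.nset k (NE.nat 0))
    (.loop (.reg q) e.comp (.seq (.nset q (NE.mul (.nat 2) (.reg q)))
      (.nset k (NE.add (.reg k) (.nat 1))))))

theorem Runs.log (hF : Fits W H) {h : NState} (hb : h.Bd H) {q k : ℕ} (hqk : q ≠ k) {e : NE}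
    (hs : e.small = true) (hcost : e.comp.cost ≤ costBound) {v : ℕ}
    (he : ∀ g : NState, h.Frame [q, k] [] g → e.Ok g.reg ∧ e.eval g.reg = v)
    (hv : 2 ^ Nat.clog 2 v ≤ H) :
    Runs W H (logProg q k e) h ((Nat.clog 2 v + 1) * (5 * costBound)) (fun h' =>
      h.Frame [q, k] [] h' ∧ h'.reg q = 2 ^ Nat.clog 2 v ∧ h'.reg k = Nat.clog 2 v) := by
  have hcB : 100 ≤ costBound := by decide
  have h64 := hF.two_le
  have hvH : Nat.clog 2 v ≤ H := (Nat.lt_two_pow_self).le.trans hv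
  refine (Runs.seq (Runs.assignNat hF hb (e := .nat 1) rfl (by decide) trivial
    (by simp only [NE.eval]; omega)) (fun g1 hgb1 hg1 => Runs.seq (Runs.assignNat hF hgb1 (e := .nat 0)
      rfl (by decide) trivial (by simp only [NE.eval]; omega)) (fun g2 hgb2 hg2 =>
      Runs.loop (Nat.clog 2 v) (fun l g => h.Frame [q, k] [] g ∧ g.reg q = 2 ^ l ∧ g.reg k = l)
        (fun _ => 2 * (costBound + 1)) (fun l hl g hgb hI => ?_) (fun l hl g hgb hI => ?_) hgb2 ?_))).mono
      ?_ (fun _ _ h => h)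
  · obtain ⟨e1, e2⟩ := he g hI.1
    refine ⟨hgb.valid hF trivial (by simp only [Expr.cost]; omega) trivial,
      hgb.valid hF (e.comp_constLe h64 hs) hcost (e.comp_ok _ e1), ?_⟩
    rw [NE.comp_eval, e2, Nat.lt_clog_iff_pow_lt (by norm_num)]
    simp only [Expr.eval, NState.st, hI.2.1]
    exact Nat.cast_lt
  · have hle : 2 ^ (l + 1) ≤ H := (Nat.pow_le_pow_right (by norm_num) hl).trans hv
    refine (Runs.seq (Runs.assignNat hF hgb (e := NE.mul (.nat 2) (.reg q)) rfl (by simp only [NE.comp, Expr.cost]; omega)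
      ⟨trivial, trivial⟩ ?_) (fun g3 hgb3 hg3 => (Runs.assignNat hF hgb3 (e := NE.add (.reg k) (.nat 1))
        rfl (by simp only [NE.comp, Expr.cost]; omega) ⟨trivial, trivial⟩ ?_).mono le_rfl ?_)).mono
        (by omega) (fun _ _ h => h)
    · simp only [NE.eval, hI.2.1]; rwa [← pow_succ']
    · subst hg3
      simp only [NE.eval, NState.set_reg_ne _ hqk.symm, hI.2.2]; omega
    · rintro g4 - rfl
      subst hg3
      refine ⟨(hI.1.set (by simp) _).set (by simp) _, ?_, ?_⟩
      · simp [NE.eval, hqk, hI.2.1, pow_succ']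
      · simp [NE.eval, hqk.symm, hI.2.2]
  · subst hg1; subst hg2
    refine ⟨((NState.Frame.refl _ _ h).set (by simp) _).set (by simp) _, ?_, ?_⟩
    · simp [NE.eval, hqk]
    · simp [NE.eval]
  · have he1 := e.comp.one_le_cost
    rw [sum_const, card_range, smul_eq_mul]
    simp only [Expr.cost]
    nlinarith

/-- Computes `K`, `2 ^ K` and `16 ^ K` from the logarithm of the order. -/
def powProg : Program :=
  -- The factor 600 is split because constants in `NE` are kept to at most 64.
  .seq (.nset 3 (NE.mul (.nat 60) (.mul (.nat 10) (.reg 2))))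
    (.seq (.nset 4 (NE.nat 1))
      (.seq (.forLt 20 (.reg 3) (.nset 4 (NE.mul (.nat 2) (.reg 4))))
        (.seq (.nset 5 (NE.mul (.mul (.reg 4) (.reg 4)) (.mul (.reg 4) (.reg 4))))
          (.nset 17 (NE.nat 1)))))

theorem Runs.pow (hF : Fits W H) {h : NState} (hb : h.Bd H) {K : ℕ} (hK : 60 * (10 * h.reg 2) = K)
    (hH : 2 ^ (8 * K) ≤ H) :
    Runs W H powProg h ((K + 1) * (12 * costBound)) (fun h' => h.Frame [3, 4, 5, 17, 20] [] h' ∧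
      h'.reg 3 = K ∧ h'.reg 4 = 2 ^ K ∧ h'.reg 5 = 2 ^ (4 * K) ∧ h'.reg 17 = 1) := by
  have hcB : 100 ≤ costBound := by decide
  have h64 := hF.two_le
  have hpow : ∀ a ≤ 8 * K, 2 ^ a ≤ H := fun a ha => (Nat.pow_le_pow_right (by norm_num) ha).trans hH
  have hKH : K ≤ H := (Nat.lt_two_pow_self).le.trans (hpow K (by omega))
  refine (Runs.seq (Runs.assignNat hF hb (by rfl) (by decide) (by simp [NE.Ok])
    (by simp only [NE.eval]; omega)) (fun g1 hgb1 hg1 => Runs.seq (Runs.assignNat hF hgb1 (by rfl) (by decide)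
      (by simp [NE.Ok]) (by simp only [NE.eval]; omega)) (fun g2 hgb2 hg2 => Runs.seq
      (Runs.forLt hF (x := 20) (N := .reg 3) K
        (fun k g => h.Frame [3, 4, 5, 17, 20] [] g ∧ g.reg 3 = K ∧ g.reg 4 = 2 ^ k)
        (fun _ => costBound + 1) hKH (by rfl) (by decide) (fun k _ g' _ hI => ⟨trivial, hI.2.1⟩)
        (fun k hk g' hgb' hgk hI => (Runs.assignNat hF hgb' (by rfl) (by decide) (by simp [NE.Ok]) ?_).mono
          le_rfl ?_) hgb2 ?_) (fun g3 hgb3 hg3 => Runs.seq (Runs.assignNat hF hgb3 (by rfl) (by decide)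
            (by simp [NE.Ok]) ?_) (fun g4 hgb4 hg4 => (Runs.assignNat hF hgb4 (by rfl) (by decide)
              (by simp [NE.Ok]) (by simp only [NE.eval]; omega)).mono le_rfl ?_))))).mono ?_ (fun _ _ h => h)
  · simp only [NE.eval, hI.2.2]
    rw [← pow_succ']
    exact hpow _ (by omega)
  · rintro g - rfl
    refine ⟨by simp [hgk], (hI.1.set (by decide) _).set (by decide) _, ?_, ?_⟩
    · simp [hI.2.1]
    · simp [NE.eval, hI.2.2, pow_succ']
  · subst hg1; subst hg2
    refine ⟨(((NState.Frame.refl _ _ h).set (by decide) _).set (by decide) _).set (by decide) _, ?_, ?_⟩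
    · simp [NE.eval, hK]
    · simp [NE.eval]
  · simp only [NE.eval, hg3.2.2.2]
    rw [← pow_add, ← pow_add]
    exact hpow _ (by omega)
  · rintro g - rfl
    subst hg4
    refine ⟨(hg3.2.1.set (by decide) _).set (by decide) _, ?_, ?_, ?_, ?_⟩
    · simp [hg3.2.2.1]
    · simp [hg3.2.2.2]
    · simp only [NE.eval, hg3.2.2.2]
      rw [NState.set_reg_ne _ (by decide), NState.set_reg_self]
      ring
    · simp [NE.eval]
  · rw [sum_const, card_range, smul_eq_mul]
    nlinarith

/-- Registers 18 and 19 hold `4 ^ k` and `9 ^ k`, where `k` is the loop counter in register 20. -/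
def piExpr : CE :=
  .add (.get 6 (.reg ix)) (.divN (.mul (.sub (.nat (.nat 1)) (.nat (.mul (.nat 2) (.mod (.reg 20) (.nat 2)))))
    (.add (.divN (.nat (.nat 1)) (.mul (.nat 2) (.reg 18))) (.divN (.nat (.nat 1)) (.mul (.nat 3) (.reg 19)))))
    (.add (.mul (.nat 2) (.reg 20)) (.nat 1)))

/-- Sums the series for `π / 4`. -/
def piProg : Program :=
  .seq (.nset 18 (NE.nat 1)) (.seq (.nset 19 (NE.nat 1))
    (.forLt 20 (.reg 3) (.seq (.cmap 3 17 piExpr) (.seq (.cmap 6 17 (copyAt 3))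
      (.seq (.nset 18 (NE.mul (.nat 4) (.reg 18)))
        (.nset 19 (NE.mul (.nat 9) (.reg 19))))))))

theorem piExpr_fit : piExpr.Fit 3 := ⟨by decide, by decide, by decide, by decide, by decide, by decide⟩

theorem copyAt_fit (a b : ℕ) (hab : a ≠ b) : (copyAt a).Fit b := by
  have h1 : 4 + 2 * a ≠ 4 + 2 * b := by omega
  have h2 : 5 + 2 * a ≠ 5 + 2 * b := by omega
  have h3 : 5 + 2 * a ≠ 4 + 2 * b := by omega
  refine ⟨rfl, by simp [copyAt, CE.comp, Expr.rnd, NE.comp, Expr.cost, costBound],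
    by simp [copyAt, CE.comp, Expr.rnd, NE.comp, Expr.cost, costBound], ?_, ?_, ?_⟩
  · simpa [copyAt, CE.comp, Expr.avoids, NE.comp] using h1
  · simpa [copyAt, CE.comp, Expr.avoids, NE.comp] using h2
  · simpa [copyAt, CE.comp, Expr.avoids, NE.comp] using h3

theorem norm_piTerm_le (k : ℕ) : ‖piTerm k‖ ≤ 1 := by
  have h1 := norm_piSum_sub_le k
  have h2 := norm_piSum_sub_le (k + 1)
  rw [piTerm, norm_div, norm_mul]
  have h3 : ‖(1 - 2 * ((k % 2 : ℕ) : ℂ))‖ = 1 := by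
    rcases Nat.mod_two_eq_zero_or_one k with h | h <;> rw [h] <;> norm_num
  have h4 : ‖(1 / (2 * 4 ^ k) + 1 / (3 * 9 ^ k) : ℂ)‖ ≤ 1 / 2 + 1 / 3 := by
    refine (norm_add_le _ _).trans (add_le_add ?_ ?_)
    · rw [norm_div, norm_mul, norm_pow]
      norm_num
      exact (inv_le_one_of_one_le₀ (one_le_pow₀ (by norm_num)))
    · rw [norm_div, norm_mul, norm_pow]
      norm_num
      exact (inv_le_one_of_one_le₀ (one_le_pow₀ (by norm_num)))
  have h5 : 1 ≤ ‖(2 * k + 1 : ℂ)‖ := by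
    have : (2 * k + 1 : ℂ) = ((2 * k + 1 : ℕ) : ℂ) := by push_cast; ring
    rw [this, Complex.norm_natCast]
    exact_mod_cast Nat.le_add_left 1 (2 * k)
  rw [h3, one_mul]
  exact (div_le_self (norm_nonneg _) h5).trans (h4.trans (by norm_num))

/-- Each term adds two roundings of `2 / D`; over `K` terms this is at most `2 / 2 ^ K`. The
truncation of the series costs at most another `2 / 2 ^ K`. -/
theorem Runs.pi (hF : Fits W H) {K : ℕ} (hK : 600 ≤ K)
    (hP : Prec H (2 ^ (4 * K)) (acc K) (2 ^ (3 * K))) (hH : 2 ^ (8 * K) ≤ H) {h : NState} (hb : h.Bd H)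
    (h3 : h.reg 3 = K) (h5 : h.reg rD = 2 ^ (4 * K)) (h17 : h.reg 17 = 1) (h0 : h.carr 6 0 = 0) :
    Runs W H piProg h ((K + 1) * (50 * costBound)) (fun h' =>
      h.Frame [15, 18, 19, 20] [3, 6] h' ∧ ‖h'.carr 6 0 - Real.pi / 4‖ ≤ 6 / 2 ^ K) := by
  have hcB : 100 ≤ costBound := by decide
  have h64 := hF.two_le
  set D : ℕ := 2 ^ (4 * K) with hD
  have hDr : (D : ℝ) = 2 ^ (4 * K) := by rw [hD]; push_cast; rfl
  have hD0 : 0 < D := hP.D_pos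
  have hKr : (K : ℝ) ≤ 2 ^ K := by exact_mod_cast (Nat.lt_two_pow_self).le
  have hK600 : (600 : ℝ) ≤ K := by exact_mod_cast hK
  have h2D : (2 : ℝ) / D ≤ 1 / 2 ^ K / 2 ^ K := by rw [hDr]; exact two_pow_div_le hK
  have hD1 : (2 : ℝ) / D ≤ 1 := by
    refine h2D.trans ?_
    rw [div_div, div_le_one (by positivity)]
    nlinarith
  have hbd : ∀ z : ℂ, ‖z‖ ≤ 5 * 2 ^ K → (‖z‖ + 1) * D ≤ H := by
    intro z hz
    refine le_trans ?_ hP.bound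
    have h1 : (2 : ℝ) ^ (3 * K) = 2 ^ K * (2 ^ K * 2 ^ K) := by rw [mul_comm, pow_mul]; ring
    have h2 : (600 : ℝ) * 600 ≤ 2 ^ K * 2 ^ K := by nlinarith
    gcongr
    rw [h1]
    nlinarith
  have h9 : ∀ k ≤ K, 9 ^ k ≤ H := by
    intro k hk
    calc 9 ^ k ≤ 16 ^ k := Nat.pow_le_pow_left (by norm_num) _
      _ = 2 ^ (4 * k) := by rw [pow_mul]; norm_num
      _ ≤ 2 ^ (8 * K) := Nat.pow_le_pow_right (by norm_num) (by omega)
      _ ≤ H := hH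
  have h4 : ∀ k ≤ K, 4 ^ k ≤ H := fun k hk => (Nat.pow_le_pow_left (by norm_num) _).trans (h9 k hk)
  have hsum : ∀ k, ‖∑ l ∈ range k, piTerm l‖ ≤ k := by
    intro k
    refine (norm_sum_le _ _).trans ((sum_le_sum fun l _ => norm_piTerm_le l).trans ?_)
    simp
  set I : ℕ → NState → Prop := fun k g => h.Frame [15, 18, 19, 20] [3, 6] g ∧
    ‖g.carr 6 0 - ∑ l ∈ range k, piTerm l‖ ≤ k * (2 * (2 / D)) ∧ g.reg 18 = 4 ^ k ∧ g.reg 19 = 9 ^ k with hI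
  have hstep : ∀ k < K, ∀ g : NState, g.Bd H → g.reg 20 = k → I k g →
      Runs W H (.seq (.cmap 3 17 piExpr) (.seq (.cmap 6 17 (copyAt 3))
        (.seq (.nset 18 (NE.mul (.nat 4) (.reg 18)))
        (.nset 19 (NE.mul (.nat 9) (.reg 19)))))) g
        ((1 + 1) * (10 * costBound) + ((1 + 1) * (10 * costBound) + ((costBound + 1) + (costBound + 1))))
        (fun h' => h'.reg 20 = k ∧ I (k + 1) (h'.set 20 (k + 1))) := by
    intro k hk g hgb hgk ⟨hgf, hgc, hg18, hg19⟩
    have g17 : g.reg 17 = 1 := by rw [hgf.reg 17 (by decide), h17]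
    have gD : g.reg rD = D := by rw [hgf.reg rD (by decide), h5]
    have hkr : (k : ℝ) ≤ K := by exact_mod_cast hk.le
    have hev : ∀ i < 1, piExpr.eval (g.set ix i) = g.carr 6 0 + piTerm k := by
      intro i hi
      obtain rfl : i = 0 := by omega
      simp [piExpr, CE.eval, NE.eval, hgk, hg18, hg19, piTerm, NState.carr]
    have hcarr : ‖g.carr 6 0‖ ≤ 3 * 2 ^ K := by
      have h1 := norm_add_le (g.carr 6 0 - ∑ l ∈ range k, piTerm l) (∑ l ∈ range k, piTerm l)
      rw [sub_add_cancel] at h1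
      have h2 := hsum k
      have h3 : (k : ℝ) * (2 * (2 / D)) ≤ k * (2 * 1) := by gcongr
      linarith
    refine Runs.seq (Runs.cmap hF piExpr_fit hgb (by decide) g17 gD hD0 (fun i _ => ?_)
      (fun i hi => hbd _ ?_)) (fun g1 hgb1 ⟨hgf1, hgc1⟩ => Runs.seq (Runs.cmap hF (copyAt_fit 3 6 (by decide))
        hgb1 (by decide) (by rw [hgf1.reg 17 (by decide), g17]) (by rw [hgf1.reg rD (by decide), gD]) hD0
        (fun i _ => by simp [copyAt, CE.Ok, NE.Ok]) (fun i hi => hbd _ ?_)) (fun g2 hgb2 ⟨hgf2, hgc2⟩ =>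
        Runs.seq (Runs.assignNat hF hgb2 (by rfl) (by decide) (by simp [NE.Ok]) ?_) (fun g3 hgb3 hg3 =>
          (Runs.assignNat hF hgb3 (by rfl) (by decide) (by simp [NE.Ok]) ?_).mono le_rfl ?_)))
    · have e18 : (g.set ix i).reg 18 = 4 ^ k := by simp [hg18]
      have e19 : (g.set ix i).reg 19 = 9 ^ k := by simp [hg19]
      simp only [piExpr, CE.Ok, NE.Ok, NE.eval, e18, e19]
      simp
    · rw [hev i hi]
      have := norm_add_le (g.carr 6 0) (piTerm k)
      have := norm_piTerm_le k
      linarith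
    · have h1 := hgc1 i hi
      rw [hev i hi] at h1
      obtain rfl : i = 0 := by omega
      have h2 := norm_add_le (g1.carr 3 0 - (g.carr 6 0 + piTerm k)) (g.carr 6 0 + piTerm k)
      rw [sub_add_cancel] at h2
      have h3 := norm_add_le (g.carr 6 0) (piTerm k)
      have h4 := norm_piTerm_le k
      have : (copyAt 3).eval (g1.set ix 0) = g1.carr 3 0 := by
        simp [copyAt, CE.eval, NE.eval, NState.carr]
      rw [this]
      linarith
    · have e18 : g2.reg 18 = 4 ^ k := by rw [hgf2.reg 18 (by decide), hgf1.reg 18 (by decide), hg18]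
      simp only [NE.eval, e18]
      rw [← pow_succ']
      exact h4 _ hk
    · have e19 : g3.reg 19 = 9 ^ k := by
        rw [hg3, NState.set_reg_ne _ (by decide), hgf2.reg 19 (by decide), hgf1.reg 19 (by decide), hg19]
      simp only [NE.eval, e19]
      rw [← pow_succ']
      exact h9 _ hk
    · rintro g4 - rfl
      subst hg3
      have e18 : g2.reg 18 = 4 ^ k := by rw [hgf2.reg 18 (by decide), hgf1.reg 18 (by decide), hg18]
      have e19 : g2.reg 19 = 9 ^ k := by rw [hgf2.reg 19 (by decide), hgf1.reg 19 (by decide), hg19]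
      refine ⟨?_, ?_, ?_, ?_, ?_⟩
      · simp [hgf2.reg 20 (by decide), hgf1.reg 20 (by decide), hgk]
      · exact ((((hgf.trans' hgf1 (by decide) (by decide)).trans' hgf2 (by decide) (by decide)).set
          (by decide) _).set (by decide) _).set (by decide) _
      · have k1 := hgc1 0 one_pos
        have k2 := hgc2 0 one_pos
        rw [hev 0 one_pos] at k1
        have : (copyAt 3).eval (g1.set ix 0) = g1.carr 3 0 := by
          simp [copyAt, CE.eval, NE.eval, NState.carr]
        rw [this] at k2
        show ‖g2.carr 6 0 - _‖ ≤ _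
        rw [sum_range_succ, show g2.carr 6 0 - (∑ l ∈ range k, piTerm l + piTerm k) =
          (g2.carr 6 0 - g1.carr 3 0) + (g1.carr 3 0 - (g.carr 6 0 + piTerm k)) +
            (g.carr 6 0 - ∑ l ∈ range k, piTerm l) by ring]
        refine (norm_add_le _ _).trans ?_
        have := norm_add_le (g2.carr 6 0 - g1.carr 3 0) (g1.carr 3 0 - (g.carr 6 0 + piTerm k))
        push_cast
        linarith
      · simp [NE.eval, e18, pow_succ']
      · simp [NE.eval, e19, pow_succ']
  refine (Runs.seq (Runs.assignNat hF hb (by rfl) (by decide) (by simp [NE.Ok]) (by simp only [NE.eval]; omega))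
    (fun g1 hgb1 hg1 => Runs.seq (Runs.assignNat hF hgb1 (by rfl) (by decide) (by simp [NE.Ok])
      (by simp only [NE.eval]; omega)) (fun g2 hgb2 hg2 => Runs.forLt hF (x := 20) (N := .reg 3) K I
        (fun _ => (1 + 1) * (10 * costBound) + ((1 + 1) * (10 * costBound) + ((costBound + 1) + (costBound + 1))))
        (by rw [← h3]; exact hb.reg_le _) (by rfl) (by decide) (fun k _ g' _ hI' => ⟨trivial, ?_⟩) hstep hgb2
        ?_))).mono ?_ ?_
  · simp only [NE.eval]; rw [hI'.1.reg 3 (by decide), h3]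
  · subst hg1; subst hg2
    refine ⟨(((NState.Frame.refl _ _ h).set (by decide) _).set (by decide) _).set (by decide) _, ?_, ?_, ?_⟩
    · show ‖h.carr 6 0 - _‖ ≤ _
      simp [h0]
    · simp [NE.eval]
    · simp [NE.eval]
  · rw [sum_const, card_range, smul_eq_mul]
    nlinarith
  · rintro h' - ⟨-, hf, hcl, -, -⟩
    refine ⟨hf, ?_⟩
    have h1 := norm_piSum_sub_le K
    rw [show h'.carr 6 0 - Real.pi / 4 = (h'.carr 6 0 - ∑ l ∈ range K, piTerm l) +
      (∑ l ∈ range K, piTerm l - Real.pi / 4) by ring]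
    refine (norm_add_le _ _).trans ?_
    have h2 : (K : ℝ) * (2 * (2 / D)) ≤ 2 ^ K * (2 * (1 / 2 ^ K / 2 ^ K)) := by gcongr
    have h3 : (2 : ℝ) ^ K * (2 * (1 / 2 ^ K / 2 ^ K)) = 2 / 2 ^ K := by field_simp
    have h4 : (2 : ℝ) * (1 / 4) ^ K ≤ 2 * (1 / 2) ^ K := by gcongr <;> norm_num
    have h5 : (2 : ℝ) * (1 / 2) ^ K = 2 / 2 ^ K := by rw [div_pow, one_pow]; ring
    have h6 : (6 : ℝ) / 2 ^ K = 2 / 2 ^ K + 2 / 2 ^ K + 2 / 2 ^ K := by ring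
    have h7 : (0 : ℝ) ≤ 2 / 2 ^ K := by positivity
    linarith

end WordRAM

namespace WordRAM

open Finset

variable {W H : ℕ}

/-! ### The fast Fourier transform -/

/-- `a[ix] ← e` for `ix < reg 11`, by way of the array `3`. -/
def viaProg (a : ℕ) (e : CE) : Program := .seq (.cmap 3 11 e) (.cmap a 11 (copyAt 3))

/-- The new values of `a` depend on its old ones, hence the detour through the scratch array. Both
passes round, and each rounding doubles the bound. -/
theorem Runs.via (hF : Fits W H) {D : ℕ} {δ M : ℝ} (hP : Prec H D δ M) {a : ℕ} (ha : a ≠ 3) {e : CE}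
    {N : ℕ} {h : NState} (hfit : e.Fit 3) (hb : h.Bd H) (hN : h.reg 11 = N)
    (hD : h.reg rD = D) {B : ℝ} {z : ℕ → ℂ} (hB : 1 ≤ B) (hBM : 2 * B ≤ M)
    (hok : ∀ i < N, e.Ok (h.set ix i).reg) (hcl : ∀ i < N, Cl δ B (e.eval (h.set ix i)) (z i)) :
    Runs W H (viaProg a e) h ((N + 1) * (20 * costBound)) (fun h' => h.Frame [ix] [a, 3] h' ∧
      ∀ i < N, Cl δ (4 * B) (h'.carr a i) (z i)) := by
  refine (Runs.seq (Runs.cmapCl hF hP hfit hb (y := 11) (by decide) hN hD hB (by linarith) hok hcl)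
    (fun g hgb ⟨hgf, hgc⟩ => (Runs.cmapCl hF hP (copyAt_fit 3 a ha.symm) hgb (y := 11) (by decide)
      (by rw [hgf.reg 11 (by decide), hN]) (by rw [hgf.reg rD (by decide), hD]) (A := 2 * B) (z := z)
      (by linarith) hBM (fun i _ => by simp [copyAt, CE.Ok, NE.Ok]) (fun i hi => ?_)).mono le_rfl ?_)).mono
      (le_of_eq (by ring : (N + 1) * (10 * costBound) + (N + 1) * (10 * costBound) = _))
      (fun _ _ h => h)
  · have := hgc i hi
    simpa only [copyAt, CE.eval, NE.eval, NState.set_reg_self, NState.carr, NState.set_mem] using this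
  · rintro h' - ⟨hf, hc⟩
    exact ⟨(hgf.mono (R' := [ix]) (A' := [a, 3]) (by simp) (by simp)).trans' hf (by simp) (by simp),
      fun i hi => by
        have := hc i hi
        rwa [show 2 * (2 * B) = 4 * B by ring] at this⟩

/-- With the half length `m` in register 12, this is the position of the first element of the
butterfly that contains the index; `halfE` tells in which half the index lies. -/
def baseE : NE :=
  .add (.mul (.div (.reg ix) (.mul (.nat 2) (.reg 12))) (.mul (.nat 2) (.reg 12))) (.mod (.reg ix) (.reg 12))

def halfE : NE := .mod (.div (.reg ix) (.reg 12)) (.nat 2)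

def signE : CE := .sub (.nat (.nat 1)) (.mul (.nat (.nat 2)) (.nat halfE))

/-- The table in the array 4 has the order `L` of register 9. Reading it with stride `L / (2 m)`
yields the roots of order `2 m`, so one table serves all steps. -/
def stepE (a : ℕ) : CE :=
  .mul (.add (.get a baseE) (.mul signE (.get a (.add baseE (.reg 12)))))
    (.get 4 (.mul (.div (.reg 9) (.mul (.nat 2) (.reg 12))) (.mul halfE (.mod (.reg ix) (.reg 12)))))

def istepE (a : ℕ) : CE :=
  .add (.get a baseE) (.mul signE (.mul (.get a (.add baseE (.reg 12)))
    (.conj (.get 4 (.mul (.div (.reg 9) (.mul (.nat 2) (.reg 12))) (.mod (.reg ix) (.reg 12)))))))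

theorem base_lt {m N p : ℕ} (hm : 0 < m) (hN : 2 * m ∣ N) (hp : p < N) :
    p / (2 * m) * (2 * m) + p % m + m < N := by
  obtain ⟨c, rfl⟩ := hN
  have h1 : p / (2 * m) < c := Nat.div_lt_of_lt_mul hp
  have h2 : (p / (2 * m) + 1) * (2 * m) ≤ c * (2 * m) := Nat.mul_le_mul_right _ h1
  have h3 := Nat.mod_lt p hm
  nlinarith

theorem stepE_ok {h : NState} {m i a : ℕ} (hm : 0 < m) (h12 : h.reg 12 = m) :
    (stepE a).Ok (h.set ix i).reg ∧ (istepE a).Ok (h.set ix i).reg := by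
  have e : (h.set ix i).reg 12 = m := by simp [h12]
  simp only [stepE, istepE, signE, halfE, baseE, CE.Ok, NE.Ok, NE.eval, e]
  have : 2 * m ≠ 0 := by omega
  simp [this, hm.ne']

/-- The table of the roots of unity of order `2 ^ k` is stored in the complex array `4`. -/
def RootTable (δ : ℝ) (T M : ℕ) (h : NState) : Prop := ∀ i < M, Cl δ 1 (h.carr T i) (root M i)

/-- Adding two entries and multiplying by a root gives `3 * (2 A) = 6 A`; the inverse step gives `A
+ 3 A = 4 A`. The common bound 8 and the factor 4 of `Runs.via` make 32 per step. -/
theorem Cl.stepE {δ A : ℝ} (hδ : 0 ≤ δ) (hδ1 : δ ≤ 1) {h : NState} {a k l N : ℕ} {x : ℕ → ℂ} (hl : l < k)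
    (h9 : h.reg 9 = 2 ^ k) (h12 : h.reg 12 = 2 ^ l) (hN : 2 ^ k ∣ N) (hT : RootTable δ 4 (2 ^ k) h)
    (hx : ∀ p < N, Cl δ A (h.carr a p) (x p)) {p : ℕ} (hp : p < N) :
    Cl δ (8 * A) ((WordRAM.stepE a).eval (h.set ix p)) (fstep (2 ^ l) x p) ∧
      Cl δ (8 * A) ((WordRAM.istepE a).eval (h.set ix p)) (istep (2 ^ l) x p) := by
  set m := 2 ^ l with hm
  have hm0 : 0 < m := by positivity
  obtain ⟨c, hc⟩ : 2 * m ∣ 2 ^ k := by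
    rw [hm, ← pow_succ']
    exact pow_dvd_pow 2 hl
  have hc0 : c ≠ 0 := by
    rintro rfl
    have : 0 < 2 ^ k := by positivity
    omega
  have hmN : 2 * m ∣ N := (Dvd.intro c hc.symm).trans hN
  have hdiv : 2 ^ k / (2 * m) = c := by rw [hc, Nat.mul_div_cancel_left _ (by omega)]
  have hlt := base_lt hm0 hmN hp
  have ho := Nat.mod_lt p hm0
  have hh : p / m % 2 < 2 := Nat.mod_lt _ (by norm_num)
  have hA := (hx p hp).nonneg
  have ex : ∀ q, (h.set ix p).carr a q = h.carr a q := fun q => rfl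
  have ex4 : ∀ q, (h.set ix p).carr 4 q = h.carr 4 q := fun q => rfl
  have r12 : (h.set ix p).reg 12 = m := by simp [h12]
  have r9 : (h.set ix p).reg 9 = 2 ^ k := by simp [h9]
  have tw : ∀ o < m, Cl δ 1 (h.carr 4 (c * o)) (root (2 * m) o) := by
    intro o ho
    have := hT (c * o) (by
      rw [hc, mul_comm (2 * m)]
      exact Nat.mul_lt_mul_of_pos_left (by omega) (Nat.pos_of_ne_zero hc0))
    rwa [hc, mul_comm (2 * m), root_mul_mul hc0] at this
  have hho : p / m % 2 * (p % m) < m := by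
    have : p / m % 2 * (p % m) ≤ 1 * (p % m) := Nat.mul_le_mul_right _ (by omega)
    omega
  constructor
  · simp only [WordRAM.stepE, signE, halfE, baseE, CE.eval, NE.eval, r12, r9, NState.set_reg_self, hdiv, ex, ex4,
      Nat.cast_one, Nat.cast_ofNat]
    refine (Cl.mul hδ hδ1 ((hx _ (by omega)).add ((hx _ hlt).sign_mul hh)) (tw _ hho)).mono hδ (by linarith)
  · simp only [WordRAM.istepE, signE, halfE, baseE, CE.eval, NE.eval, r12, r9, NState.set_reg_self, hdiv, ex, ex4,
      Nat.cast_one, Nat.cast_ofNat]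
    refine ((hx _ (by omega)).add ((Cl.mul hδ hδ1 (hx _ hlt) (tw _ ho).conj).sign_mul hh)).mono hδ (by linarith)

theorem loop_time_le {c k N : ℕ} (hc : 100 ≤ c) :
    c + 1 + (k * (c + 1 + (N + 1) * (20 * c) + 3 * c) + 3 * c) ≤ (k + 1) * (N + 1) * (30 * c) := by
  have h1 : k * 1 ≤ k * c := Nat.mul_le_mul_left _ (by omega)
  have h2 := Nat.zero_le (k * c * N)
  have h3 := Nat.zero_le (c * N)
  nlinarith

/-- The half length is halved before each step, so that the first step works with `L / 2`; `bwdProg`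
starts with 1 and doubles it after each step. -/
def fwdProg (a : ℕ) : Program :=
  .seq (.nset 12 (.reg 9)) (.forLt 14 (.reg 10)
    (.seq (.nset 12 (.div (.reg 12) (.nat 2))) (viaProg a (stepE a))))

def bwdProg (a : ℕ) : Program :=
  .seq (.nset 12 (.nat 1)) (.forLt 14 (.reg 10)
    (.seq (viaProg a (istepE a)) (.nset 12 (.mul (.nat 2) (.reg 12)))))

/-- The registers of a transform of blocks of length `2 ^ k` in an array of length `N`. -/
structure Blocks (D k N : ℕ) (h : NState) : Prop where
  L_eq : h.reg 9 = 2 ^ k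
  k_eq : h.reg 10 = k
  N_eq : h.reg 11 = N
  D_eq : h.reg rD = D
  dvd : 2 ^ k ∣ N

theorem Blocks.frame {D k N : ℕ} {h h' : NState} (hB : Blocks D k N h) {R A : List ℕ}
    (hf : h.Frame R A h') (hR : 9 ∉ R ∧ 10 ∉ R ∧ 11 ∉ R ∧ 5 ∉ R) : Blocks D k N h' := by
  obtain ⟨h1, h2, h3, h4⟩ := hR
  exact ⟨by rw [hf.reg _ h1, hB.L_eq], by rw [hf.reg _ h2, hB.k_eq], by rw [hf.reg _ h3, hB.N_eq],
    by rw [hf.reg _ h4, hB.D_eq], hB.dvd⟩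

theorem RootTable.frame {δ : ℝ} {T M : ℕ} {h h' : NState} (hT : RootTable δ T M h) {R A : List ℕ}
    (hf : h.Frame R A h') (hA : T ∉ A) : RootTable δ T M h' := by
  intro i hi
  rw [hf.carr hA]
  exact hT i hi

theorem Runs.fwd (hF : Fits W H) {D : ℕ} {δ M : ℝ} (hP : Prec H D δ M) {a : ℕ} (ha : a ≠ 3) (ha4 : a ≠ 4)
    (hfit : (stepE a).Fit 3) {k N : ℕ} {h : NState} (hb : h.Bd H) (hB : Blocks D k N h)
    (hT : RootTable δ 4 (2 ^ k) h) {A : ℝ} (hA : 1 ≤ A) (hAM : A * 32 ^ k ≤ M) {x : ℕ → ℂ}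
    (hx : ∀ p < N, Cl δ A (h.carr a p) (x p)) :
    Runs W H (fwdProg a) h ((k + 1) * (N + 1) * (30 * costBound)) (fun h' =>
      h.Frame [12, 14, 15] [a, 3] h' ∧
        ∀ p < N, Cl δ (A * 32 ^ k) (h'.carr a p) (WordRAM.fwd k x k p)) := by
  have hcB : 100 ≤ costBound := by decide
  have hδ := hP.nonneg
  have ha4' : 4 ∉ [a, 3] := by simpa using ha4.symm
  refine (Runs.seq (Runs.assignNat hF hb (by rfl) (by decide) (by simp [NE.Ok])
      (by simpa only [NE.eval] using hb.reg_le 9))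
    (fun g hgb hg => Runs.forLt hF (x := 14) (N := .reg 10) k
      (fun l g => h.Frame [12, 14, 15] [a, 3] g ∧ g.reg 12 = 2 ^ (k - l) ∧
        ∀ p < N, Cl δ (A * 32 ^ l) (g.carr a p) (WordRAM.fwd k x l p))
      (fun _ => (costBound + 1) + (N + 1) * (20 * costBound)) (hB.k_eq ▸ hb.reg_le 10) rfl (by decide)
      (fun l _ g' _ hI => ⟨trivial, ?_⟩) (fun l hl g' hgb' hgl hI => ?_) hgb ?_)).mono ?_ ?_
  · simp only [NE.eval]; rw [hI.1.reg 10 (by decide), hB.k_eq]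
  · have h32 : A * 32 ^ (l + 1) ≤ M := by
      refine le_trans ?_ hAM
      gcongr
      · norm_num
      · omega
    have hA1 : 1 ≤ A * 32 ^ l := one_le_mul_of_one_le_of_one_le hA (one_le_pow₀ (by norm_num))
    have hpow : A * 32 ^ (l + 1) = 32 * (A * 32 ^ l) := by ring
    have hB' := hB.frame hI.1 (by decide)
    have hT' := hT.frame hI.1 ha4'
    have hhalf : 2 ^ (k - l) / 2 = 2 ^ (k - (l + 1)) := by
      rw [show k - l = k - (l + 1) + 1 by omega, pow_succ, Nat.mul_div_cancel _ (by norm_num)]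
    refine Runs.seq (Runs.assignNat hF hgb' (by rfl) (by decide) (by simp [NE.Ok, NE.eval]) ?_)
      (fun g1 hgb1 hg1 => (Runs.via hF hP ha hfit hgb1 (B := 8 * (A * 32 ^ l))
        (z := WordRAM.fwd k x (l + 1)) ?_ ?_ ?_ ?_ (fun i hi => ?_) (fun i hi => ?_)).mono le_rfl ?_)
    · simp only [NE.eval]
      exact (Nat.div_le_self _ _).trans (hgb'.reg_le _)
    · rw [hg1, NState.set_reg_ne _ (by decide), hB'.N_eq]
    · rw [hg1, NState.set_reg_ne _ (by decide), hB'.D_eq]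
    · linarith
    · linarith
    · refine (stepE_ok (m := 2 ^ (k - (l + 1))) (by positivity) ?_).1
      rw [hg1]; simp [NE.eval, hI.2.1, hhalf]
    · refine (Cl.stepE hδ hP.le_one (k := k) (l := k - (l + 1)) (N := N) (A := A * 32 ^ l) (by omega) ?_ ?_
        hB.dvd ?_ ?_ hi).1
      · rw [hg1, NState.set_reg_ne _ (by decide), hB'.L_eq]
      · rw [hg1]; simp [NE.eval, hI.2.1, hhalf]
      · subst hg1; exact hT'
      · subst hg1; exact hI.2.2
    · rintro g2 - ⟨hf2, hc2⟩
      have hf1 := (g'.frame_set 12 (NE.eval g'.reg (.div (.reg 12) (.nat 2))))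
      rw [← hg1] at hf1
      have hfr := (hI.1.trans' hf1 (by decide) (by simp)).trans' hf2 (by decide) (by simp)
      refine ⟨?_, hfr.set (by decide) _, ?_, ?_⟩
      · rw [hf2.reg 14 (by decide), hg1, NState.set_reg_ne _ (by decide), hgl]
      · rw [NState.set_reg_ne _ (by decide), hf2.reg 12 (by decide), hg1]
        simp [NE.eval, hI.2.1, hhalf]
      · intro p hp
        rw [hpow, show 32 * (A * 32 ^ l) = 4 * (8 * (A * 32 ^ l)) by ring]
        exact hc2 p hp
  · subst hg
    refine ⟨((NState.Frame.refl _ _ h).set (by decide) _).set (by decide) _, ?_, ?_⟩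
    · simp [NE.eval, hB.L_eq]
    · intro p hp
      rw [pow_zero, mul_one]
      exact hx p hp
  · rw [sum_const, card_range, smul_eq_mul]
    have := loop_time_le (k := k) (N := N) hcB
    omega
  · rintro h' - ⟨-, hf, -, hc⟩
    exact ⟨hf, hc⟩

theorem Runs.bwd (hF : Fits W H) {D : ℕ} {δ M : ℝ} (hP : Prec H D δ M) {a : ℕ} (ha : a ≠ 3) (ha4 : a ≠ 4)
    (hfit : (istepE a).Fit 3) {k N : ℕ} {h : NState} (hb : h.Bd H) (hB : Blocks D k N h)
    (hkH : 2 ^ k ≤ H)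
    (hT : RootTable δ 4 (2 ^ k) h) {A : ℝ} (hA : 1 ≤ A) (hAM : A * 32 ^ k ≤ M) {x : ℕ → ℂ}
    (hx : ∀ p < N, Cl δ A (h.carr a p) (x p)) :
    Runs W H (bwdProg a) h ((k + 1) * (N + 1) * (30 * costBound)) (fun h' =>
      h.Frame [12, 14, 15] [a, 3] h' ∧
        ∀ p < N, Cl δ (A * 32 ^ k) (h'.carr a p) (WordRAM.bwd x k p)) := by
  have hcB : 100 ≤ costBound := by decide
  have h64 := hF.two_le
  have hδ := hP.nonneg
  have ha4' : 4 ∉ [a, 3] := by simpa using ha4.symm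
  refine (Runs.seq (Runs.assignNat hF hb (by rfl) (by decide) (by simp [NE.Ok])
      (by simp only [NE.eval]; omega))
    (fun g hgb hg => Runs.forLt hF (x := 14) (N := .reg 10) k
      (fun l g => h.Frame [12, 14, 15] [a, 3] g ∧ g.reg 12 = 2 ^ l ∧
        ∀ p < N, Cl δ (A * 32 ^ l) (g.carr a p) (WordRAM.bwd x l p))
      (fun _ => costBound + 1 + (N + 1) * (20 * costBound)) (hB.k_eq ▸ hb.reg_le 10) rfl (by decide)
      (fun l _ g' _ hI => ⟨trivial, ?_⟩) (fun l hl g' hgb' hgl hI => ?_) hgb ?_)).mono ?_ ?_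
  · simp only [NE.eval]; rw [hI.1.reg 10 (by decide), hB.k_eq]
  · have h32 : A * 32 ^ (l + 1) ≤ M := by
      refine le_trans ?_ hAM
      gcongr
      · norm_num
      · omega
    have hA1 : 1 ≤ A * 32 ^ l := one_le_mul_of_one_le_of_one_le hA (one_le_pow₀ (by norm_num))
    have hpow : A * 32 ^ (l + 1) = 32 * (A * 32 ^ l) := by ring
    have hB' := hB.frame hI.1 (by decide)
    have hT' := hT.frame hI.1 ha4'
    refine (Runs.seq (Runs.via hF hP ha hfit hgb' (B := 8 * (A * 32 ^ l))
        (z := WordRAM.bwd x (l + 1)) hB'.N_eq hB'.D_eq (by linarith) (by linarith)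
        (fun i hi => (stepE_ok (m := 2 ^ l) (by positivity) hI.2.1).2) (fun i hi =>
          (Cl.stepE hδ hP.le_one hl hB'.L_eq hI.2.1 hB.dvd hT' hI.2.2 hi).2))
      (fun g1 hgb1 ⟨hf1, hc1⟩ => (Runs.assignNat hF hgb1 (by rfl) (by decide) (by simp [NE.Ok]) ?_).mono
        le_rfl ?_)).mono (by omega) (fun _ _ h => h)
    · simp only [NE.eval]
      rw [hf1.reg 12 (by decide), hI.2.1, ← pow_succ']
      exact (Nat.pow_le_pow_right (by norm_num) hl).trans hkH
    · rintro g2 - rfl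
      have hfr := hI.1.trans' hf1 (by decide) (by simp)
      refine ⟨?_, (hfr.set (by decide) _).set (by decide) _, ?_, ?_⟩
      · rw [NState.set_reg_ne _ (by decide), hf1.reg 14 (by decide), hgl]
      · rw [NState.set_reg_ne _ (by decide), NState.set_reg_self]
        simp only [NE.eval]
        rw [hf1.reg 12 (by decide), hI.2.1, pow_succ']
      · intro p hp
        rw [hpow, show 32 * (A * 32 ^ l) = 4 * (8 * (A * 32 ^ l)) by ring]
        exact hc1 p hp
  · subst hg
    refine ⟨((NState.Frame.refl _ _ h).set (by decide) _).set (by decide) _, ?_, ?_⟩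
    · simp [NE.eval]
    · intro p hp
      rw [pow_zero, mul_one]
      exact hx p hp
  · rw [sum_const, card_range, smul_eq_mul]
    have := loop_time_le (k := k) (N := N) hcB
    omega
  · rintro h' - ⟨-, hf, -, hc⟩
    exact ⟨hf, hc⟩

theorem stepE_fit1 : (stepE 1).Fit 3 := ⟨by decide, by decide, by decide, by decide, by decide, by decide⟩

theorem stepE_fit2 : (stepE 2).Fit 3 := ⟨by decide, by decide, by decide, by decide, by decide, by decide⟩

theorem istepE_fit1 : (istepE 1).Fit 3 := ⟨by decide, by decide, by decide, by decide, by decide, by decide⟩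

end WordRAM

namespace WordRAM

open Finset

variable {W H : ℕ}

/-! ### The Fourier transform along one digit -/

/-- Sets up the lengths and the tables of roots of unity for the transform along a digit. -/
def dimSetup : Program :=
  .seq (.assign 8 (.get 0 (.reg 6))) (.seq (logProg 9 10 (.mul (.nat 2) (.reg 8)))
    (.seq (.nset 11 (.mul (.div (.reg 1) (.reg 8)) (.reg 9))) (.seq (.nset 16 (.mul (.nat 2) (.reg 8)))
      (.seq (rootProg 4 9) (rootProg 5 16)))))

/-- The state after `dimSetup` for the digit with stride `S` and radix `r`. -/
structure Dim (n K S r c k : ℕ) (h : NState) : Prop where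
  consts : Consts n K h
  n_eq : n = S * r * c
  S_eq : h.reg 7 = S
  r_eq : h.reg 8 = r
  blocks : Blocks (2 ^ (4 * K)) k (S * c * 2 ^ k) h
  two_eq : h.reg 16 = 2 * r
  tab4 : RootTable (acc K) 4 (2 ^ k) h
  tab5 : RootTable (acc K) 5 (2 * r) h

theorem Dim.frame {n K S r c k : ℕ} {h h' : NState} (hd : Dim n K S r c k h) {R A : List ℕ}
    (hf : h.Frame R A h') (hR : 1 ∉ R ∧ 3 ∉ R ∧ 4 ∉ R ∧ 5 ∉ R ∧ 17 ∉ R) (hA : 6 ∉ A)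
    (hR' : 9 ∉ R ∧ 10 ∉ R ∧ 11 ∉ R ∧ 5 ∉ R) (hR'' : 7 ∉ R ∧ 8 ∉ R ∧ 16 ∉ R) (hA' : 4 ∉ A ∧ 5 ∉ A) :
    Dim n K S r c k h' :=
  ⟨hd.consts.frame hf hR hA, hd.n_eq, by rw [hf.reg _ hR''.1, hd.S_eq], by rw [hf.reg _ hR''.2.1, hd.r_eq],
    hd.blocks.frame hf hR', by rw [hf.reg _ hR''.2.2, hd.two_eq], hd.tab4.frame hf hA'.1,
    hd.tab5.frame hf hA'.2⟩

theorem rootInit_fit4 : (rootInit 9).Fit 4 := ⟨by decide, by decide, by decide, by decide, by decide, by decide⟩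

theorem rootInit_fit5 : (rootInit 16).Fit 5 := ⟨by decide, by decide, by decide, by decide, by decide, by decide⟩

theorem sqAt_fit4 : (sqAt 4).Fit 3 := ⟨by decide, by decide, by decide, by decide, by decide, by decide⟩

theorem sqAt_fit5 : (sqAt 5).Fit 3 := ⟨by decide, by decide, by decide, by decide, by decide, by decide⟩

/-- This keeps the padded array, of length `n / r * 2 ^ k`, within `4 n` cells. -/
theorem two_pow_clog_le {r : ℕ} (hr : 1 ≤ r) : 2 ^ Nat.clog 2 (2 * r) ≤ 4 * r := by
  have h := Nat.pow_pred_clog_lt_self (b := 2) (by norm_num) (show 1 < 2 * r by omega)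
  have h2 : 0 < Nat.clog 2 (2 * r) := Nat.clog_pos (by norm_num) (by omega)
  rw [← Nat.succ_pred_eq_of_pos h2, pow_succ]
  omega

/-- The cost is dominated by the two tables, of lengths at most `4 r` and `2 r`, each of which needs
`K` squarings per entry. It does not contain `n` as a factor. -/
theorem Runs.dimSetup (hF : Fits W H) {n K : ℕ} (hK : 600 ≤ K)
    (hP : Prec H (2 ^ (4 * K)) (acc K) (2 ^ (3 * K))) {h : NState} (hb : h.Bd H) (hc : Consts n K h)
    {t S r c : ℕ} (ht : h.reg 6 = t) (hS : h.reg 7 = S) (hr : h.mem 0 t = r) (hr1 : 1 ≤ r) (hc1 : 1 ≤ S * c)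
    (hn : n = S * r * c) (hnH : 4 * n ≤ H) :
    Runs W H WordRAM.dimSetup h ((Nat.clog 2 (2 * r) + 1) * (5 * costBound) + 8 * r * (K + 1) * (23 * costBound)
      + 4 * costBound) (fun h' => h.Frame [8, 9, 10, 11, 15, 16, 20] [3, 4, 5] h' ∧
        Dim n K S r c (Nat.clog 2 (2 * r)) h') := by
  have hcB : 100 ≤ costBound := by decide
  have h64 := hF.two_le
  set k := Nat.clog 2 (2 * r) with hk
  have hL := two_pow_clog_le hr1
  rw [← hk] at hL
  have hrn : r ≤ n := by rw [hn]; nlinarith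
  have hN : S * c * 2 ^ k ≤ 4 * n := by
    calc S * c * 2 ^ k ≤ S * c * (4 * r) := Nat.mul_le_mul_left _ hL
      _ = 4 * n := by rw [hn]; ring
  have hdiv : n / r = S * c := by
    rw [hn, show S * r * c = S * c * r by ring, Nat.mul_div_cancel _ (by omega)]
  refine (Runs.seq (Runs.readOrder hF hb ht hr) (fun g1 hgb1 hg1 => Runs.seq
    (Runs.log hF hgb1 (q := 9) (k := 10) (e := .mul (.nat 2) (.reg 8)) (v := 2 * r) (by decide) rfl (by decide)
      (fun g hg => ⟨⟨trivial, trivial⟩, ?_⟩) (hL.trans (by omega))) (fun g2 hgb2 ⟨hf2, hg29, hg210⟩ => Runs.seq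
    (Runs.assignNat hF hgb2 (by rfl) (by decide) ?_ ?_) (fun g3 hgb3 hg3 => Runs.seq
    (Runs.assignNat hF hgb3 (by rfl) (by decide) (by simp [NE.Ok]) ?_) (fun g4 hgb4 hg4 => Runs.seq
    (Runs.rootProg hF (n := n) (M := 2 ^ k) hK hP hgb4 ?_ (by decide) ?_ rootInit_fit4 sqAt_fit4 (copyAt_fit 3 4 (by decide)))
    (fun g5 hgb5 ⟨hf5, hg5⟩ => (Runs.rootProg hF (n := n) (M := 2 * r) hK hP hgb5 ?_ (by decide) ?_ rootInit_fit5
      sqAt_fit5 (copyAt_fit 3 5 (by decide))).mono le_rfl ?_)))))).mono ?_ (fun _ _ h => h)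
  -- Time bound: the table lengths give `(4 r + 1) + (2 r + 1) ≤ 8 r`.
  pick_goal -1
  · have h1 : (2 ^ k + 1) * (K + 1) * (23 * costBound) + (2 * r + 1) * (K + 1) * (23 * costBound) ≤
        8 * r * (K + 1) * (23 * costBound) := by
      rw [← add_mul, ← add_mul]
      gcongr
      omega
    simp only [← hk]
    omega
  · simp only [NE.eval]
    rw [hg.reg 8 (by decide), hg1, NState.set_reg_self]
  all_goals
    have f1 := h.frame_set 8 r
    rw [← hg1] at f1
    have f2 := f1.trans hf2
    have g28 : g2.reg 8 = r := by rw [hf2.reg 8 (by decide), hg1, NState.set_reg_self]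
    have g21 : g2.reg 1 = n := by rw [f2.reg 1 (by decide), hc.n_eq]
  · simp only [NE.Ok, NE.eval, true_and, and_true, g28]; omega
  · simp only [NE.eval, g21, g28, hg29, hdiv, ← hk]; omega
  all_goals
    have f3 := g2.frame_set 11 (S * c * 2 ^ k)
    have hg3' : g3 = g2.set 11 (S * c * 2 ^ k) := by rw [hg3]; simp only [NE.eval, g21, g28, hg29, hdiv]; rfl
    rw [← hg3'] at f3
    have g38 : g3.reg 8 = r := by rw [f3.reg 8 (by decide), g28]
  · simp only [NE.eval, g38]; omega
  all_goals
    have f4 := g3.frame_set 16 (2 * r)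
    have hg4' : g4 = g3.set 16 (2 * r) := by rw [hg4]; simp only [NE.eval, g38]
    rw [← hg4'] at f4
    have ff4 := (f2.trans f3).trans f4
    have g49 : g4.reg 9 = 2 ^ k := by rw [f4.reg 9 (by decide), f3.reg 9 (by decide), hg29]
    have hc4 : Consts n K g4 := hc.frame ff4 (by decide) (by decide)
  · exact hc4
  · exact g49
  · exact hc4.frame hf5 (by decide) (by decide)
  · rw [hf5.reg 16 (by decide), hg4', NState.set_reg_self]
  · rintro g6 - ⟨hf6, hg6⟩
    have ff6 := (ff4.trans hf5).trans hf6
    have f56 := hf5.trans hf6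
    refine ⟨ff6.mono (by decide) (by decide), hc.frame ff6 (by decide) (by decide), hn, ?_, ?_, ?_, ?_, ?_, hg6⟩
    · rw [ff6.reg 7 (by decide), hS]
    · rw [f56.reg 8 (by decide), f4.reg 8 (by decide), g38]
    · refine ⟨?_, ?_, ?_, ?_, Dvd.intro_left _ rfl⟩
      · rw [f56.reg 9 (by decide), g49]
      · rw [f56.reg 10 (by decide), f4.reg 10 (by decide), f3.reg 10 (by decide), hg210]
      · rw [f56.reg 11 (by decide), f4.reg 11 (by decide), hg3', NState.set_reg_self]
      · rw [ff6.reg 5 (by decide), hc.D_eq]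
    · rw [f56.reg 16 (by decide), hg4', NState.set_reg_self]
    · exact RootTable.frame hg5 hf6 (by decide)

/-! ### Bluestein's convolution in array expressions -/

def idxI : NE := .mod (.reg ix) (.reg 9)

/-- Block `f = ix / L` of the padded array belongs to a fixed choice of all digits but the current
one: the lower ones are `f % S`, the higher ones `f / S`. The current digit is the offset `idxI` in
the block. -/
def srcE : NE :=
  .add (.mod (.div (.reg ix) (.reg 9)) (.reg 7))
    (.mul (.reg 7) (.add idxI (.mul (.reg 8) (.div (.div (.reg ix) (.reg 9)) (.reg 7)))))

/-- The last factor is the integer quotient `1 / (1 + i / r)`, which is 1 for `i < r` and 0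
otherwise; it pads with zeros without a case distinction. -/
def fillX : CE :=
  .mul (.mul (.get 0 srcE) (.get 5 (.mod (.mul idxI idxI) (.reg 16))))
    (.nat (.div (.nat 1) (.add (.nat 1) (.div idxI (.reg 8)))))

def fillY : CE := .conj (.get 5 (.mod (.add (.mul idxI idxI) (.mul (.reg 8) (.reg 8))) (.reg 16)))

def digE : NE := .mod (.div (.reg ix) (.reg 7)) (.reg 8)

/-- The transform is found at the offset `digE + r` of its block, because Bluestein's kernel is
shifted by `r`. The division by `L` removes the powers of 2 left by the inverse steps. -/
def outE : CE :=
  .divN (.mul (.get 5 (.mod (.mul digE digE) (.reg 16)))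
    (.get 1 (.add (.mul (.add (.mod (.reg ix) (.reg 7)) (.mul (.reg 7) (.div (.reg ix) (.mul (.reg 7) (.reg 8)))))
      (.reg 9)) (.add digE (.reg 8))))) (.reg 9)

def mulE : CE := .mul (.get 1 (.reg ix)) (.get 2 (.reg ix))

/-- Transforms the array `0` along the digit that `dimSetup` has prepared. -/
def dimConv : Program :=
  .seq (.cmap 1 11 fillX) (.seq (.cmap 2 11 fillY) (.seq (fwdProg 1) (.seq (fwdProg 2)
    (.seq (viaProg 1 mulE) (.seq (bwdProg 1) (.seq (.cmap 0 1 outE) (.nset 7 (.mul (.reg 7) (.reg 8)))))))))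

theorem fillX_fit : fillX.Fit 1 := ⟨by decide, by decide, by decide, by decide, by decide, by decide⟩

theorem fillY_fit : fillY.Fit 2 := ⟨by decide, by decide, by decide, by decide, by decide, by decide⟩

theorem outE_fit : outE.Fit 0 := ⟨by decide, by decide, by decide, by decide, by decide, by decide⟩

theorem mulE_fit : mulE.Fit 3 := ⟨by decide, by decide, by decide, by decide, by decide, by decide⟩

/-- The signal of Bluestein's convolution. -/
noncomputable def sigX (S r L : ℕ) (x : ℕ → ℂ) (p : ℕ) : ℂ :=
  if p % L < r then x (p / L % S + S * (p % L + r * (p / L / S))) * root (2 * r) (p % L * (p % L)) else 0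

/-- The kernel of Bluestein's convolution. -/
noncomputable def sigY (r L : ℕ) (p : ℕ) : ℂ := (starRingEnd ℂ) (root (2 * r) (p % L * (p % L) + r * r))

theorem Cl.fillX {n K S r c k : ℕ} (hK : 600 ≤ K) {h : NState} (hd : Dim n K S r c k h) (hS : 0 < S)
    (hr : 0 < r) {A : ℝ} {x : ℕ → ℂ} (hA : 0 ≤ A) (hx : ∀ p < n, Cl (acc K) A (h.carr 0 p) (x p))
    {p : ℕ} (hp : p < S * c * 2 ^ k) :
    Cl (acc K) (3 * A) (WordRAM.fillX.eval (h.set ix p)) (sigX S r (2 ^ k) x p) := by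
  have hδ := (acc_pos K).le
  have hδ1 : acc K ≤ 1 := (acc_le hK).trans (by norm_num)
  have r7 : (h.set ix p).reg 7 = S := by simp [hd.S_eq]
  have r8 : (h.set ix p).reg 8 = r := by simp [hd.r_eq]
  have r9 : (h.set ix p).reg 9 = 2 ^ k := by simp [hd.blocks.L_eq]
  have r16 : (h.set ix p).reg 16 = 2 * r := by simp [hd.two_eq]
  have ex : ∀ a q, (h.set ix p).carr a q = h.carr a q := fun a q => rfl
  simp only [WordRAM.fillX, srcE, idxI, CE.eval, NE.eval, r7, r8, r9, r16, NState.set_reg_self, ex, sigX]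
  split_ifs with hi
  · rw [Nat.div_eq_of_lt hi, add_zero, Nat.div_one, Nat.cast_one, mul_one]
    have h1 : p / 2 ^ k < S * c := Nat.div_lt_of_lt_mul (by rwa [mul_comm])
    have h2 : p / 2 ^ k / S < c := Nat.div_lt_of_lt_mul h1
    have h3 := Nat.mod_lt (p / 2 ^ k) hS
    have hlt : p / 2 ^ k % S + S * (p % 2 ^ k + r * (p / 2 ^ k / S)) < n := by
      rw [hd.n_eq]
      have h4 : p % 2 ^ k + r * (p / 2 ^ k / S) + 1 ≤ r * c := by
        calc _ ≤ r * (p / 2 ^ k / S) + r := by omega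
          _ = r * (p / 2 ^ k / S + 1) := by ring
          _ ≤ r * c := Nat.mul_le_mul_left _ h2
      calc _ < S + S * (p % 2 ^ k + r * (p / 2 ^ k / S)) := by omega
        _ = S * (p % 2 ^ k + r * (p / 2 ^ k / S) + 1) := by ring
        _ ≤ S * (r * c) := Nat.mul_le_mul_left _ h4
        _ = S * r * c := by ring
    have := hd.tab5 (p % 2 ^ k * (p % 2 ^ k) % (2 * r)) (Nat.mod_lt _ (by omega))
    rw [root_mod] at this
    exact (Cl.mul hδ hδ1 (hx _ hlt) this).mono hδ (by linarith)
  · have h1 : 1 ≤ p % 2 ^ k / r := (Nat.one_le_div_iff hr).2 (by omega)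
    rw [Nat.div_eq_of_lt (by omega : 1 < 1 + p % 2 ^ k / r), Nat.cast_zero, mul_zero]
    exact Cl.zero.mono hδ (by linarith)

theorem Cl.fillY {n K S r c k : ℕ} {h : NState} (hd : Dim n K S r c k h) (hr : 0 < r) (p : ℕ) :
    Cl (acc K) 1 (WordRAM.fillY.eval (h.set ix p)) (sigY r (2 ^ k) p) := by
  have r8 : (h.set ix p).reg 8 = r := by simp [hd.r_eq]
  have r9 : (h.set ix p).reg 9 = 2 ^ k := by simp [hd.blocks.L_eq]
  have r16 : (h.set ix p).reg 16 = 2 * r := by simp [hd.two_eq]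
  have ex : ∀ a q, (h.set ix p).carr a q = h.carr a q := fun a q => rfl
  simp only [WordRAM.fillY, idxI, CE.eval, NE.eval, r8, r9, r16, NState.set_reg_self, ex, sigY]
  have := hd.tab5 ((p % 2 ^ k * (p % 2 ^ k) + r * r) % (2 * r)) (Nat.mod_lt _ (by omega))
  rw [root_mod] at this
  exact this.conj

theorem out_index_lt {S r c L g : ℕ} (hS : 0 < S) (hr : 0 < r) (hL : 2 * r ≤ L) (hg : g < S * r * c) :
    (g % S + S * (g / (S * r))) * L + (g / S % r + r) < S * c * L := by
  have h1 : g / (S * r) < c := Nat.div_lt_of_lt_mul hg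
  have h2 := Nat.mod_lt g hS
  have h3 := Nat.mod_lt (g / S) hr
  have h4 : g % S + S * (g / (S * r)) + 1 ≤ S * c := by
    calc _ ≤ S * (g / (S * r) + 1) := by rw [mul_add]; omega
      _ ≤ S * c := Nat.mul_le_mul_left _ h1
  calc _ < (g % S + S * (g / (S * r)) + 1) * L := by rw [add_mul _ 1]; omega
    _ ≤ S * c * L := Nat.mul_le_mul_right _ h4

/-- The block `f` collects the entries that share with `g` all digits except the current one, and
`bluestein` applies to this block. -/
theorem dstep_eq {S r L : ℕ} (hS : 0 < S) (hr : 0 < r) (hL : 2 * r ≤ L) (x : ℕ → ℂ) (g : ℕ) :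
    root (2 * r) (g / S % r * (g / S % r)) * bconv L (sigX S r L x) (sigY r L)
      ((g % S + S * (g / (S * r))) * L + (g / S % r + r)) = dstep S r x g := by
  have h2 := Nat.mod_lt g hS
  set f := g % S + S * (g / (S * r)) with hf
  have f1 : f % S = g % S := by rw [hf, Nat.add_mul_mod_self_left, Nat.mod_mod]
  have f2 : f / S = g / (S * r) := by rw [hf, Nat.add_mul_div_left _ _ hS, Nat.div_eq_of_lt h2, zero_add]
  rw [bluestein hL f (fun j => x (g % S + S * (j + r * (g / (S * r))))) _ _ ?_ ?_ ?_ (Nat.mod_lt _ hr)]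
  · rfl
  · intro j hj
    have hjL : j < L := by omega
    rw [sigX, block_div f hjL, block_mod f hjL, if_pos hj, f1, f2]
  · intro j hjL hj
    rw [sigX, block_mod f hjL, if_neg (by omega)]
  · intro i hi
    rw [sigY, block_mod f hi]

end WordRAM

namespace WordRAM

open Finset

variable {W H : ℕ}

/-! ### Error and cost of the transform along one digit -/

/-- A pure power of `r` is wanted because such bounds multiply over the digits to a power of `n`,
whatever their number. Since `r ≥ 2`, constants can be absorbed: `4 r ≤ r ^ 3` gives `E ≤ r ^ 15`,
and `864 ≤ 2 ^ 10 ≤ r ^ 10`. -/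
theorem amplification_le {r : ℕ} (hr : 2 ≤ r) {E : ℝ} (hE : E = 32 ^ Nat.clog 2 (2 * r)) :
    864 * E ^ 3 ≤ (r : ℝ) ^ 55 := by
  have h2 : (2 : ℝ) ≤ r := by exact_mod_cast hr
  have h1 : (2 : ℝ) ^ Nat.clog 2 (2 * r) ≤ (r : ℝ) ^ 3 := by
    have : (2 : ℝ) ^ Nat.clog 2 (2 * r) ≤ 4 * r := by exact_mod_cast two_pow_clog_le (r := r) (by omega)
    nlinarith [mul_nonneg (mul_nonneg (show (0 : ℝ) ≤ r by linarith) (sub_nonneg.2 h2)) (show (0 : ℝ) ≤ r + 2 by linarith)]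
  have h3 : E ≤ (r : ℝ) ^ 15 := by
    calc E = (2 ^ Nat.clog 2 (2 * r)) ^ 5 := by
          rw [hE, ← pow_mul, mul_comm _ 5, pow_mul]; norm_num
      _ ≤ ((r : ℝ) ^ 3) ^ 5 := by gcongr
      _ = (r : ℝ) ^ 15 := by ring
  calc 864 * E ^ 3 ≤ 2 ^ 10 * E ^ 3 := by
        have : (0 : ℝ) ≤ E := by rw [hE]; positivity
        gcongr; norm_num
    _ ≤ (r : ℝ) ^ 10 * ((r : ℝ) ^ 15) ^ 3 := by
        have : (0 : ℝ) ≤ E := by rw [hE]; positivity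
        gcongr
    _ = (r : ℝ) ^ 55 := by ring

theorem dimConv_time_le {k N n c : ℕ} (hn : n ≤ N) :
    (N + 1) * (10 * c) + ((N + 1) * (10 * c) + ((k + 1) * (N + 1) * (30 * c) + ((k + 1) * (N + 1) * (30 * c) +
      ((N + 1) * (20 * c) + ((k + 1) * (N + 1) * (30 * c) + ((n + 1) * (10 * c) + 2 * c)))))) ≤
      (k + 1) * (N + 1) * (150 * c) := by
  have h1 : (n + 1) * (10 * c) ≤ (N + 1) * (10 * c) := by gcongr
  have h2 : (N + 1) * (60 * c) ≤ (k + 1) * (N + 1) * (60 * c) := by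
    rw [mul_assoc (k + 1)]
    exact Nat.le_mul_of_pos_left _ (by omega)
  have h3 : 2 * c ≤ (N + 1) * (10 * c) := by
    calc 2 * c ≤ 1 * (10 * c) := by omega
      _ ≤ _ := by gcongr; omega
  calc _ ≤ (k + 1) * (N + 1) * (90 * c) + (N + 1) * (60 * c) := by linarith
    _ ≤ (k + 1) * (N + 1) * (90 * c) + (k + 1) * (N + 1) * (60 * c) := by omega
    _ = _ := by ring

/-- With `E = 32 ^ k`, filling leaves the bounds `6 A` and 2, the forward transforms multiply both
by `E`, their product has `3 * 6 * 2 * A E² = 36 A E²`, and storing it multiplies by 4. The inverse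
transform gives `144 A E³`, the final multiplication by a root 432 and the last rounding 864, which
is the constant of `amplification_le`. -/
theorem Runs.dimConv (hF : Fits W H) {n K : ℕ} (hK : 600 ≤ K)
    (hP : Prec H (2 ^ (4 * K)) (acc K) (2 ^ (3 * K))) {h : NState} (hb : h.Bd H) {S r c k : ℕ}
    (hd : Dim n K S r c k h) (hk : k = Nat.clog 2 (2 * r)) (hS : 0 < S) (hr : 2 ≤ r)
    (hSr : S * r ≤ H) (hkH : 2 ^ k ≤ H) {A : ℝ} (hA : 1 ≤ A) (hAM : A * r ^ 55 ≤ 2 ^ (3 * K)) {x : ℕ → ℂ}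
    (hx : ∀ p < n, Cl (acc K) A (h.carr 0 p) (x p)) :
    Runs W H WordRAM.dimConv h ((k + 1) * (S * c * 2 ^ k + 1) * (150 * costBound)) (fun h' =>
      h.Frame [7, 12, 14, 15] [0, 1, 2, 3] h' ∧ h'.reg 7 = S * r ∧
        ∀ g < n, Cl (acc K) (A * r ^ 55) (h'.carr 0 g) (dstep S r x g)) := by
  have hδ := hP.nonneg
  have hδ1 := hP.le_one
  have hcB : 100 ≤ costBound := by decide
  set N := S * c * 2 ^ k with hN
  have hL : 2 * r ≤ 2 ^ k := by rw [hk]; exact Nat.le_pow_clog (by norm_num) _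
  have hnN : n ≤ N := by
    rw [hd.n_eq, hN]
    calc S * r * c = S * c * r := by ring
      _ ≤ S * c * 2 ^ k := Nat.mul_le_mul_left _ (by omega)
  set E : ℝ := 32 ^ k with hE
  have hE1 : 1 ≤ E := one_le_pow₀ (by norm_num)
  have hamp := amplification_le hr (E := E) (by rw [hE, hk])
  have hE2 : E ≤ E ^ 3 := le_self_pow₀ hE1 (by norm_num)
  have hE3 : E ^ 2 ≤ E ^ 3 := pow_le_pow_right₀ hE1 (by norm_num)
  have hE4 : 1 ≤ E ^ 3 := one_le_pow₀ hE1
  have hAE : 864 * (A * E ^ 3) ≤ A * r ^ 55 := by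
    calc 864 * (A * E ^ 3) = A * (864 * E ^ 3) := by ring
      _ ≤ A * r ^ 55 := by gcongr
  have hAE3 : 1 ≤ A * E ^ 3 := by nlinarith
  have hA3 : A ≤ A * E ^ 3 := by nlinarith
  have hAE1 : A * E ≤ A * E ^ 3 := by gcongr
  have hAE2 : A * E ^ 2 ≤ A * E ^ 3 := by gcongr
  have hEA : E ≤ A * E ^ 3 := by nlinarith
  have hE1A : 1 ≤ A * E ^ 2 := by nlinarith [one_le_pow₀ hE1 (n := 2)]
  have hdf : ∀ {g : NState} {R B : List ℕ}, h.Frame R B g → R ⊆ [12, 14, 15] → B ⊆ [0, 1, 2, 3] →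
      Dim n K S r c k g := fun hf hR hB =>
    hd.frame (hf.mono hR hB) (by decide) (by decide) (by decide) (by decide) (by decide)
  refine (Runs.seq (u := (N + 1) * (10 * costBound) +
      ((k + 1) * (N + 1) * (30 * costBound) + ((k + 1) * (N + 1) * (30 * costBound) +
      ((N + 1) * (20 * costBound) + ((k + 1) * (N + 1) * (30 * costBound) +
      ((n + 1) * (10 * costBound) + 2 * costBound))))))
      (Runs.cmapCl hF hP (a := 1) (y := 11) (e := fillX) fillX_fit hb (by decide)
      hd.blocks.N_eq hd.blocks.D_eq (A := 3 * A) (z := sigX S r (2 ^ k) x) (by linarith) (by linarith)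
      (fun i _ => ?_) (fun i hi => Cl.fillX hK hd hS (by omega) (by linarith) hx hi))
    (fun g1 hgb1 ⟨hf1, hc1⟩ => ?_)).mono (dimConv_time_le hnN) (fun _ _ h => h)
  · have r7 : (h.set ix i).reg 7 = S := by simp [hd.S_eq]
    have r8 : (h.set ix i).reg 8 = r := by simp [hd.r_eq]
    have r9 : (h.set ix i).reg 9 = 2 ^ k := by simp [hd.blocks.L_eq]
    have r16 : (h.set ix i).reg 16 = 2 * r := by simp [hd.two_eq]
    simp only [fillX, srcE, idxI, CE.Ok, NE.Ok, NE.eval, r7, r8, r9, r16]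
    simp [hS.ne', show r ≠ 0 by omega]
  have hd1 := hdf hf1 (by decide) (by decide)
  refine Runs.seq (Runs.cmapCl hF hP (a := 2) (y := 11) (e := fillY) fillY_fit hgb1 (by decide)
      hd1.blocks.N_eq hd1.blocks.D_eq (A := 1) (z := sigY r (2 ^ k)) le_rfl (by linarith)
      (fun i _ => ?_) (fun i hi => Cl.fillY hd1 (by omega) i)) (fun g2 hgb2 ⟨hf2, hc2⟩ => ?_)
  · have r9 : (g1.set ix i).reg 9 = 2 ^ k := by simp [hd1.blocks.L_eq]
    have r16 : (g1.set ix i).reg 16 = 2 * r := by simp [hd1.two_eq]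
    simp only [fillY, idxI, CE.Ok, NE.Ok, NE.eval, r9, r16]
    simp [show r ≠ 0 by omega]
  have ff2 := hf1.trans hf2
  have hd2 := hdf ff2 (by decide) (by decide)
  refine Runs.seq (Runs.fwd hF hP (a := 1) (by decide) (by decide) stepE_fit1 hgb2 hd2.blocks hd2.tab4
    (A := 6 * A) (x := sigX S r (2 ^ k) x) (by linarith) (by linarith) (fun p hp => ?_))
    (fun g3 hgb3 ⟨hf3, hc3⟩ => ?_)
  · rw [hf2.carr (by decide)]
    exact (hc1 p hp).mono hδ (by linarith)
  have ff3 := ff2.trans hf3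
  have hd3 := hdf ff3 (by decide) (by decide)
  refine Runs.seq (Runs.fwd hF hP (a := 2) (by decide) (by decide) stepE_fit2 hgb3 hd3.blocks hd3.tab4
    (A := 2) (x := sigY r (2 ^ k)) (by norm_num) (by linarith) (fun p hp => ?_))
    (fun g4 hgb4 ⟨hf4, hc4⟩ => ?_)
  · rw [hf3.carr (by decide)]
    exact (hc2 p hp).mono hδ (by norm_num)
  have ff4 := ff3.trans hf4
  have hd4 := hdf ff4 (by decide) (by decide)
  refine Runs.seq (Runs.via hF hP (a := 1) (by decide) mulE_fit hgb4 hd4.blocks.N_eq hd4.blocks.D_eq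
    (B := 36 * (A * E ^ 2)) (z := fun p => WordRAM.fwd k (sigX S r (2 ^ k) x) k p * WordRAM.fwd k (sigY r (2 ^ k)) k p)
    (by linarith) (by linarith) (fun i _ => ⟨trivial, trivial⟩) (fun i hi => ?_)) (fun g5 hgb5 ⟨hf5, hc5⟩ => ?_)
  · have h1 := hc3 i hi
    rw [← hf4.carr (a := 1) (by decide)] at h1
    refine (Cl.mul hδ hδ1 h1 (hc4 i hi)).mono hδ (le_of_eq ?_)
    ring
  have ff5 := ff4.trans hf5
  have hd5 := hdf ff5 (by decide) (by decide)
  refine Runs.seq (Runs.bwd hF hP (a := 1) (by decide) (by decide) istepE_fit1 hgb5 hd5.blocks hkH hd5.tab4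
    (A := 4 * (36 * (A * E ^ 2))) (by linarith) ?_ hc5) (fun g6 hgb6 ⟨hf6, hc6⟩ => ?_)
  · calc 4 * (36 * (A * E ^ 2)) * 32 ^ k = 144 * (A * E ^ 3) := by rw [← hE]; ring
      _ ≤ _ := by linarith
  have ff6 := ff5.trans hf6
  have hd6 := hdf ff6 (by decide) (by decide)
  have r7 : ∀ i, (g6.set ix i).reg 7 = S := fun i => by simp [hd6.S_eq]
  have r8 : ∀ i, (g6.set ix i).reg 8 = r := fun i => by simp [hd6.r_eq]
  have r9 : ∀ i, (g6.set ix i).reg 9 = 2 ^ k := fun i => by simp [hd6.blocks.L_eq]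
  have r16 : ∀ i, (g6.set ix i).reg 16 = 2 * r := fun i => by simp [hd6.two_eq]
  have hk0 : 2 ^ k ≠ 0 := by positivity
  refine (Runs.seq (Runs.cmapCl hF hP (a := 0) (y := 1) (e := outE) outE_fit hgb6 (by decide)
      hd6.consts.n_eq hd6.blocks.D_eq (A := 432 * (A * E ^ 3)) (z := dstep S r x) (by linarith) (by linarith)
      (fun i _ => ?_) (fun i hi => ?_)) (fun g7 hgb7 ⟨hf7, hc7⟩ => (Runs.assignNat hF hgb7 (by rfl) (by decide)
        (by simp [NE.Ok]) ?_).mono (by omega : costBound + 1 ≤ 2 * costBound) ?_))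
  · simp only [outE, digE, CE.Ok, NE.Ok, NE.eval, r7, r8, r9, r16]
    simp [hS.ne', show r ≠ 0 by omega]
  · have ex : ∀ a q, (g6.set ix i).carr a q = g6.carr a q := fun a q => rfl
    simp only [outE, digE, CE.eval, NE.eval, r7, r8, r9, r16, NState.set_reg_self, ex]
    rw [← dstep_eq hS (by omega : 0 < r) hL x i]
    have h1 := hc6 _ (out_index_lt hS (by omega : 0 < r) hL (by rw [← hd.n_eq]; exact hi))
    rw [bwd_mul_fwd] at h1
    have h2 := hd6.tab5 (i / S % r * (i / S % r) % (2 * r)) (Nat.mod_lt _ (by omega))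
    rw [root_mod] at h2
    have h3 := ((Cl.mul hδ hδ1 h2 h1).divN (k := 2 ^ k) Nat.one_le_two_pow).mono hδ
      (B := 432 * (A * E ^ 3)) (le_of_eq (by rw [← hE]; ring))
    convert h3 using 1
    push_cast
    field_simp
  · simp only [NE.eval]
    rw [hf7.reg 7 (by decide), hf7.reg 8 (by decide), hd6.S_eq, hd6.r_eq]
    exact hSr
  · rintro g8 - rfl
    have ff7 := ff6.trans hf7
    refine ⟨(ff7.trans (g7.frame_set 7 _)).mono (by decide) (by decide), ?_, fun g hg => ?_⟩
    · rw [NState.set_reg_self]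
      simp only [NE.eval]
      rw [hf7.reg 7 (by decide), hf7.reg 8 (by decide), hd6.S_eq, hd6.r_eq]
    · exact (hc7 g hg).mono hδ (by linarith)

end WordRAM

namespace WordRAM

open Finset

variable {W H : ℕ}

/-! ### The transform along all digits -/

/-- Rounded-down logarithms are superadditive under products. For a radix of at least 2 rounding up
costs at most a factor 2, since `clog ≤ log + 1` and `log ≥ 1`. -/
theorem sum_clog_le {r : ℕ → ℕ} {s : ℕ} (hr : ∀ t < s, 2 ≤ r t) :
    ∑ t ∈ range s, Nat.clog 2 (r t) ≤ 2 * Nat.log 2 (stride r s) := by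
  induction s with
  | zero => simp
  | succ s ih =>
    have h1 := ih fun t ht => hr t (by omega)
    have h2 := hr s (by omega)
    have hpos : 0 < stride r s := stride_pos fun u hu => by have := hr u (by omega); omega
    have h3 : Nat.log 2 (stride r s) + Nat.log 2 (r s) ≤ Nat.log 2 (stride r (s + 1)) := by
      rw [stride_succ]
      refine Nat.le_log_of_pow_le (by norm_num) ?_
      rw [pow_add]
      exact Nat.mul_le_mul (Nat.pow_log_le_self 2 hpos.ne') (Nat.pow_log_le_self 2 (by omega))
    have h4 : Nat.clog 2 (r s) ≤ Nat.log 2 (r s) + 1 :=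
      Nat.clog_le_of_le_pow (Nat.lt_pow_succ_log_self (by norm_num) _).le
    have h5 : 1 ≤ Nat.log 2 (r s) := Nat.le_log_of_pow_le (by norm_num) (by omega)
    rw [sum_range_succ]
    omega

theorem sum_le_stride {r : ℕ → ℕ} {s : ℕ} (hr : ∀ t < s, 2 ≤ r t) :
    ∑ t ∈ range s, r t ≤ stride r s := by
  -- The inequality `a + b ≤ a b` needs both numbers to be at least 2, which fails for the empty
  -- product; the alternative separates that case.
  suffices h : ∑ t ∈ range s, r t ≤ stride r s ∧ (∑ t ∈ range s, r t = 0 ∨ 2 ≤ stride r s) from h.1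
  induction s with
  | zero => simp
  | succ s ih =>
    obtain ⟨h1, h3⟩ := ih fun t ht => hr t (by omega)
    have h2 := hr s (by omega)
    have hpos : 0 < stride r s := stride_pos fun u hu => by have := hr u (by omega); omega
    rw [sum_range_succ, stride_succ]
    refine ⟨?_, Or.inr (by nlinarith)⟩
    rcases h3 with h3 | h3
    · rw [h3, zero_add]
      exact Nat.le_mul_of_pos_left _ hpos
    · nlinarith

/-- The Fourier transform of the array `0`, digit by digit. -/
def transform : Program := .seq (.nset 7 (.nat 1)) (.forLt 6 (.reg 0) (.seq dimSetup dimConv))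

theorem dim_time_le {r n K c N : ℕ} (hr : 2 ≤ r) (hn : 1 ≤ n) (hN : N ≤ 4 * n) :
    (Nat.clog 2 (2 * r) + 1) * (5 * c) + 8 * r * (K + 1) * (23 * c) + 4 * c +
      (Nat.clog 2 (2 * r) + 1) * (N + 1) * (150 * c) + 3 * c ≤
      Nat.clog 2 r * (2272 * n * c) + r * (184 * (K + 1) * c) := by
  have h1 : Nat.clog 2 (2 * r) + 1 ≤ 3 * Nat.clog 2 r := by
    have h2 : Nat.clog 2 (2 * r) ≤ Nat.clog 2 r + 1 := by
      refine Nat.clog_le_of_le_pow ?_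
      rw [pow_succ, mul_comm]
      exact Nat.mul_le_mul_right _ (Nat.le_pow_clog (by norm_num) _)
    have h3 : 0 < Nat.clog 2 r := Nat.clog_pos (by norm_num) hr
    omega
  have h4 : 0 < Nat.clog 2 r := Nat.clog_pos (by norm_num) hr
  calc _ ≤ 3 * Nat.clog 2 r * (5 * c) + 8 * r * (K + 1) * (23 * c) + 4 * c +
        3 * Nat.clog 2 r * (5 * n) * (150 * c) + 3 * c := by gcongr; omega
    _ = Nat.clog 2 r * (1 * (15 * c)) + 1 * (1 * (7 * c)) + Nat.clog 2 r * (2250 * n * c) +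
        r * (184 * (K + 1) * c) := by ring
    _ ≤ Nat.clog 2 r * (n * (15 * c)) + Nat.clog 2 r * (n * (7 * c)) + Nat.clog 2 r * (2250 * n * c) +
        r * (184 * (K + 1) * c) := by gcongr; omega
    _ = _ := by ring

/-- The convolutions contribute `n * ∑ log r t` and the root tables `K * ∑ r t`; both are of order
`n log n` by `sum_clog_le` and `sum_le_stride`. -/
theorem transform_time_le {r : ℕ → ℕ} {s n K κ c : ℕ} (hr : ∀ t < s, 2 ≤ r t) (hn : stride r s = n) (hn2 : 2 ≤ n)
    (hκ : κ = Nat.clog 2 n) (hK : K = 600 * κ) :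
    ∑ t ∈ range s, (Nat.clog 2 (r t) * (2272 * n * c) + r t * (184 * (K + 1) * c)) + 5 * c ≤
      120000 * κ * n * c := by
  have hκ1 : 0 < κ := hκ ▸ Nat.clog_pos (by norm_num) hn2
  rw [sum_add_distrib, ← sum_mul, ← sum_mul]
  have h1 := sum_clog_le hr
  have h2 := sum_le_stride hr
  rw [hn] at h1 h2
  have h3 : Nat.log 2 n ≤ κ := hκ ▸ Nat.log_le_clog 2 n
  calc _ ≤ 2 * κ * (2272 * n * c) + n * (184 * (601 * κ) * c) + 5 * (1 * 1 * c) := by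
        gcongr
        · omega
        · omega
        · omega
    _ ≤ 2 * κ * (2272 * n * c) + n * (184 * (601 * κ) * c) + 5 * (κ * n * c) := by
        gcongr <;> omega
    _ = 115133 * κ * n * c := by ring
    _ ≤ _ := by gcongr; norm_num

/-- The bound for the first `t` digits is `A * (stride r t) ^ 55`, and a digit contributes the
factor `r t ^ 55`, so the invariant reproduces itself and ends with `n ^ 55`. -/
theorem Runs.transform (hF : Fits W H) {n K κ : ℕ} (hK : 600 ≤ K) (hKκ : K = 600 * κ) (hκ : κ = Nat.clog 2 n)
    (hP : Prec H (2 ^ (4 * K)) (acc K) (2 ^ (3 * K))) {h : NState} (hb : h.Bd H) (hc : Consts n K h)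
    {r : ℕ → ℕ} {s : ℕ} (hs : h.reg 0 = s) (hr : ∀ t < s, h.mem 0 t = r t) (hr2 : ∀ t < s, 2 ≤ r t)
    (hn : stride r s = n) (hn2 : 2 ≤ n) (hnH : 4 * n ≤ H) {A : ℝ} (hA : 1 ≤ A) (hAM : A * n ^ 55 ≤ 2 ^ (3 * K))
    {x : ℕ → ℂ} (hx : ∀ p < n, Cl (acc K) A (h.carr 0 p) (x p)) :
    Runs W H WordRAM.transform h (120000 * κ * n * costBound) (fun h' =>
      h.Frame [6, 7, 8, 9, 10, 11, 12, 14, 15, 16, 20] [0, 1, 2, 3, 4, 5] h' ∧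
        ∀ p < n, Cl (acc K) (A * n ^ 55) (h'.carr 0 p) (dft r x s p)) := by
  have hcB : 100 ≤ costBound := by decide
  have h64 := hF.two_le
  have hrpos : ∀ u < s, 0 < r u := fun u hu => by have := hr2 u hu; omega
  refine (Runs.seq (Runs.assignNat hF hb (x := 7) (e := .nat 1) (by rfl) (by decide) trivial
      (by simp only [NE.eval]; omega))
    (fun g hgb hg => (Runs.forLt hF (x := 6) (N := .reg 0) s
      (fun t g => h.Frame [6, 7, 8, 9, 10, 11, 12, 14, 15, 16, 20] [0, 1, 2, 3, 4, 5] g ∧ g.reg 7 = stride r t ∧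
        ∀ p < n, Cl (acc K) (A * (stride r t : ℝ) ^ 55) (g.carr 0 p) (dft r x t p))
      -- The quotient `n / (stride r t * r t)` is the number of choices for the higher digits,
      -- written without the witness of divisibility that is only available inside the step.
      (fun t => (Nat.clog 2 (2 * r t) + 1) * (5 * costBound) + 8 * r t * (K + 1) * (23 * costBound) + 4 * costBound +
        (Nat.clog 2 (2 * r t) + 1) * (n / (stride r t * r t) * stride r t * 2 ^ Nat.clog 2 (2 * r t) + 1) *
          (150 * costBound)) (hs ▸ hb.reg_le 0) rfl (by decide)
      (fun t _ g' _ hI => ⟨trivial, ?_⟩) (fun t ht g' hgb' hgt hI => ?_) hgb ?_).mono (le_refl _)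
        (fun h' _ hq => ?_))).mono ?_ (fun _ _ h => h)
  · simp only [NE.eval]; rw [hI.1.reg 0 (by decide), hs]
  · obtain ⟨hf, h7, hcl⟩ := hI
    have hS : 0 < stride r t := stride_pos fun u hu => hrpos u (by omega)
    have hrt := hr2 t ht
    obtain ⟨c, hc'⟩ := stride_dvd (r := r) (show t + 1 ≤ s from ht)
    have hSc : stride r (t + 1) * c = n := by rw [← hc', hn]
    have hle : stride r (t + 1) ≤ n := hn ▸ stride_le_stride ht hrpos
    rw [stride_succ] at hSc hle
    have hc1 : 1 ≤ c := by
      rcases Nat.eq_zero_or_pos c with h0 | h0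
      · rw [h0, mul_zero] at hSc; omega
      · exact h0
    have hdiv : n / (stride r t * r t) = c := by
      rw [← hSc, Nat.mul_div_cancel_left _ (Nat.mul_pos hS (by omega))]
    have hrn : r t ≤ n := le_trans (Nat.le_mul_of_pos_left _ hS) hle
    have hkH := two_pow_clog_le (r := r t) (by omega)
    refine Runs.seq (Runs.dimSetup hF hK hP hgb' (hc.frame hf (by decide) (by decide)) hgt h7
      (by rw [hf.inp 0 (by norm_num), hr t ht]) (by omega) (Nat.mul_pos hS hc1) hSc.symm hnH)
      (fun g1 hgb1 ⟨hf1, hd1⟩ => (Runs.dimConv hF hK hP hgb1 hd1 rfl hS hrt (by omega) (by omega)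
        (A := A * (stride r t : ℝ) ^ 55) (x := dft r x t) ?_ ?_ (fun p hp => ?_)).mono
          (le_of_eq (by rw [hdiv, mul_comm c])) ?_)
    · have : (1 : ℝ) ≤ stride r t := by exact_mod_cast hS
      have := one_le_pow₀ this (n := 55)
      nlinarith
    · refine le_trans ?_ hAM
      have : (stride r t : ℝ) * r t ≤ n := by exact_mod_cast hle
      rw [mul_assoc, ← mul_pow]
      gcongr
    · rw [hf1.carr (by decide)]
      exact hcl p hp
    · rintro g2 - ⟨hf2, h27, hcl2⟩
      have ff := (hf.trans hf1).trans hf2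
      refine ⟨?_, ((ff.mono (by decide) (by decide)).set (by decide) _ :
          h.Frame [6, 7, 8, 9, 10, 11, 12, 14, 15, 16, 20] [0, 1, 2, 3, 4, 5] _), ?_, fun p hp => ?_⟩
      · rw [hf2.reg 6 (by decide), hf1.reg 6 (by decide), hgt]
      · rw [NState.set_reg_ne _ (by decide), h27, stride_succ]
      · have := hcl2 p hp
        rw [mul_assoc, ← mul_pow] at this
        rw [stride_succ]
        push_cast
        exact this
  · subst hg
    refine ⟨((h.frame_set 7 _).mono (by decide) (by decide)).set (by decide) _, ?_, fun p hp => ?_⟩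
    · rw [NState.set_reg_ne _ (by decide), NState.set_reg_self]
      simp [NE.eval, stride]
    · have := hx p hp
      simpa [stride, dft, NState.carr] using this
  · refine ⟨hq.2.1, fun p hp => ?_⟩
    have := hq.2.2.2 p hp
    rwa [hn] at this
  · refine le_trans ?_ (transform_time_le (c := costBound) hr2 hn hn2 hκ hKκ)
    have : ∑ t ∈ range s, ((Nat.clog 2 (2 * r t) + 1) * (5 * costBound) + 8 * r t * (K + 1) * (23 * costBound) +
        4 * costBound + (Nat.clog 2 (2 * r t) + 1) * (n / (stride r t * r t) * stride r t *
          2 ^ Nat.clog 2 (2 * r t) + 1) * (150 * costBound) + 3 * costBound) ≤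
        ∑ t ∈ range s, (Nat.clog 2 (r t) * (2272 * n * costBound) + r t * (184 * (K + 1) * costBound)) := by
      refine sum_le_sum fun t ht => dim_time_le (hr2 t (mem_range.1 ht)) (by omega) ?_
      have hrt := hr2 t (mem_range.1 ht)
      calc _ ≤ n / (stride r t * r t) * stride r t * (4 * r t) := by
            gcongr; exact two_pow_clog_le (by omega)
        _ = 4 * (n / (stride r t * r t) * (stride r t * r t)) := by ring
        _ ≤ _ := by gcongr; exact Nat.div_mul_le_self _ _
    omega

end WordRAM

namespace WordRAM

open Finset

variable {W H : ℕ}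

/-! ### The algorithm -/

/-- Computes the constants of `Consts`. -/
def constProg : Program := .seq orderProg (.seq (logProg 10 2 (.reg 1)) (.seq powProg piProg))

theorem Runs.constProg (hF : Fits W H) {n K κ : ℕ} (hK : 600 ≤ K) (hKκ : K = 600 * κ) (hκ : κ = Nat.clog 2 n)
    (hP : Prec H (2 ^ (4 * K)) (acc K) (2 ^ (3 * K))) (hH : 2 ^ (8 * K) ≤ H) {h : NState} (hb : h.Bd H)
    {r : ℕ → ℕ} {s : ℕ} (hs : h.reg 0 = s) (hr : ∀ t < s, h.mem 0 t = r t) (hr2 : ∀ t < s, 2 ≤ r t)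
    (hn : stride r s = n) (h6 : h.carr 6 0 = 0) :
    Runs W H WordRAM.constProg h ((s + 1) * (6 * costBound) + ((κ + 1) * (5 * costBound) +
      ((K + 1) * (12 * costBound) + (K + 1) * (50 * costBound)))) (fun h' =>
      h.Frame [1, 2, 3, 4, 5, 6, 8, 10, 15, 17, 18, 19, 20] [3, 6] h' ∧ Consts n K h') := by
  have hκH : 2 ^ κ ≤ H := le_trans (Nat.pow_le_pow_right (by norm_num) (by omega)) hH
  have hnH : n ≤ H := le_trans (hκ ▸ Nat.le_pow_clog (by norm_num) n) hκH
  refine Runs.seq (Runs.order hF hb (fun u hu => by have := hr2 u hu; omega) hs hr (hn ▸ hnH))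
    (fun g1 hgb1 ⟨hf1, h1⟩ => Runs.seq (hκ ▸ Runs.log hF hgb1 (q := 10) (k := 2) (e := .reg 1) (v := n)
      (by decide) rfl (by decide) (fun g hg => ⟨trivial, ?_⟩) (hκ ▸ hκH)) (fun g2 hgb2 ⟨hf2, _, h2⟩ =>
    Runs.seq (Runs.pow hF hgb2 (K := K) (by rw [h2]; omega) hH) (fun g3 hgb3 ⟨hf3, h33, h34, h35, h317⟩ =>
      (Runs.pi hF hK hP hH hgb3 h33 h35 h317 ?_).mono le_rfl ?_)))
  · simp only [NE.eval]; rw [hg.reg 1 (by decide), h1, hn]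
  · rw [((hf1.trans hf2).trans hf3).carr (by decide), h6]
  · rintro g4 - ⟨hf4, h4⟩
    refine ⟨(((hf1.trans hf2).trans hf3).trans hf4).mono (by decide) (by decide), ?_, ?_, ?_, ?_, ?_, h4⟩
    · rw [hf4.reg 1 (by decide), hf3.reg 1 (by decide), hf2.reg 1 (by decide), h1, hn]
    · rw [hf4.reg 3 (by decide), h33]
    · rw [hf4.reg 4 (by decide), h34]
    · rw [hf4.reg rD (by decide)]; exact h35
    · rw [hf4.reg 17 (by decide), h317]

/-- The array 7 keeps the spectrum of the first table while the array 0 is reused for the second. -/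
def prodE : CE := .conj (.mul (.get 7 (.reg ix)) (.get 0 (.reg ix)))

/-- `1` if the quotient of the real part by the order rounds to a positive integer, and `0` if it rounds
to `0`. -/
def positiveE : Expr :=
  .sub (.const 1) (.floor (.div (.const 1)
    (.add (.const 1) (.floor (.add (.div (.get 4 (.reg ix)) (.reg 1)) (.const (1 / 2)))))))

/-- Convolution of the tables in the arrays `1` and `2`. -/
def convProg : Program :=
  .seq constProg (.seq (.cmap 0 1 (.rget 1 (.reg ix))) (.seq transform (.seq (.cmap 7 1 (copyAt 0))
    (.seq (.cmap 0 1 (.rget 2 (.reg ix))) (.seq transform (.seq (.cmap 3 1 prodE) (.seq (.cmap 0 1 (copyAt 3))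
      -- The result goes to the rational array 3, which is distinct from the complex scratch array 3
      -- stored in the rational arrays 10 and 11.
      (.seq transform (.fill 3 1 positiveE)))))))))

theorem rget_fit1 : (CE.rget 1 (.reg ix)).Fit 0 := ⟨by decide, by decide, by decide, by decide, by decide, by decide⟩

theorem rget_fit2 : (CE.rget 2 (.reg ix)).Fit 0 := ⟨by decide, by decide, by decide, by decide, by decide, by decide⟩

theorem prodE_fit : prodE.Fit 3 := ⟨by decide, by decide, by decide, by decide, by decide, by decide⟩

theorem prec_pow {K : ℕ} (hK : 600 ≤ K) : Prec (2 ^ (8 * K)) (2 ^ (4 * K)) (acc K) (2 ^ (3 * K)) := by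
  refine ⟨by positivity, ?_, (acc_le hK).trans (by norm_num), ?_⟩
  · have h1 := two_pow_div_le hK
    have h2 : (1 : ℝ) / 2 ^ K / 2 ^ K ≤ acc K := by
      rw [acc]
      have h3 : (1 : ℝ) / 2 ^ K ≤ (3 / 4) ^ K := by
        rw [← one_div_pow]; exact pow_le_pow_left₀ (by norm_num) (by norm_num) _
      have h4 : (1 : ℝ) / 2 ^ K / 2 ^ K ≤ 1 / 2 ^ K := div_le_self (by positivity) (one_le_pow₀ (by norm_num))
      have h5 : (0 : ℝ) ≤ (3 / 4) ^ K := by positivity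
      linarith
    push_cast
    exact h1.trans h2
  · have h1 : (1 : ℝ) ≤ 2 ^ (3 * K) := one_le_pow₀ (by norm_num)
    have h2 : (4 : ℝ) ≤ 2 ^ K := by
      calc (4 : ℝ) = 2 ^ 2 := by norm_num
        _ ≤ 2 ^ K := pow_le_pow_right₀ (by norm_num) (by omega)
    push_cast
    calc (2 * 2 ^ (3 * K) + 1) * (2 : ℝ) ^ (4 * K) ≤ (2 ^ K * 2 ^ (3 * K)) * 2 ^ (4 * K) := by
          gcongr; nlinarith
      _ = 2 ^ (8 * K) := by rw [← pow_add, ← pow_add]; congr 1; ring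

theorem convProg_le_prec {n K κ : ℕ} (hKκ : K = 600 * κ) (hκ : n ≤ 2 ^ κ) (hκ1 : 1 ≤ κ) {A : ℝ} {e : ℕ} (hA : A ≤ 96)
    (he : e ≤ 165) (hn1 : 1 ≤ n) : A * (n : ℝ) ^ e ≤ 2 ^ (3 * K) := by
  have h1 : (n : ℝ) ≤ 2 ^ κ := by exact_mod_cast hκ
  have h2 : (1 : ℝ) ≤ n := by exact_mod_cast hn1
  calc A * (n : ℝ) ^ e ≤ 2 ^ 7 * (n : ℝ) ^ 165 := by
        refine mul_le_mul (hA.trans (by norm_num)) (pow_le_pow_right₀ h2 he) (by positivity) (by positivity)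
    _ ≤ 2 ^ 7 * (2 ^ κ) ^ 165 := by gcongr
    _ = 2 ^ (7 + κ * 165) := by rw [← pow_mul, ← pow_add]
    _ ≤ 2 ^ (3 * K) := pow_le_pow_right₀ (by norm_num) (by omega)

/-- Since `(3/4) ^ 3 < 1/2`, the choice `K = 600 κ` gives `acc K ≤ 2 ^ 7 / 2 ^ (200 κ)`, whereas `96
n ^ 165 ≤ 2 ^ (7 + 165 κ)`. -/
theorem error_lt_half {n K κ : ℕ} (hKκ : K = 600 * κ) (hκ : n ≤ 2 ^ κ) (hκ1 : 1 ≤ κ) :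
    96 * (n : ℝ) ^ 165 * acc K < 1 / 2 := by
  have h1 : (n : ℝ) ≤ 2 ^ κ := by exact_mod_cast hκ
  have h2 : acc K ≤ 2 ^ 7 / 2 ^ (200 * κ) := by
    rw [acc, hKκ, show 600 * κ = 3 * (200 * κ) by ring, pow_mul, div_eq_mul_one_div (2 ^ 7 : ℝ), ← one_div_pow]
    gcongr <;> norm_num
  calc 96 * (n : ℝ) ^ 165 * acc K ≤ 2 ^ 7 * (2 ^ κ) ^ 165 * (2 ^ 7 / 2 ^ (200 * κ)) := by
        have := (acc_pos K).le
        gcongr; norm_num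
    _ = 2 ^ (14 + 165 * κ) / 2 ^ (200 * κ) := by
        rw [← pow_mul, pow_add]; ring
    _ < 1 / 2 := by
        rw [div_lt_div_iff₀ (by positivity) (by norm_num), one_mul, ← pow_succ]
        exact pow_lt_pow_right₀ (by norm_num) (by omega)

/-- Dividing by `n ≥ 1` does not enlarge the error, so the quotient stays within 1/2 of the integer
`c`. -/
theorem round_eq {q : ℚ} {w : ℂ} (hw : w.re = q) {n c : ℕ} (hn1 : 1 ≤ n) (hcl : ‖w - n * c‖ < 1 / 2) :
    ⌊q / n + 1 / 2⌋ = (c : ℤ) := by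
  have hn0 : (0 : ℝ) < n := by exact_mod_cast hn1
  have h1 : |(q : ℝ) / n - c| < 1 / 2 := by
    have h2 := (Complex.abs_re_le_norm _).trans_lt hcl
    have h3 : (w - n * c).re = (q : ℝ) - n * c := by simp [hw]
    rw [h3] at h2
    rw [show (q : ℝ) / n - c = ((q : ℝ) - n * c) / n by field_simp, abs_div, abs_of_pos hn0]
    exact (div_le_self (abs_nonneg _) (by exact_mod_cast hn1)).trans_lt h2
  rw [abs_lt] at h1
  rw [Int.floor_eq_iff]
  have h5 : ((((c : ℤ) : ℚ)) : ℝ) ≤ ((q / n + 1 / 2 : ℚ) : ℝ) := by push_cast; linarith [h1.1]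
  have h6 : ((q / n + 1 / 2 : ℚ) : ℝ) < (((((c : ℤ) : ℚ) + 1 : ℚ)) : ℝ) := by push_cast; linarith [h1.2]
  exact ⟨by exact_mod_cast h5, by exact_mod_cast h6⟩

theorem positiveE_spec {h : NState} {n c : ℕ} (hn : h.reg 1 = n) (hn1 : 1 ≤ n) {i : ℕ} (hi : h.reg ix = i)
    (hcl : ‖h.carr 0 i - n * c‖ < 1 / 2) :
    positiveE.Ok h.st ∧ positiveE.eval h.st = if 0 < c then 1 else 0 := by
  have h4 : ⌊h.mem 4 i / n + 1 / 2⌋ = (c : ℤ) := round_eq (w := h.carr 0 i) (by simp [NState.carr]) hn1 hcl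
  have hn0 : (n : ℚ) ≠ 0 := by exact_mod_cast (by omega : n ≠ 0)
  have hc1 : (1 + c : ℚ) ≠ 0 := by positivity
  refine ⟨?_, ?_⟩
  · simp only [positiveE, Expr.Ok, Expr.eval, NState.st, hn, hi, Nat.floor_natCast, h4, Int.cast_natCast]
    exact ⟨trivial, trivial, ⟨trivial, ⟨⟨trivial, i, rfl⟩, trivial, hn0⟩, trivial⟩, hc1⟩
  have h7 : positiveE.eval h.st = 1 - ((⌊(1 : ℚ) / (1 + c)⌋ : ℤ) : ℚ) := by
    simp only [positiveE, Expr.eval, NState.st, hn, hi, Nat.floor_natCast, h4, Int.cast_natCast]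
  rw [h7]
  split_ifs with hc
  · have h8 : ⌊(1 : ℚ) / (1 + c)⌋ = 0 := by
      rw [Int.floor_eq_zero_iff]
      have hc0 : (0 : ℚ) < c := by exact_mod_cast hc
      exact ⟨by positivity, by rw [div_lt_one (by positivity)]; linarith⟩
    rw [h8]; simp
  · rw [show c = 0 by omega]; simp

theorem conv_time_le {s n K κ c : ℕ} (hs : s ≤ n) (hn : 1 ≤ n) (hκ : 1 ≤ κ) (hK : K = 600 * κ) :
    (s + 1) * (6 * c) + ((κ + 1) * (5 * c) + ((K + 1) * (12 * c) + (K + 1) * (50 * c))) +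
      ((n + 1) * (10 * c) + (120000 * κ * n * c + ((n + 1) * (10 * c) + ((n + 1) * (10 * c) +
        (120000 * κ * n * c + ((n + 1) * (10 * c) + ((n + 1) * (10 * c) + (120000 * κ * n * c +
          (n + 1) * (5 * c))))))))) ≤ 500000 * κ * n * c := by
  calc _ ≤ (n + n) * (6 * c) + ((κ + κ) * (5 * c) + ((601 * κ) * (12 * c) + (601 * κ) * (50 * c))) +
      ((n + n) * (10 * c) + (120000 * κ * n * c + ((n + n) * (10 * c) + ((n + n) * (10 * c) +
        (120000 * κ * n * c + ((n + n) * (10 * c) + ((n + n) * (10 * c) + (120000 * κ * n * c +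
          (n + n) * (5 * c))))))))) := by gcongr <;> omega
    _ = 360000 * κ * n * c + 1 * n * (122 * c) + κ * 1 * (37272 * c) := by ring
    _ ≤ 360000 * κ * n * c + κ * n * (122 * c) + κ * n * (37272 * c) := by gcongr
    _ = 397394 * κ * n * c := by ring
    _ ≤ _ := by gcongr; norm_num

-- The bounds develop as follows: each spectrum has `2 n ^ 55`, the saved copy of the first `4 n ^
-- 55`, their product `3 * 4 * 2 * n ^ 110 = 24 n ^ 110`, two more roundings give 96, and the last
-- transform gives `96 n ^ 165`, the factor in `error_lt_half`.
open Classical in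
theorem Runs.convProg {n K κ : ℕ} (hF : Fits W (2 ^ (8 * K))) (hKκ : K = 600 * κ) (hκ : κ = Nat.clog 2 n)
    {h : NState} (hb : h.Bd (2 ^ (8 * K)))
    {r : ℕ → ℕ} {s : ℕ} (hs : h.reg 0 = s) (hr : ∀ t < s, h.mem 0 t = r t) (hr2 : ∀ t < s, 2 ≤ r t)
    (hn : stride r s = n) (hn2 : 2 ≤ n) (h6 : h.carr 6 0 = 0) (x y : ℕ → Prop)
    (hx : ∀ p < n, h.mem 1 p = if x p then 1 else 0) (hy : ∀ p < n, h.mem 2 p = if y p then 1 else 0) :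
    Runs W (2 ^ (8 * K)) WordRAM.convProg h (500000 * κ * n * costBound) (fun h' =>
      ∀ p < n, h'.mem 3 p = if 0 < convCount r s x y p then 1 else 0) := by
  have hκ1 : 1 ≤ κ := hκ ▸ Nat.clog_pos (by norm_num) hn2
  have hK6 : 600 ≤ K := by omega
  have hP := prec_pow hK6
  have hδ := hP.nonneg
  have hδ1 := hP.le_one
  have hnκ : n ≤ 2 ^ κ := hκ ▸ Nat.le_pow_clog (by norm_num) n
  have hn1 : 1 ≤ n := by omega
  have hnr : (1 : ℝ) ≤ n := by exact_mod_cast hn1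
  have hone : ∀ e : ℕ, (1 : ℝ) ≤ (n : ℝ) ^ e := fun e => one_le_pow₀ hnr
  have hnH : 4 * n ≤ 2 ^ (8 * K) := by
    calc 4 * n ≤ 2 ^ 2 * 2 ^ κ := Nat.mul_le_mul_left _ hnκ
      _ = 2 ^ (2 + κ) := (pow_add _ _ _).symm
      _ ≤ _ := Nat.pow_le_pow_right (by norm_num) (by omega)
  have hprec : ∀ {A : ℝ} {e : ℕ}, A ≤ 96 → e ≤ 165 → A * (n : ℝ) ^ e ≤ 2 ^ (3 * K) := fun hA he =>
    convProg_le_prec hKκ hnκ hκ1 hA he hn1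
  have hprec0 : ∀ {A : ℝ}, A ≤ 96 → A ≤ 2 ^ (3 * K) := fun hA => by
    simpa using hprec (e := 0) hA (by norm_num)
  have hsn : s ≤ n := by
    rw [← hn]
    calc s = ∑ t ∈ range s, 1 := by simp
      _ ≤ ∑ t ∈ range s, r t := sum_le_sum fun t ht => by have := hr2 t (mem_range.1 ht); omega
      _ ≤ _ := sum_le_stride hr2
  have hind : ∀ (z : ℕ → Prop) (q : ℚ) (p : ℕ), (q = if z p then 1 else 0) →
      Cl (acc K) 1 (((q : ℚ) : ℝ) : ℂ) (if z p then 1 else 0) := by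
    rintro z q p rfl
    rw [Cl]
    split_ifs <;> simp [hδ]
  refine (Runs.seq (Runs.constProg hF hK6 hKκ hκ hP le_rfl hb hs hr hr2 hn h6) (fun g1 hgb1 ⟨hf1, hc1⟩ => ?_)).mono
    (conv_time_le hsn hn1 hκ1 hKκ) (fun _ _ h => h)
  refine Runs.seq (Runs.cmapCl hF hP (a := 0) (y := 1) (e := .rget 1 (.reg ix)) rget_fit1 hgb1 (by decide)
      hc1.n_eq hc1.D_eq (A := 1) (z := fun q => if x q then 1 else 0) le_rfl (hprec0 (by norm_num))
      (fun i _ => trivial) (fun i hi => ?_)) (fun g2 hgb2 ⟨hf2, hq2⟩ => ?_)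
  · refine hind x _ i ?_
    simp only [NE.eval, NState.set_reg_self, NState.set_mem]
    rw [hf1.inp 1 (by norm_num), hx i hi]
  have ff2 := hf1.trans hf2
  have hc2 : Consts n K g2 := hc1.frame hf2 (by decide) (by decide)
  refine Runs.seq (Runs.transform hF hK6 hKκ hκ hP hgb2 hc2 (r := r) (s := s) (by rw [ff2.reg 0 (by decide), hs])
    (fun t ht => by rw [ff2.inp 0 (by norm_num), hr t ht]) hr2 hn hn2 hnH (A := 2) (by norm_num)
    (hprec (by norm_num) (by norm_num)) (fun p hp => (hq2 p hp).mono hδ (by norm_num)))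
    (fun g3 hgb3 ⟨hf3, hq3⟩ => ?_)
  have ff3 := ff2.trans hf3
  have hc3 : Consts n K g3 := hc2.frame hf3 (by decide) (by decide)
  refine Runs.seq (Runs.cmapCl hF hP (a := 7) (y := 1) (copyAt_fit 0 7 (by decide)) hgb3 (by decide)
      hc3.n_eq hc3.D_eq (A := 2 * (n : ℝ) ^ 55) (z := dft r (fun q => if x q then 1 else 0) s)
      (by linarith [hone 55]) (hprec (by norm_num) (by norm_num))
      (fun i _ => trivial) (fun i hi => ?_)) (fun g4 hgb4 ⟨hf4, hq4⟩ => ?_)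
  · simpa only [copyAt, CE.eval, NE.eval, NState.set_reg_self, NState.carr, NState.set_mem] using hq3 i hi
  have ff4 := ff3.trans hf4
  have hc4 : Consts n K g4 := hc3.frame hf4 (by decide) (by decide)
  refine Runs.seq (Runs.cmapCl hF hP (a := 0) (y := 1) (e := .rget 2 (.reg ix)) rget_fit2 hgb4 (by decide)
      hc4.n_eq hc4.D_eq (A := 1) (z := fun q => if y q then 1 else 0) le_rfl (hprec0 (by norm_num))
      (fun i _ => trivial) (fun i hi => ?_)) (fun g5 hgb5 ⟨hf5, hq5⟩ => ?_)
  · refine hind y _ i ?_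
    simp only [NE.eval, NState.set_reg_self, NState.set_mem]
    rw [ff4.inp 2 (by norm_num), hy i hi]
  have ff5 := ff4.trans hf5
  have hc5 : Consts n K g5 := hc4.frame hf5 (by decide) (by decide)
  refine Runs.seq (Runs.transform hF hK6 hKκ hκ hP hgb5 hc5 (r := r) (s := s) (by rw [ff5.reg 0 (by decide), hs])
    (fun t ht => by rw [ff5.inp 0 (by norm_num), hr t ht]) hr2 hn hn2 hnH (A := 2) (by norm_num)
    (hprec (by norm_num) (by norm_num)) (fun p hp => (hq5 p hp).mono hδ (by norm_num)))
    (fun g6 hgb6 ⟨hf6, hq6⟩ => ?_)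
  have ff6 := ff5.trans hf6
  have hc6 : Consts n K g6 := hc5.frame hf6 (by decide) (by decide)
  refine Runs.seq (Runs.cmapCl hF hP (a := 3) (y := 1) prodE_fit hgb6 (by decide)
      hc6.n_eq hc6.D_eq (A := 24 * (n : ℝ) ^ 110)
      (z := fun k => (starRingEnd ℂ) (dft r (fun q => if x q then 1 else 0) s k *
        dft r (fun q => if y q then 1 else 0) s k))
      (by linarith [hone 110]) (hprec (by norm_num) (by norm_num))
      (fun i _ => ⟨trivial, trivial⟩) (fun i hi => ?_)) (fun g7 hgb7 ⟨hf7, hq7⟩ => ?_)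
  · have h1 := hq4 i hi
    rw [← (hf5.trans hf6).carr (a := 7) (by decide)] at h1
    exact ((Cl.mul hδ hδ1 h1 (hq6 i hi)).mono hδ (le_of_eq (by ring))).conj
  have ff7 := ff6.trans hf7
  have hc7 : Consts n K g7 := hc6.frame hf7 (by decide) (by decide)
  refine Runs.seq (Runs.cmapCl hF hP (a := 0) (y := 1) (copyAt_fit 3 0 (by decide)) hgb7 (by decide)
      hc7.n_eq hc7.D_eq (A := 48 * (n : ℝ) ^ 110)
      (z := fun k => (starRingEnd ℂ) (dft r (fun q => if x q then 1 else 0) s k *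
        dft r (fun q => if y q then 1 else 0) s k))
      (by linarith [hone 110]) (hprec (by norm_num) (by norm_num))
      (fun i _ => trivial) (fun i hi => ?_)) (fun g8 hgb8 ⟨hf8, hq8⟩ => ?_)
  · have := (hq7 i hi).mono hδ (B := 48 * (n : ℝ) ^ 110) (le_of_eq (by ring))
    simpa only [copyAt, CE.eval, NE.eval, NState.set_reg_self, NState.carr, NState.set_mem] using this
  have ff8 := ff7.trans hf8
  have hc8 : Consts n K g8 := hc7.frame hf8 (by decide) (by decide)
  refine Runs.seq (Runs.transform hF hK6 hKκ hκ hP hgb8 hc8 (r := r) (s := s) (by rw [ff8.reg 0 (by decide), hs])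
    (fun t ht => by rw [ff8.inp 0 (by norm_num), hr t ht]) hr2 hn hn2 hnH (A := 96 * (n : ℝ) ^ 110)
    (by linarith [hone 110]) (by rw [mul_assoc, ← pow_add]; exact hprec (by norm_num) (by norm_num))
    (fun p hp => (hq8 p hp).mono hδ (le_of_eq (by ring)))) (fun g9 hgb9 ⟨hf9, hq9⟩ => ?_)
  have hc9 : Consts n K g9 := hc8.frame hf9 (by decide) (by decide)
  have hspec : ∀ i < n, positiveE.Ok (g9.set ix i).st ∧ positiveE.eval (g9.set ix i).st =
      if 0 < convCount r s x y i then 1 else 0 := by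
    intro i hi
    refine positiveE_spec (h := g9.set ix i) (n := n) (by simp [hc9.n_eq]) hn1
      (NState.set_reg_self _ _ _) ?_
    have h1 := (hq9 i hi).2
    rw [dft_conj_mul (fun u hu => by have := hr2 u hu; omega) x y (by rw [hn]; exact hi), hn] at h1
    refine lt_of_le_of_lt h1 (lt_of_eq_of_lt ?_ (error_lt_half hKκ hnκ hκ1))
    ring
  refine (Runs.fill hF (fun i => if 0 < convCount r s x y i then 1 else 0) hgb9 (by decide) hc9.n_eq ?_ (by decide)
    (by decide) (fun i hi => (hspec i hi).1) (fun i hi => (hspec i hi).2) (fun i _ => ?_)).mono le_rfl ?_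
  · have h64 := hF.two_le
    have h2 : ht (1 / 2 : ℚ) ≤ 2 ^ (8 * K) := by
      have : ht (1 / 2 : ℚ) = 2 := by norm_num [ht]
      omega
    have h3 : ht (1 : ℚ) ≤ 2 ^ (8 * K) := by
      have : ht (1 : ℚ) = 1 := by norm_num [ht]
      omega
    simp only [positiveE, Expr.ConstLe, h2, h3, and_self]
  · have h64 := hF.two_le
    split_ifs <;> norm_num [ht] <;> omega
  · rintro g - rfl p hp
    simp [NState.write, hp]

end WordRAM

/-! ### Tables of a group with a basis -/

section GroupBasis

open Finset

variable {G : Type*} [AddCommGroup G] {s : ℕ} {b : Fin s → G}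

/-- The orders of the basis elements, extended to all natural numbers. -/
noncomputable def basisOrder (b : Fin s → G) (u : ℕ) : ℕ := if h : u < s then addOrderOf (b ⟨u, h⟩) else 1

theorem basisOrder_val (b : Fin s → G) (j : Fin s) : basisOrder b j = addOrderOf (b j) := by
  simp [basisOrder]

theorem two_le_basisOrder [Fintype G] (hb : ∀ j, b j ≠ 0) {u : ℕ} (hu : u < s) : 2 ≤ basisOrder b u := by
  have h1 : basisOrder b u = addOrderOf (b ⟨u, hu⟩) := basisOrder_val b ⟨u, hu⟩
  have h2 := addOrderOf_pos (b ⟨u, hu⟩)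
  have h3 : addOrderOf (b ⟨u, hu⟩) ≠ 1 := fun h => hb _ (AddMonoid.addOrderOf_eq_one_iff.1 h)
  omega

theorem stride_basisOrder (b : Fin s → G) : WordRAM.stride (basisOrder b) s = ∏ j, addOrderOf (b j) := by
  rw [WordRAM.stride, prod_range]
  simp only [basisOrder_val]

theorem IsGroupBasis.bijective (hb : IsGroupBasis b) :
    Function.Bijective fun i : (j : Fin s) → Fin (addOrderOf (b j)) => ∑ j, (i j : ℕ) • b j :=
  (Function.bijective_iff_existsUnique _).2 hb

theorem IsGroupBasis.prod_eq_card [Fintype G] (hb : IsGroupBasis b) : ∏ j, addOrderOf (b j) = Fintype.card G := by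
  rw [← Fintype.card_of_bijective hb.bijective, Fintype.card_pi]
  simp

/-- This ties the positions used in the statement to the mixed radix digits of the transform; both
are quotients by a product of earlier orders, reduced modulo the current one. -/
theorem finPiFinEquiv_symm_eq_digit (p : Fin (∏ j, addOrderOf (b j))) (j : Fin s) :
    (finPiFinEquiv.symm p j : ℕ) = WordRAM.digit (basisOrder b) j p := by
  have h : (finPiFinEquiv.symm p j : ℕ) =
      p / (∏ k : Fin j, addOrderOf (b (Fin.castLE j.is_lt.le k))) % addOrderOf (b j) := rfl
  rw [h, WordRAM.digit, WordRAM.stride, prod_range, basisOrder_val]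
  congr 2
  refine prod_congr rfl fun k _ => ?_
  rw [← basisOrder_val]
  rfl

theorem tableElem_surjective (hb : IsGroupBasis b) : Function.Surjective (tableElem b) := by
  intro g
  obtain ⟨i, hi⟩ := hb.bijective.2 g
  exact ⟨finPiFinEquiv i, by simpa [tableElem] using hi⟩

/-- Coefficients of `b j` matter only modulo its order, so addition in the group is digitwise
addition with reduction. Uniqueness of the representation gives the converse. -/
theorem tableElem_add_eq_iff [Fintype G] (hb : IsGroupBasis b) (q q' p : Fin (∏ j, addOrderOf (b j))) :
    tableElem b q + tableElem b q' = tableElem b p ↔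
      ∀ u < s, (WordRAM.digit (basisOrder b) u q + WordRAM.digit (basisOrder b) u q') % basisOrder b u =
        WordRAM.digit (basisOrder b) u p := by
  have h1 : tableElem b q + tableElem b q' = ∑ j : Fin s,
      (((⟨(finPiFinEquiv.symm q j + finPiFinEquiv.symm q' j : ℕ) % addOrderOf (b j),
        Nat.mod_lt _ (addOrderOf_pos _)⟩ : Fin (addOrderOf (b j)))) : ℕ) • b j := by
    simp only [tableElem, mod_addOrderOf_nsmul, ← sum_add_distrib, add_nsmul]
  rw [h1, tableElem]
  constructor
  · intro h u hu
    have h2 := congrFun (hb.bijective.1 h) ⟨u, hu⟩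
    rw [Fin.ext_iff] at h2
    simpa only [finPiFinEquiv_symm_eq_digit, ← basisOrder_val] using h2
  · intro h
    refine sum_congr rfl fun j _ => ?_
    congr 1
    simpa only [finPiFinEquiv_symm_eq_digit, ← basisOrder_val] using h j j.2

theorem boolConv_eq_true_iff [Fintype G] {α β : G → Bool} {x : G} :
    boolConv α β x = true ↔ ∃ g, α g = true ∧ β (x - g) = true := by
  have h : (true : Bool) = ⊤ := rfl
  rw [boolConv, h, Finset.sup_eq_top_iff]
  simp

/-- The positions of the table of `α` with the value `1`. -/
def tableSupport (b : Fin s → G) (α : G → Bool) (p : ℕ) : Prop :=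
  ∃ h : p < ∏ j, addOrderOf (b j), α (tableElem b ⟨p, h⟩) = true

theorem boolConv_tableElem [Fintype G] (hb : IsGroupBasis b) (α β : G → Bool) (p : Fin (∏ j, addOrderOf (b j))) :
    boolConv α β (tableElem b p) = true ↔ 0 < WordRAM.convCount (basisOrder b) s (tableSupport b α)
      (tableSupport b β) p := by
  rw [boolConv_eq_true_iff, WordRAM.convCount_pos_iff, stride_basisOrder]
  constructor
  · rintro ⟨g, hg, hg'⟩
    obtain ⟨q, rfl⟩ := tableElem_surjective hb g
    obtain ⟨q', hq'⟩ := tableElem_surjective hb (tableElem b p - tableElem b q)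
    refine ⟨q, q.2, q', q'.2, ⟨q.2, hg⟩, ⟨q'.2, by rwa [← hq'] at hg'⟩, ?_⟩
    exact (tableElem_add_eq_iff hb q q' p).1 (by rw [hq']; abel)
  · rintro ⟨q, hq, q', hq', ⟨_, h1⟩, ⟨_, h2⟩, h3⟩
    refine ⟨tableElem b ⟨q, hq⟩, h1, ?_⟩
    rw [← (tableElem_add_eq_iff hb ⟨q, hq⟩ ⟨q', hq'⟩ p).2 h3, add_sub_cancel_left]
    exact h2

open Classical in
theorem boolTable_eq (b : Fin s → G) (α : G → Bool) (p : ℕ) :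
    boolTable b α p = if tableSupport b α p then 1 else 0 := by
  by_cases h : p < ∏ j, addOrderOf (b j) <;> simp [boolTable, tableSupport, h]

end GroupBasis

namespace WordRAM

open Finset

/-! ### Word size, initial state and conclusion -/

/-- Intermediate results have height at most `2 ^ (8 K * costBound)`, so the word size is linear in
`K`, that is, in `log n`. -/
theorem fits_pow {K : ℕ} (hK : 600 ≤ K) : Fits (2 * (8 * K * costBound + 2)) (2 ^ (8 * K)) := by
  refine ⟨?_, fun q hq => (ratSize_le q).trans ?_⟩
  · calc 64 = 2 ^ 6 := by norm_num
      _ ≤ 2 ^ (8 * K) := Nat.pow_le_pow_right (by norm_num) (by omega)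
  · have : Nat.clog 2 (ht q + 1) ≤ 8 * K * costBound + 1 := by
      refine Nat.clog_le_of_le_pow ?_
      rw [← pow_mul] at hq
      have := Nat.one_le_two_pow (n := 8 * K * costBound)
      rw [pow_succ]
      omega
    omega

/-- Rounding up costs a factor 2 for `n ≥ 2`, and the change to the natural logarithm costs `1 / log
2 < 2`. -/
theorem clog_le_log {n : ℕ} (hn : 2 ≤ n) : (Nat.clog 2 n : ℝ) ≤ 4 * Real.log n := by
  have h1 : Nat.clog 2 n ≤ 2 * Nat.log 2 n := by
    have h4 : Nat.clog 2 n ≤ Nat.log 2 n + 1 :=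
      Nat.clog_le_of_le_pow (Nat.lt_pow_succ_log_self (by norm_num) _).le
    have h5 : 1 ≤ Nat.log 2 n := Nat.le_log_of_pow_le (by norm_num) (by omega)
    omega
  have h2 : (Nat.clog 2 n : ℝ) ≤ 2 * (Nat.log 2 n : ℝ) := by exact_mod_cast h1
  have h3 : (Nat.log 2 n : ℝ) * Real.log 2 ≤ Real.log n := by
    rw [← Real.log_pow]
    refine Real.log_le_log (by positivity) ?_
    exact_mod_cast Nat.pow_log_le_self 2 (by omega)
  have h4 := Real.log_two_gt_d9
  have h5 : (0 : ℝ) ≤ Nat.log 2 n := by positivity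
  nlinarith

/-- The input of the convolution. -/
noncomputable def convStart {G : Type*} [AddCommGroup G] {s : ℕ} (b : Fin s → G) (α β : G → Bool) : NState :=
  ⟨fun x => if x = 0 then s else 0, (convInput b α β).mem⟩

theorem convStart_st {G : Type*} [AddCommGroup G] {s : ℕ} (b : Fin s → G) (α β : G → Bool) :
    (convStart b α β).st = convInput b α β := by
  simp only [NState.st, convStart, convInput, State.mk.injEq, and_true]
  funext x
  split_ifs <;> simp

theorem convStart_bd {G : Type*} [AddCommGroup G] [Fintype G] {s : ℕ} (b : Fin s → G) (α β : G → Bool) {H : ℕ}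
    (hH : 1 ≤ H) (hs : s ≤ H) (ho : ∀ j, addOrderOf (b j) ≤ H) : (convStart b α β).Bd H := by
  classical
  have h0 : ht 0 ≤ H := by simpa [ht] using hH
  have h1 : ht 1 ≤ H := by simpa [ht] using hH
  refine ⟨fun x => ?_, fun a i => ?_⟩
  · simp only [convStart]
    split_ifs <;> omega
  · simp only [convStart, convInput, boolTable_eq]
    split_ifs with _ h <;> first | assumption | skip
    rw [ht_natCast]
    exact max_le (ho _) hH

end WordRAM

theorem mainTheorem6 :
    ∃ (P : WordRAM.Program) (C : ℝ),
      ∀ (G : Type*) [AddCommGroup G] [Fintype G] [Nontrivial G] (s : ℕ) (b : Fin s → G),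
        IsGroupBasis b → (∀ j, b j ≠ 0) →
        ∀ α β : G → Bool, ∃ (W T : ℕ) (τ : WordRAM.State),
          (W : ℝ) ≤ C * Real.log (Fintype.card G) ∧
          (T : ℝ) ≤ C * (Fintype.card G * Real.log (Fintype.card G)) ∧
          WordRAM.Exec W P (convInput b α β) T τ ∧
          ∀ p : Fin (∏ j, addOrderOf (b j)),
            τ.mem 3 p = if boolConv α β (tableElem b p) then 1 else 0 := by
  classical
  -- The running time dictates the constant: `500000 * 20000` steps per unit of `κ n`, and `κ ≤ 4
  -- log n`. The word size needs far less.
  refine ⟨WordRAM.convProg, 40000000000, ?_⟩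
  intro G _ _ _ s b hb hb0 α β
  set n := Fintype.card G with hn
  have hn2 : 2 ≤ n := Fintype.one_lt_card
  set κ := Nat.clog 2 n with hκ
  have hκ1 : 1 ≤ κ := Nat.clog_pos (by norm_num) hn2
  have hnκ : n ≤ 2 ^ κ := Nat.le_pow_clog (by norm_num) n
  have hst : WordRAM.stride (basisOrder b) s = n := by rw [stride_basisOrder, hb.prod_eq_card]
  have hr2 : ∀ u < s, 2 ≤ basisOrder b u := fun u hu => two_le_basisOrder hb0 hu
  have hnH : n ≤ 2 ^ (8 * (600 * κ)) := hnκ.trans (Nat.pow_le_pow_right (by norm_num) (by omega))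
  have hsum := WordRAM.sum_le_stride hr2
  rw [hst] at hsum
  have hle : ∀ u < s, basisOrder b u ≤ n := fun u hu =>
    (Finset.single_le_sum (fun _ _ => Nat.zero_le _) (Finset.mem_range.2 hu)).trans hsum
  have hsn : s ≤ n := by
    refine le_trans ?_ hsum
    calc s = ∑ u ∈ Finset.range s, 1 := by simp
      _ ≤ _ := Finset.sum_le_sum fun u hu => by have := hr2 u (Finset.mem_range.1 hu); omega
  have hlog := WordRAM.clog_le_log hn2
  rw [← hκ] at hlog
  have hcb : WordRAM.costBound = 20000 := rfl
  obtain ⟨T, hT, h', hex, -, hq⟩ := WordRAM.Runs.convProg (n := n) (WordRAM.fits_pow (by omega)) rfl hκ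
    (WordRAM.convStart_bd b α β Nat.one_le_two_pow (hsn.trans hnH) fun j =>
      (basisOrder_val b j ▸ hle j j.2).trans hnH) (r := basisOrder b) (s := s) rfl
    (fun t ht => by simp [WordRAM.convStart, convInput, basisOrder, ht]) hr2 hst hn2
    -- The array 6 is zero in the input, so the summation for `π / 4` needs no initialization.
    (by apply Complex.ext <;> simp [WordRAM.NState.carr, WordRAM.convStart, convInput])
    (tableSupport b α) (tableSupport b β)
    (fun p _ => by simp [WordRAM.convStart, convInput, boolTable_eq])
    (fun p _ => by simp [WordRAM.convStart, convInput, boolTable_eq])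
  rw [WordRAM.convStart_st] at hex
  refine ⟨_, T, h'.st, ?_, ?_, hex, fun p => ?_⟩
  · rw [hcb]
    have h1 : (1 : ℝ) ≤ κ := by exact_mod_cast hκ1
    push_cast
    linarith
  · rw [hcb] at hT
    have h1 : (T : ℝ) ≤ 500000 * κ * n * 20000 := by exact_mod_cast hT
    have h2 : (κ : ℝ) * n ≤ 4 * Real.log n * n := by gcongr
    linarith
  · have h1 := hq p (p.2.trans_eq hb.prod_eq_card)
    simp only [← boolConv_tableElem hb] at h1
    exact h1
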